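/- Work over $\mathbb{C}$. Let $q=x_0x_1+x_2x_3$, and let $\mathbb{C}[y_0,\dots,y_3]$ act on $\mathbb{C}[x_0,\dots,x_3]$ by $y_i=\partial/\partial x_i$. A form $g(y)$ is called apolar if $g(\partial)(q^2)=0$. Let $(q^2)^\perp_3$ be the ($16$-dimensional) space of apolar cubic forms, and let $\mathbb{G}=\mathbb{G}(10,(q^2)^\perp_3)$ be the Grassmannian of its $10$-dimensional subspaces, with the Zariski topology given by its Plücker embedding in $\mathbb{P}(\bigwedge^{10}(q^2)^\perp_3)$. A closed subscheme $\Gamma\subset\mathbb{P}^3$ (with coordinates $y_i$) with saturated homogeneous ideal $I_\Gamma$ is apolar to $q^2$ if every $g\in I_\Gamma$ satisfies $g(\partial)(q^2)=0$. Let $Q^{-1}=\{y_0y_1+y_2y_3=0\}\subset\mathbb{P}^3$ be the inverse quadric, let $p\in Q^{-1}$, let $L\subset Q^{-1}$ be a line through $p$, and let $T_p$ be the tangent plane to $Q^{-1}$ at $p$. Let $V_p\subset\mathbb{G}$ be the closure of the set of the points $[I_{\Gamma,3}]$, where $\Gamma$ runs through the schemes of length ten that are apolar to $q^2$ and contain $p$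 (and $I_{\Gamma,3}$, the space of cubics in $I_\Gamma$, is $10$-dimensional). Then: (a) There is exactly one irreducible component $V_p(0)$ of $V_p$ all of whose members $\Lambda$ satisfy $B_{T_p}\subseteq\Lambda\subseteq A_p$, where $B_{T_p}$ is the set of apolar cubics that vanish on $T_p$, and $A_p$ is the set of apolar cubics whose restriction to $T_p$ is singular at $p$. (b) There is exactly one irreducible component $V_p(1)$ of $V_p$ all of whose members $\Lambda$ satisfy $W_{L,p}\subseteq\Lambda\subseteq U_{L,p}$, where $W_{L,p}$ is the set of apolar cubics that are singular along $L$ and whose restriction to $T_p$ has multiplicity at least $3$ at $p$, and $U_{L,p}$ is the set of apolar cubics whose restriction to $L$ has multiplicity at least $3$ at $p$. (c) Let $I_{ver,p}$ be the vertex ideal: the ideal generated by the apolar cubics that vanish on $L$ and are singular at $p$. Its degree three part is a point of $\mathbb{G}$, and the (set-theoretic) intersection $V_p(0)\cap V_p(1)$ is, in the Plücker embedding, a cone over a smooth conic with vertex $[I_{ver,p,3}]$: it is the union of the lines that join the vertex to the points of a smooth conic in a plane that does not contain the vertex. -/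

import Mathlib

open scoped LinearAlgebra.Projectivization

attribute [local instance] MvPolynomial.gradedAlgebra

noncomputable section

namespace Apolar

/-! ### Projective spaces, Grassmannians, the Zariski topology, cones over conics -/

section Projective

variable {E : Type*} [AddCommGroup E] [Module ℂ E]

/-- The value at `w` of a polynomial function on the vector space `E`: the variables of `f` are the
linear forms on `E`. -/
def evalAt (f : MvPolynomial (Module.Dual ℂ E) ℂ) (w : E) : ℂ :=
  MvPolynomial.eval (fun φ : Module.Dual ℂ E => φ w) f

/-- The Zariski topology of `ℙ(E)`, generated by the complements of the zero loci of
homogeneous polynomials. -/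
@[reducible] def zariskiProj (E : Type*) [AddCommGroup E] [Module ℂ E] : TopologicalSpace (ℙ ℂ E) :=
  TopologicalSpace.generateFrom
    {U | ∃ (n : ℕ) (f : MvPolynomial (Module.Dual ℂ E) ℂ), f.IsHomogeneous n ∧
      U = {P : ℙ ℂ E | evalAt f P.rep ≠ 0}}

/-- `C` is a smooth conic in the projective plane `ℙ(N)` inside `ℙ(E)`: the zero locus of a
nondegenerate ternary quadratic form. -/
def IsConicInPlane (N : Submodule ℂ E) (C : Set (ℙ ℂ E)) : Prop :=
  Module.finrank ℂ N = 3 ∧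
    ∃ Q : QuadraticForm ℂ N, Q.polarBilin.Nondegenerate ∧
      C = {P : ℙ ℂ E | ∃ h : P.rep ∈ N, Q ⟨P.rep, h⟩ = 0}

/-- `X` is a cone with vertex `v` over a smooth conic: the union of the lines that join `v` to the
points of a smooth conic in a plane that does not contain `v`. -/
def IsConeOverConic (v : ℙ ℂ E) (X : Set (ℙ ℂ E)) : Prop :=
  ∃ (N : Submodule ℂ E) (C : Set (ℙ ℂ E)), IsConicInPlane N C ∧ v.rep ∉ N ∧
    X = {P : ℙ ℂ E | ∃ c ∈ C, P.submodule ≤ v.submodule ⊔ c.submodule}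

end Projective

/-- The Grassmannian `𝔾(k, V)` of `k`-dimensional subspaces of `V`. -/
def Gr (k : ℕ) (V : Type*) [AddCommGroup V] [Module ℂ V] : Type _ :=
  {Λ : Submodule ℂ V // Module.finrank ℂ Λ = k}

section Grassmannian

variable {k : ℕ} {V : Type*} [AddCommGroup V] [Module ℂ V]

/-- The line `⋀ᵏ Λ` in `⋀ᵏ V`. -/
def pluckerLine (Λ : Gr k V) : Submodule ℂ (⋀[ℂ]^k V) :=
  LinearMap.range (exteriorPower.map k Λ.1.subtype)

theorem finrank_pluckerLine (Λ : Gr k V) : Module.finrank ℂ (pluckerLine Λ) = 1 := by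
  have hinj : Function.Injective (exteriorPower.map k Λ.1.subtype) :=
    exteriorPower.map_injective_field Λ.1.injective_subtype
  unfold pluckerLine
  rw [LinearMap.finrank_range_of_inj hinj]
  rcases Nat.eq_zero_or_pos k with h | h
  · subst h
    rw [(exteriorPower.zeroEquiv ℂ Λ.1).finrank_eq, Module.finrank_self]
  · have : Module.Finite ℂ Λ.1 := Module.finite_of_finrank_pos (by rw [Λ.2]; exact h)
    rw [exteriorPower.finrank_eq, Λ.2, Nat.choose_self]

/-- The Plücker embedding `𝔾(k, V) → ℙ(⋀ᵏ V)`. -/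
def plucker (Λ : Gr k V) : ℙ ℂ (⋀[ℂ]^k V) :=
  Projectivization.mk'' (pluckerLine Λ) (finrank_pluckerLine Λ)

/-- The Zariski topology of the Grassmannian, as a subvariety of the Plücker space. -/
instance : TopologicalSpace (Gr k V) :=
  TopologicalSpace.induced plucker (zariskiProj _)

end Grassmannian

/-- `Z` is an irreducible component of the subset `X`. -/
def IsComponentOf {α : Type*} [TopologicalSpace α] (X Z : Set α) : Prop :=
  Maximal (fun Y : Set α => IsIrreducible Y ∧ Y ⊆ X) Z

/-! ### Apolarity -/

/-- The polynomial ring in four variables (`x₀,…,x₃` or `y₀,…,y₃`). -/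
abbrev T := MvPolynomial (Fin 4) ℂ

open MvPolynomial in
/-- `g ↦ g(∂/∂x₀,…,∂/∂x₃)(f)`. -/
def diffOn (f : T) : T →ₗ[ℂ] T :=
  (basisMonomials (Fin 4) ℂ).constr ℂ fun m =>
    (pderiv 0)^[m 0] ((pderiv 1)^[m 1] ((pderiv 2)^[m 2] ((pderiv 3)^[m 3] f)))

/-- The quadric `q = x₀x₁ + x₂x₃`. -/
def q : T := MvPolynomial.X 0 * MvPolynomial.X 1 + MvPolynomial.X 2 * MvPolynomial.X 3

/-- The inverse quadric `q⁻¹ = y₀y₁ + y₂y₃`. -/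
def qInv : T := MvPolynomial.X 0 * MvPolynomial.X 1 + MvPolynomial.X 2 * MvPolynomial.X 3

/-- The space `(q²)^⊥_3` of cubic forms apolar to `q²`. -/
def W : Submodule ℂ T :=
  MvPolynomial.homogeneousSubmodule (Fin 4) ℂ 3 ⊓ LinearMap.ker (diffOn (q ^ 2))

/-- The degree `d` part of an ideal. -/
def degPart (I : Ideal T) (d : ℕ) : Submodule ℂ T :=
  I.restrictScalars ℂ ⊓ MvPolynomial.homogeneousSubmodule (Fin 4) ℂ d

/-- The Hilbert function `d ↦ dim (T/I)_d`. -/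
def hilb (I : Ideal T) (d : ℕ) : ℕ :=
  Module.finrank ℂ (MvPolynomial.homogeneousSubmodule (Fin 4) ℂ d ⧸
    (I.restrictScalars ℂ).comap (MvPolynomial.homogeneousSubmodule (Fin 4) ℂ d).subtype)

/-- `I` is the saturated homogeneous ideal of a closed subscheme of `ℙ³` of length `n`. -/
structure IsIdealOfLength (n : ℕ) (I : Ideal T) : Prop where
  homogeneous : I.IsHomogeneous (MvPolynomial.homogeneousSubmodule (Fin 4) ℂ)
  saturated : ∀ g : T, (∀ i, MvPolynomial.X i * g ∈ I) → g ∈ I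
  length : ∀ᶠ d in Filter.atTop, hilb I d = n

/-- A subspace of `(q²)^⊥_3`, as a space of cubic forms. -/
def cubics (Λ : Gr 10 W) : Submodule ℂ T := Λ.1.map W.subtype

/-- The points `[I_{Γ,3}]` of `𝔾(10, (q²)^⊥_3)`, for the schemes `Γ` of length ten that are apolar
to `q²` and contain the point `p`. -/
def apolarThrough (p : Fin 4 → ℂ) : Set (Gr 10 W) :=
  {Λ | ∃ I : Ideal T, IsIdealOfLength 10 I ∧ (∀ g ∈ I, diffOn (q ^ 2) g = 0) ∧
    (∀ g ∈ I, MvPolynomial.eval p g = 0) ∧ cubics Λ = degPart I 3}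

/-- The variety `V_p`. -/
def Vp (p : Fin 4 → ℂ) : Set (Gr 10 W) := closure (apolarThrough p)

/-! ### Spaces of apolar cubics attached to a point `p` and a line `L` -/

/-- The cone over the tangent plane `T_p` to the inverse quadric at `p`. -/
def tangentPlane (p : Fin 4 → ℂ) : Submodule ℂ (Fin 4 → ℂ) :=
  LinearMap.ker (∑ i, MvPolynomial.eval p (MvPolynomial.pderiv i qInv) •
    (LinearMap.proj i : (Fin 4 → ℂ) →ₗ[ℂ] ℂ))

/-- The restriction of the form `g` to the linear space `ℙ(N)` has multiplicity at least `m` at the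
point `p` of `ℙ(N)`: it vanishes to order at least `m` at `p` in every direction in `N`. -/
def MultGE (g : T) (N : Submodule ℂ (Fin 4 → ℂ)) (p : Fin 4 → ℂ) (m : ℕ) : Prop :=
  ∀ z ∈ N, (Polynomial.X : Polynomial ℂ) ^ m ∣
    MvPolynomial.aeval (fun i => Polynomial.C (p i) + Polynomial.C (z i) * Polynomial.X) g

/-- `B_{T_p}`: the apolar cubics that vanish on `T_p`. -/
def B (p : Fin 4 → ℂ) : Set T :=
  {g | g ∈ W ∧ ∀ z ∈ tangentPlane p, MvPolynomial.eval z g = 0}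

/-- `A_p`: the apolar cubics whose restriction to `T_p` is singular at `p`. -/
def A (p : Fin 4 → ℂ) : Set T := {g | g ∈ W ∧ MultGE g (tangentPlane p) p 2}

/-- `W_{L,p}`: the apolar cubics that are singular along `L` and whose restriction to `T_p` has
multiplicity at least three at `p`. -/
def WL (L : Submodule ℂ (Fin 4 → ℂ)) (p : Fin 4 → ℂ) : Set T :=
  {g | g ∈ W ∧ (∀ z ∈ L, MultGE g ⊤ z 2) ∧ MultGE g (tangentPlane p) p 3}

/-- `U_{L,p}`: the apolar cubics whose restriction to `L` has multiplicity at least three at `p`. -/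
def UL (L : Submodule ℂ (Fin 4 → ℂ)) (p : Fin 4 → ℂ) : Set T :=
  {g | g ∈ W ∧ MultGE g L p 3}

/-- The vertex ideal `I_{ver,p}`, generated by the apolar cubics that contain `L` and are singular
at `p`. -/
def vertexIdeal (L : Submodule ℂ (Fin 4 → ℂ)) (p : Fin 4 → ℂ) : Ideal T :=
  Ideal.span {g | g ∈ W ∧ (∀ z ∈ L, MvPolynomial.eval z g = 0) ∧ MultGE g ⊤ p 2}

/-- `Z` is a component of `V_p` all of whose members contain `B_{T_p}` and lie in `A_p`. -/
def IsV0 (p : Fin 4 → ℂ) (Z : Set (Gr 10 W)) : Prop :=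
  IsComponentOf (Vp p) Z ∧ ∀ Λ ∈ Z, B p ⊆ cubics Λ ∧ (cubics Λ : Set T) ⊆ A p

/-- `Z` is a component of `V_p` all of whose members contain `W_{L,p}` and lie in `U_{L,p}`. -/
def IsV1 (L : Submodule ℂ (Fin 4 → ℂ)) (p : Fin 4 → ℂ) (Z : Set (Gr 10 W)) : Prop :=
  IsComponentOf (Vp p) Z ∧ ∀ Λ ∈ Z, WL L p ⊆ cubics Λ ∧ (cubics Λ : Set T) ⊆ UL L p

end Apolar

end

/-! Apolar cubics are the harmonic cubics, so restriction to the inverse quadric ℙ¹ × ℙ¹ identifies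
them with the forms of bidegree (3,3); `harm` lifts the sixteen monomials. Pairing with q² is the
functional `phi`, which is the squared Laplacian at the origin and therefore invariant under
isometries (`phi_sub`). By Witt's argument (`exists_isIsom`) the flag p ∈ L may be taken to be e₀ in
the line z₁ = z₃ = 0.

Suppose first that Γ misses the plane y₀ = 0, so that y₀ is a nonzerodivisor modulo I. Then `phi`,
which kills I, extends twice along multiplication by y₀ (`exists_lift`), to functionals t and θ
killing I. Apolarity and the nondegeneracy of `phi` on quadrics exclude nonzero multiples of y₀ from
I₃. Hence the ten coordinates of bidegree (i,j) with i + j ≥ 3 are coordinates on I₃, and pairing I₃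
with quadrics by t expresses the other six through them: I₃ is a graph whose entries are values of
t. Vanishing at p and the pairing with cubics by θ leave eight parameters subject to the quadratic
equations `IsParam` (`isParam_of_relations`, `exists_isParam_of_le_ideal`). Conversely these
equations make three explicit 10 × 10 matrices commute. The resulting algebra of dimension ten
defines an apolar scheme through p whose cubics are the given member of the family
(`IsRep.cubics_fam`).

The solutions of `IsParam` are covered by three polynomial images of ℂ³, together with the limit of
the first at infinite parameter (`exists_param`). Their closures `comp₀`, `comp₁`, `comp₂` are
irreducible and are told apart by coordinates that vanish on all members. A general Γ misses some
plane obtained from y₀ = 0 by a unipotent isometry fixing p (`exists_chart`). The components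
computed in that moved chart are contained in the union of the standard ones, because lying in the
standard chart is an open condition satisfied at the parameter 0 of the moved family
(`comps_unip_subset`). Thus V_p is exactly the union of the three components (`Vp_eq`).

All members of `comp₀ ∩ comp₁` contain eight fixed basis cubics and have vanishing coordinates at
four others, so they amount to planes in a four-dimensional space. Two linear Plücker relations hold
on `comp₁`; they cut the Klein quadric in a quadric cone y₀y₂ = 6y₁². Every point of it is attained,
if necessary as a limit, and its vertex is the vertex ideal (`isConeOverConic_inter`,
`cubics_vertex`). -/

noncomputable section

namespace Apolar

/-! ### Polynomial functions and polynomial maps on affine space -/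

section Poly

variable {n m : ℕ}

/-- `f` is a polynomial function on `ℂⁿ`. -/
def IsPolyFun (f : (Fin n → ℂ) → ℂ) : Prop :=
  ∃ p : MvPolynomial (Fin n) ℂ, ∀ b, f b = MvPolynomial.eval b p

namespace IsPolyFun

variable {f g : (Fin n → ℂ) → ℂ}

theorem const (c : ℂ) : IsPolyFun fun _ : Fin n → ℂ => c :=
  ⟨MvPolynomial.C c, fun b => by simp⟩

theorem coord (i : Fin n) : IsPolyFun fun b : Fin n → ℂ => b i :=
  ⟨MvPolynomial.X i, fun b => by simp⟩

theorem add (hf : IsPolyFun f) (hg : IsPolyFun g) : IsPolyFun fun b => f b + g b := by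
  obtain ⟨p, hp⟩ := hf
  obtain ⟨r, hr⟩ := hg
  exact ⟨p + r, fun b => by simp [hp, hr]⟩

theorem mul (hf : IsPolyFun f) (hg : IsPolyFun g) : IsPolyFun fun b => f b * g b := by
  obtain ⟨p, hp⟩ := hf
  obtain ⟨r, hr⟩ := hg
  exact ⟨p * r, fun b => by simp [hp, hr]⟩

theorem neg (hf : IsPolyFun f) : IsPolyFun fun b => -f b := by
  obtain ⟨p, hp⟩ := hf
  exact ⟨-p, fun b => by simp [hp]⟩

theorem sub (hf : IsPolyFun f) (hg : IsPolyFun g) : IsPolyFun fun b => f b - g b := by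
  simpa only [sub_eq_add_neg] using hf.add hg.neg

theorem pow (hf : IsPolyFun f) (k : ℕ) : IsPolyFun fun b => f b ^ k := by
  obtain ⟨p, hp⟩ := hf
  exact ⟨p ^ k, fun b => by simp [hp]⟩

theorem div_const (hf : IsPolyFun f) (c : ℂ) : IsPolyFun fun b => f b / c := by
  simpa only [div_eq_mul_inv] using hf.mul (const c⁻¹)

theorem sum {ι : Type*} (s : Finset ι) {f : ι → (Fin n → ℂ) → ℂ} (hf : ∀ i, IsPolyFun (f i)) :
    IsPolyFun fun b => ∑ i ∈ s, f i b := by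
  choose p hp using hf
  exact ⟨∑ i ∈ s, p i, fun b => by simp [hp]⟩

theorem prod {ι : Type*} (s : Finset ι) {f : ι → (Fin n → ℂ) → ℂ} (hf : ∀ i, IsPolyFun (f i)) :
    IsPolyFun fun b => ∏ i ∈ s, f i b := by
  choose p hp using hf
  exact ⟨∏ i ∈ s, p i, fun b => by simp [hp]⟩

theorem comp (hf : IsPolyFun f) {c : (Fin m → ℂ) → Fin n → ℂ}
    (hc : ∀ i, IsPolyFun fun b => c b i) : IsPolyFun fun b => f (c b) := by
  obtain ⟨p, hp⟩ := hf
  choose r hr using hc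
  refine ⟨MvPolynomial.bind₁ r p, fun b => ?_⟩
  have hc : c b = fun i => MvPolynomial.eval b (r i) := funext fun i => hr i b
  change f (c b) = _
  rw [hp, hc, ← MvPolynomial.coe_aeval_eq_eval, ← MvPolynomial.coe_aeval_eq_eval]
  exact (MvPolynomial.aeval_bind₁ _ _ _).symm

end IsPolyFun

variable {E : Type*} [AddCommGroup E] [Module ℂ E]

/-- `F` is a polynomial map from `ℂⁿ` to the vector space `E`. -/
def IsPolyMap (F : (Fin n → ℂ) → E) : Prop :=
  ∀ φ : Module.Dual ℂ E, IsPolyFun fun b => φ (F b)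

namespace IsPolyMap

variable {F G : (Fin n → ℂ) → E}

theorem const (v : E) : IsPolyMap fun _ : Fin n → ℂ => v := fun φ => .const (φ v)

theorem add (hF : IsPolyMap F) (hG : IsPolyMap G) : IsPolyMap fun b => F b + G b := fun φ => by
  simpa only [map_add] using (hF φ).add (hG φ)

theorem sub (hF : IsPolyMap F) (hG : IsPolyMap G) : IsPolyMap fun b => F b - G b := fun φ => by
  simpa only [map_sub] using (hF φ).sub (hG φ)

theorem smul {f : (Fin n → ℂ) → ℂ} (hf : IsPolyFun f) (hF : IsPolyMap F) :
    IsPolyMap fun b => f b • F b := fun φ => by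
  simpa only [map_smul, smul_eq_mul] using hf.mul (hF φ)

/-- Multilinear expansion in a basis of `E` turns the value into a finite sum of products of
coordinates, each polynomial in the parameters. -/
theorem alternatingMap [FiniteDimensional ℂ E] {k : ℕ} {E' : Type*} [AddCommGroup E'] [Module ℂ E']
    (f : E [⋀^Fin k]→ₗ[ℂ] E') {F : (Fin n → ℂ) → Fin k → E}
    (hF : ∀ j, IsPolyMap fun b => F b j) : IsPolyMap fun b => f (F b) := fun φ => by
  let h := Module.finBasis ℂ E
  have key : ∀ b, φ (f (F b)) = ∑ r : Fin k → Fin (Module.finrank ℂ E),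
      (∏ j, h.coord (r j) (F b j)) * φ (f fun j => h (r j)) := fun b => by
    have e : F b = fun j => ∑ i, h.coord i (F b j) • h i :=
      funext fun j => (h.sum_repr (F b j)).symm
    conv_lhs => rw [e]
    rw [← AlternatingMap.coe_multilinearMap, MultilinearMap.map_sum, map_sum]
    refine Finset.sum_congr rfl fun r _ => ?_
    rw [MultilinearMap.map_smul_univ, map_smul, smul_eq_mul, AlternatingMap.coe_multilinearMap]
  simp only [key]
  exact .sum _ fun r => (IsPolyFun.prod _ fun j => hF j _).mul (.const _)

end IsPolyMap

end Poly

/-! ### Points of the Grassmannian and their Plücker coordinates -/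

section Pluecker

open exteriorPower

variable {k : ℕ} {V : Type*} [AddCommGroup V] [Module ℂ V]

/-- The subspace spanned by `k` independent vectors. -/
def grSpan (e : Fin k → V) (he : LinearIndependent ℂ e) : Gr k V :=
  ⟨Submodule.span ℂ (Set.range e), by simpa using finrank_span_eq_card he⟩

theorem exists_dual_coordinates {ι : Type*} [Fintype ι] [DecidableEq ι] {e : ι → V}
    (he : LinearIndependent ℂ e) :
    ∃ α : V →ₗ[ℂ] (ι → ℂ), ∀ j, α (e j) = Pi.single j 1 := by
  obtain ⟨α, hα⟩ := LinearMap.exists_leftInverse_of_injective (Fintype.linearCombination ℂ e)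
    (LinearMap.ker_eq_bot.2 he.fintypeLinearCombination_injective)
  refine ⟨α, fun j => ?_⟩
  have := LinearMap.congr_fun hα (Pi.single j 1)
  simpa [Fintype.linearCombination_apply_single] using this

theorem linearIndependent_of_dual_coordinates {ι : Type*} [Fintype ι] [DecidableEq ι] {e : ι → V}
    (α : V →ₗ[ℂ] (ι → ℂ)) (hα : ∀ j, α (e j) = Pi.single j 1) : LinearIndependent ℂ e := by
  refine LinearIndependent.of_comp α ?_
  have : α ∘ e = Pi.basisFun ℂ ι := by ext j; simp [hα]
  rw [this]
  exact (Pi.basisFun ℂ ι).linearIndependent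

/-- The determinant of the coordinates `α`. -/
def detForm (α : V →ₗ[ℂ] (Fin k → ℂ)) : V [⋀^Fin k]→ₗ[ℂ] ℂ :=
  (Matrix.detRowAlternating (n := Fin k) (R := ℂ)).compLinearMap α

theorem detForm_apply (α : V →ₗ[ℂ] (Fin k → ℂ)) (v : Fin k → V) :
    detForm α v = (Matrix.of fun i j => α (v i) j).det := rfl

theorem ιMulti_ne_zero {e : Fin k → V} (he : LinearIndependent ℂ e) : ιMulti ℂ k e ≠ 0 := by
  obtain ⟨α, hα⟩ := exists_dual_coordinates he
  intro h0
  have h1 : alternatingMapLinearEquiv (detForm α) (ιMulti ℂ k e) = 1 := by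
    rw [alternatingMapLinearEquiv_apply_ιMulti, detForm_apply]
    have : (Matrix.of fun i j => α (e i) j) = 1 := by
      ext i j
      simp [hα, Matrix.one_apply, Pi.single_apply, eq_comm]
    rw [this, Matrix.det_one]
  rw [h0, map_zero] at h1
  exact zero_ne_one h1

theorem exists_spanning_family [FiniteDimensional ℂ V] (Λ : Gr k V) :
    ∃ (e : Fin k → V) (he : LinearIndependent ℂ e), Λ = grSpan e he := by
  let b := Module.finBasisOfFinrankEq ℂ Λ.1 Λ.2
  refine ⟨fun i => (b i : V), b.linearIndependent.map' Λ.1.subtype (Submodule.ker_subtype _),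
    Subtype.ext ?_⟩
  change Λ.1 = Submodule.span ℂ (Set.range fun i => (b i : V))
  have : (Set.range fun i => (b i : V)) = Λ.1.subtype '' Set.range b := by
    rw [← Set.range_comp]; rfl
  rw [this, Submodule.span_image, b.span_eq, Submodule.map_top, Submodule.range_subtype]

theorem eq_span_singleton_of_finrank_eq_one {E : Type*} [AddCommGroup E] [Module ℂ E]
    {S : Submodule ℂ E} (hS : Module.finrank ℂ S = 1) {x : E} (hx : x ∈ S) (hx0 : x ≠ 0) :
    S = ℂ ∙ x := by
  have hne : (⟨x, hx⟩ : S) ≠ 0 := fun h => hx0 (congrArg Subtype.val h)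
  refine le_antisymm (fun y hy => ?_) ((Submodule.span_singleton_le_iff_mem _ _).2 hx)
  obtain ⟨c, hc⟩ := (finrank_eq_one_iff_of_nonzero' _ hne).1 hS ⟨y, hy⟩
  exact Submodule.mem_span_singleton.2 ⟨c, congrArg Subtype.val hc⟩

theorem pluckerLine_grSpan (e : Fin k → V) (he : LinearIndependent ℂ e) :
    pluckerLine (grSpan e he) = ℂ ∙ ιMulti ℂ k e := by
  have hmem : ιMulti ℂ k e ∈ pluckerLine (grSpan e he) :=
    ⟨ιMulti ℂ k fun i => (⟨e i, Submodule.subset_span ⟨i, rfl⟩⟩ : (grSpan e he).1), by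
      rw [map_apply_ιMulti]; rfl⟩
  exact eq_span_singleton_of_finrank_eq_one (finrank_pluckerLine _) hmem (ιMulti_ne_zero he)

theorem plucker_grSpan (e : Fin k → V) (he : LinearIndependent ℂ e) :
    plucker (grSpan e he) = Projectivization.mk ℂ (ιMulti ℂ k e) (ιMulti_ne_zero he) := by
  apply Projectivization.submodule_injective
  rw [plucker, Projectivization.submodule_mk'', Projectivization.submodule_mk, pluckerLine_grSpan]

/-- Nonvanishing at a projective point does not depend on the representative, so the chosen `rep`
may be replaced by an explicit Plücker vector. -/
theorem evalAt_smul {E : Type*} [AddCommGroup E] [Module ℂ E] {d : ℕ}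
    {f : MvPolynomial (Module.Dual ℂ E) ℂ} (hf : f.IsHomogeneous d) (c : ℂ) (w : E) :
    evalAt f (c • w) = c ^ d * evalAt f w := by
  unfold evalAt
  rw [MvPolynomial.eval_eq, MvPolynomial.eval_eq, Finset.mul_sum]
  refine Finset.sum_congr rfl fun m hm => ?_
  have hd := hf (MvPolynomial.mem_support_iff.1 hm)
  have hd' : ∑ i ∈ m.support, m i = d := by
    rw [← hd, Finsupp.weight_apply, Finsupp.sum]
    simp
  simp only [map_smul, smul_eq_mul, mul_pow, Finset.prod_mul_distrib]
  rw [Finset.prod_pow_eq_pow_sum, hd']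
  ring

theorem evalAt_polyMap {n : ℕ} {E : Type*} [AddCommGroup E] [Module ℂ E]
    (f : MvPolynomial (Module.Dual ℂ E) ℂ) {F : (Fin n → ℂ) → E} (hF : IsPolyMap F) :
    IsPolyFun fun b => evalAt f (F b) := by
  choose p hp using hF
  refine ⟨MvPolynomial.bind₁ p f, fun b => ?_⟩
  have hc : (fun φ : Module.Dual ℂ E => φ (F b)) = fun φ => MvPolynomial.eval b (p φ) :=
    funext fun φ => hp φ b
  change MvPolynomial.eval _ f = _
  rw [hc, ← MvPolynomial.coe_aeval_eq_eval, ← MvPolynomial.coe_aeval_eq_eval]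
  exact (MvPolynomial.aeval_bind₁ _ _ _).symm

/-- A map from affine space to the Grassmannian that is continuous in the Zariski topologies. -/
def IsRegularFamily {n : ℕ} (Λ : (Fin n → ℂ) → Gr k V) : Prop :=
  ∀ U : Set (Gr k V), IsOpen U → ∀ b₀, Λ b₀ ∈ U →
    ∃ f, IsPolyFun f ∧ f b₀ ≠ 0 ∧ ∀ b, f b ≠ 0 → Λ b ∈ U

/-- The Plücker vector is the wedge of the spanning vectors, hence polynomial in the parameters.
This settles the generating open sets, and the other cases follow by induction on the generated
topology. -/
theorem isRegularFamily_grSpan [FiniteDimensional ℂ V] {n : ℕ}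
    {F : (Fin n → ℂ) → Fin k → V}
    (hF : ∀ j, IsPolyMap fun b => F b j) (hli : ∀ b, LinearIndependent ℂ (F b)) :
    IsRegularFamily fun b => grSpan (F b) (hli b) := by
  rintro U ⟨O, hO, rfl⟩
  simp only [Set.mem_preimage]
  induction hO with
  | basic O hO =>
    obtain ⟨d, f, hf, rfl⟩ := hO
    intro b₀ hb₀
    have key : ∀ b, evalAt f (plucker (grSpan (F b) (hli b))).rep ≠ 0 ↔
        evalAt f (ιMulti ℂ k (F b)) ≠ 0 := fun b => by
      rw [plucker_grSpan]
      obtain ⟨c, hc⟩ := Projectivization.exists_smul_eq_mk_rep ℂ _ (ιMulti_ne_zero (hli b))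
      rw [← hc, Units.smul_def, evalAt_smul hf, mul_ne_zero_iff]
      simp
    refine ⟨_, evalAt_polyMap f (IsPolyMap.alternatingMap (ιMulti ℂ k) hF), ?_, fun b hb => ?_⟩
    · exact (key b₀).1 hb₀
    · exact (key b).2 hb
  | univ => exact fun b₀ _ => ⟨fun _ => 1, .const 1, one_ne_zero, fun _ _ => trivial⟩
  | inter O₁ O₂ _ _ h₁ h₂ =>
    rintro b₀ ⟨hb₁, hb₂⟩
    obtain ⟨f₁, hf₁, h₁', h₁⟩ := h₁ b₀ hb₁
    obtain ⟨f₂, hf₂, h₂', h₂⟩ := h₂ b₀ hb₂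
    exact ⟨_, hf₁.mul hf₂, mul_ne_zero h₁' h₂', fun b hb =>
      ⟨h₁ b (left_ne_zero_of_mul hb), h₂ b (right_ne_zero_of_mul hb)⟩⟩
  | sUnion S _ h =>
    rintro b₀ ⟨O, hO, hb⟩
    obtain ⟨f, hf, h₁, h₂⟩ := h O hO b₀ hb
    exact ⟨f, hf, h₁, fun b hb => ⟨O, hO, h₂ b hb⟩⟩

namespace IsRegularFamily

variable {n m : ℕ} {Λ : (Fin n → ℂ) → Gr k V}

theorem comp (hΛ : IsRegularFamily Λ) {c : (Fin m → ℂ) → Fin n → ℂ}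
    (hc : ∀ i, IsPolyFun fun b => c b i) : IsRegularFamily fun b => Λ (c b) := fun U hU b₀ hb₀ => by
  obtain ⟨f, hf, h₁, h₂⟩ := hΛ U hU _ hb₀
  exact ⟨_, hf.comp hc, h₁, fun b hb => h₂ _ hb⟩

/-- Nonempty relatively open sets pull back to sets containing nonvanishing loci of nonzero
polynomials; a product of two such polynomials is nonzero somewhere because ℂ is infinite. -/
theorem isIrreducible_range (hΛ : IsRegularFamily Λ) : IsIrreducible (Set.range Λ) := by
  refine ⟨Set.range_nonempty _, ?_⟩
  rintro U₁ U₂ hU₁ hU₂ ⟨_, ⟨b₁, rfl⟩, h₁⟩ ⟨_, ⟨b₂, rfl⟩, h₂⟩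
  obtain ⟨f₁, ⟨p₁, hp₁⟩, hb₁, h₁⟩ := hΛ U₁ hU₁ b₁ h₁
  obtain ⟨f₂, ⟨p₂, hp₂⟩, hb₂, h₂⟩ := hΛ U₂ hU₂ b₂ h₂
  have hp : p₁ * p₂ ≠ 0 := by
    refine mul_ne_zero ?_ ?_
    · rintro rfl; exact hb₁ (by simp [hp₁])
    · rintro rfl; exact hb₂ (by simp [hp₂])
  obtain ⟨b, hb⟩ : ∃ b, MvPolynomial.eval b (p₁ * p₂) ≠ 0 := by
    by_contra! h
    exact hp (MvPolynomial.funext fun b => by simpa using h b)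
  rw [map_mul] at hb
  exact ⟨Λ b, ⟨b, rfl⟩, h₁ b (by rw [hp₁]; exact left_ne_zero_of_mul hb),
    h₂ b (by rw [hp₂]; exact right_ne_zero_of_mul hb)⟩

/-- Allows specialisation: a property known off a hypersurface of the parameter space passes, up to
closure, to every parameter. -/
theorem mem_closure (hΛ : IsRegularFamily Λ) {f : (Fin n → ℂ) → ℂ} (hf : IsPolyFun f)
    {b₁ : Fin n → ℂ} (hb₁ : f b₁ ≠ 0) (b₀ : Fin n → ℂ) {S : Set (Gr k V)}
    (hS : ∀ b, f b ≠ 0 → Λ b ∈ S) : Λ b₀ ∈ closure S := by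
  rw [mem_closure_iff]
  intro U hU hb₀
  obtain ⟨g, ⟨p₁, hp₁⟩, hg, h₁⟩ := hΛ U hU b₀ hb₀
  obtain ⟨p₂, hp₂⟩ := hf
  have hp : p₁ * p₂ ≠ 0 := by
    refine mul_ne_zero ?_ ?_
    · rintro rfl; exact hg (by simp [hp₁])
    · rintro rfl; exact hb₁ (by simp [hp₂])
  obtain ⟨b, hb⟩ : ∃ b, MvPolynomial.eval b (p₁ * p₂) ≠ 0 := by
    by_contra! h
    exact hp (MvPolynomial.funext fun b => by simpa using h b)
  rw [map_mul] at hb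
  exact ⟨Λ b, h₁ b (by rw [hp₁]; exact left_ne_zero_of_mul hb),
    hS b (by rw [hp₂]; exact right_ne_zero_of_mul hb)⟩

end IsRegularFamily

/-! ### Closed subsets of the Grassmannian -/

/-- An alternating form is a linear form on the exterior power, so the condition is a hyperplane
section in the Plücker embedding. -/
theorem isClosed_alternating (f : V [⋀^Fin k]→ₗ[ℂ] ℂ) :
    IsClosed {Λ : Gr k V | ∀ v : Fin k → V, (∀ i, v i ∈ Λ.1) → f v = 0} := by
  rw [← isOpen_compl_iff]
  refine ⟨_, TopologicalSpace.GenerateOpen.basic _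
    ⟨1, MvPolynomial.X (alternatingMapLinearEquiv f), MvPolynomial.isHomogeneous_X _ _, rfl⟩, ?_⟩
  ext Λ
  simp only [Set.mem_preimage, Set.mem_ofPred_eq, Set.mem_compl_iff, not_iff_not]
  have h1 : evalAt (MvPolynomial.X (alternatingMapLinearEquiv f)) (plucker Λ).rep =
      alternatingMapLinearEquiv f (plucker Λ).rep := by simp [evalAt]
  have h2 : pluckerLine Λ = ℂ ∙ (plucker Λ).rep := by
    rw [← Projectivization.submodule_eq, plucker, Projectivization.submodule_mk'']
  rw [h1]
  constructor
  · intro h v hv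
    have hm : ιMulti ℂ k v ∈ pluckerLine Λ :=
      ⟨ιMulti ℂ k fun i => (⟨v i, hv i⟩ : Λ.1), by rw [map_apply_ιMulti]; rfl⟩
    rw [h2, Submodule.mem_span_singleton] at hm
    obtain ⟨c, hc⟩ := hm
    rw [← alternatingMapLinearEquiv_apply_ιMulti f v, ← hc, map_smul, h, smul_zero]
  · intro h
    have hm : (plucker Λ).rep ∈ pluckerLine Λ := h2 ▸ Submodule.mem_span_singleton_self _
    obtain ⟨x, hx⟩ := hm
    have h3 : (alternatingMapLinearEquiv f) ∘ₗ exteriorPower.map k Λ.1.subtype = 0 := by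
      apply linearMap_ext
      ext v
      simpa [Function.comp_def] using h (fun i => v i) fun i => (v i).2
    rw [← hx]
    exact LinearMap.congr_fun h3 x

theorem alternating_eq_zero_of_mem {e : Fin k → V} {f : V [⋀^Fin k]→ₗ[ℂ] ℂ} (he : f e = 0)
    {v : Fin k → V} (hv : ∀ i, v i ∈ Submodule.span ℂ (Set.range e)) : f v = 0 := by
  choose c hc using fun i => (Submodule.mem_span_range_iff_exists_fun ℂ).1 (hv i)
  have hv' : v = fun i => ∑ j, c i j • e j := funext fun i => (hc i).symm
  rw [hv', ← AlternatingMap.coe_multilinearMap, MultilinearMap.map_sum]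
  refine Finset.sum_eq_zero fun r _ => ?_
  rw [MultilinearMap.map_smul_univ, AlternatingMap.coe_multilinearMap]
  by_cases hr : Function.Injective r
  · have hb := Finite.injective_iff_bijective.1 hr
    have := f.map_perm e (Equiv.ofBijective r hb)
    rw [Function.comp_def] at this
    simp only [Equiv.ofBijective_apply] at this
    rw [this, he, smul_zero, smul_zero]
  · rw [Function.not_injective_iff] at hr
    obtain ⟨i, j, hij, hne⟩ := hr
    rw [f.map_eq_zero_of_eq _ (by simp [hij]) hne, smul_zero]

/-- Injectivity of `α` on a subspace of the same dimension `k` is the nonvanishing of one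
determinant, that is, of one Plücker linear form. -/
theorem isOpen_chart [FiniteDimensional ℂ V] (α : V →ₗ[ℂ] (Fin k → ℂ)) :
    IsOpen {Λ : Gr k V | ∀ x ∈ Λ.1, α x = 0 → x = 0} := by
  have : {Λ : Gr k V | ∀ x ∈ Λ.1, α x = 0 → x = 0} =
      {Λ : Gr k V | ∀ v : Fin k → V, (∀ i, v i ∈ Λ.1) → detForm α v = 0}ᶜ := by
    ext Λ
    obtain ⟨e, he, rfl⟩ := exists_spanning_family Λ
    simp only [Set.mem_ofPred_eq, Set.mem_compl_iff]
    have hmem : ∀ x, x ∈ (grSpan e he).1 ↔ ∃ c : Fin k → ℂ, ∑ j, c j • e j = x := fun x =>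
      Submodule.mem_span_range_iff_exists_fun ℂ
    have hα : ∀ c : Fin k → ℂ, α (∑ j, c j • e j) =
        Matrix.vecMul c (Matrix.of fun i j => α (e i) j) := fun c => by
      ext j
      simp [Matrix.vecMul, dotProduct]
    constructor
    · intro h h0
      have hdet := h0 e fun i => Submodule.subset_span ⟨i, rfl⟩
      rw [detForm_apply] at hdet
      obtain ⟨c, hc, hc0⟩ := Matrix.exists_vecMul_eq_zero_iff.2 hdet
      rw [← hα] at hc0
      have h1 := h _ ((hmem _).2 ⟨c, rfl⟩) hc0
      exact hc (funext fun i => (Fintype.linearIndependent_iff.1 he) c h1 i)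
    · intro h x hx hx0
      obtain ⟨c, rfl⟩ := (hmem x).1 hx
      rw [hα] at hx0
      by_cases hc : c = 0
      · simp [hc]
      · refine absurd (fun v hv => alternating_eq_zero_of_mem ?_ hv) h
        rw [detForm_apply]
        exact Matrix.exists_vecMul_eq_zero_iff.1 ⟨c, hc, hx0⟩
  rw [this, isOpen_compl_iff]
  exact isClosed_alternating _

/-- If `w` is not in a subspace, some coordinates kill `w` and stay injective on the subspace; the
chart they define excludes every subspace containing `w`. -/
theorem isClosed_mem [FiniteDimensional ℂ V] (w : V) : IsClosed {Λ : Gr k V | w ∈ Λ.1} := by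
  rw [← isOpen_compl_iff, isOpen_iff_forall_mem_open]
  intro Λ hΛ
  obtain ⟨e, he, rfl⟩ := exists_spanning_family Λ
  have hli : LinearIndependent ℂ (Fin.cons w e : Fin (k + 1) → V) :=
    linearIndependent_finCons.2 ⟨he, hΛ⟩
  obtain ⟨β, hβ⟩ := exists_dual_coordinates hli
  let α : V →ₗ[ℂ] (Fin k → ℂ) := LinearMap.funLeft ℂ ℂ Fin.succ ∘ₗ β
  have hαe : ∀ j, α (e j) = Pi.single j 1 := fun j => by
    have := hβ j.succ
    ext i
    simp only [Fin.cons_succ] at this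
    simp [α, LinearMap.funLeft_apply, this, Pi.single_apply]
  have hαw : α w = 0 := by
    have := hβ 0
    ext i
    simp only [Fin.cons_zero] at this
    simp [α, LinearMap.funLeft_apply, this]
  refine ⟨_, ?_, isOpen_chart α, ?_⟩
  · intro Λ' h' hw
    have := h' w hw hαw
    subst this
    exact hΛ (grSpan e he).1.zero_mem
  · intro x hx hx0
    obtain ⟨c, rfl⟩ := (Submodule.mem_span_range_iff_exists_fun ℂ).1 hx
    have : c = 0 := by
      simp only [map_sum, map_smul, hαe] at hx0
      ext i
      simpa [Finset.sum_apply, Pi.single_apply] using congrFun hx0 i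
    simp [this]

/-- Starting from dual coordinates on a subspace where `κ` is nonzero, replace one of them by `κ`. A
subspace killed by `κ` has a zero column in the resulting determinant and lies outside the chart. -/
theorem isClosed_forall_mem_eq_zero [FiniteDimensional ℂ V] (κ : Module.Dual ℂ V) :
    IsClosed {Λ : Gr k V | ∀ x ∈ Λ.1, κ x = 0} := by
  rw [← isOpen_compl_iff, isOpen_iff_forall_mem_open]
  intro Λ hΛ
  obtain ⟨e, he, rfl⟩ := exists_spanning_family Λ
  obtain ⟨β, hβ⟩ := exists_dual_coordinates he
  obtain ⟨i, hi⟩ : ∃ i, κ (e i) ≠ 0 := by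
    by_contra! h
    refine hΛ fun x hx => ?_
    obtain ⟨c, rfl⟩ := (Submodule.mem_span_range_iff_exists_fun ℂ).1 hx
    simp [h]
  let α : V →ₗ[ℂ] (Fin k → ℂ) := LinearMap.pi (Function.update (fun j => LinearMap.proj j ∘ₗ β) i κ)
  refine ⟨_, ?_, isOpen_chart α, ?_⟩
  · intro Λ' h' h0
    obtain ⟨e', he', rfl⟩ := exists_spanning_family Λ'
    have hdet : (Matrix.of fun r j => α (e' r) j).det = 0 :=
      Matrix.det_eq_zero_of_column_eq_zero i fun r => by
        simp [α, h0 (e' r) (Submodule.subset_span ⟨r, rfl⟩)]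
    obtain ⟨c, hc, hc0⟩ := Matrix.exists_vecMul_eq_zero_iff.2 hdet
    have hα : α (∑ j, c j • e' j) = 0 := by
      rw [← hc0]
      ext j
      simp [Matrix.vecMul, dotProduct]
    have h1 := h' _ ((Submodule.mem_span_range_iff_exists_fun ℂ).2 ⟨c, rfl⟩) hα
    exact hc (funext fun i => (Fintype.linearIndependent_iff.1 he') c h1 i)
  · intro x hx hx0
    obtain ⟨c, rfl⟩ := (Submodule.mem_span_range_iff_exists_fun ℂ).1 hx
    have h1 : ∀ j, j ≠ i → c j = 0 := fun j hj => by
      have := congrFun hx0 j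
      simpa [α, hj, hβ, Pi.single_apply] using this
    have h2 : ∑ j, c j • e j = c i • e i :=
      Finset.sum_eq_single_of_mem i (Finset.mem_univ _) fun j _ hj => by rw [h1 j hj, zero_smul]
    have h3 := congrFun hx0 i
    rw [h2] at h3 ⊢
    have : c i = 0 := by simpa [α, hi] using h3
    rw [this, zero_smul]

end Pluecker

/-! ### The family of ten-dimensional subspaces -/

section Family

variable {V : Type*} [AddCommGroup V] [Module ℂ V] (h : Module.Basis (Fin 4 × Fin 4) ℂ V)

/-- The indices of the leading terms of the members of the family. -/
def lead : Fin 10 → Fin 4 × Fin 4 :=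
  ![(3, 0), (2, 1), (1, 2), (0, 3), (3, 1), (1, 3), (2, 2), (3, 2), (2, 3), (3, 3)]

/-- The coordinates at the leading indices. -/
def leadCoord : V →ₗ[ℂ] (Fin 10 → ℂ) := LinearMap.pi fun j => h.coord (lead j)

/-- The spanning vectors of the member of the family with parameters `w`. -/
def famVec (w : Fin 8 → ℂ) : Fin 10 → V :=
  ![h (3, 0) - (w 2 / 2) • h (0, 2) - w 3 • h (1, 1) - (w 4 / 2) • h (2, 0) - w 0 • h (0, 1),
    h (2, 1) - (w 3 / 6) • h (0, 2) - (w 4 / 3) • h (1, 1) - (w 5 / 6) • h (2, 0),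
    h (1, 2) - (w 4 / 6) • h (0, 2) - (w 5 / 3) • h (1, 1) - (w 6 / 6) • h (2, 0),
    h (0, 3) - (w 5 / 2) • h (0, 2) - w 6 • h (1, 1) - (w 7 / 2) • h (2, 0) - w 1 • h (1, 0),
    h (3, 1) + (w 0 / 2) • h (0, 2),
    h (1, 3) + (w 1 / 2) • h (2, 0),
    h (2, 2), h (3, 2), h (2, 3), h (3, 3)]

theorem leadCoord_famVec (w : Fin 8 → ℂ) (j : Fin 10) :
    leadCoord h (famVec h w j) = Pi.single j 1 := by
  ext i
  fin_cases j <;> fin_cases i <;> simp [leadCoord, lead, famVec]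

theorem linearIndependent_famVec (w : Fin 8 → ℂ) : LinearIndependent ℂ (famVec h w) :=
  linearIndependent_of_dual_coordinates _ (leadCoord_famVec h w)

/-- The member of the family with parameters `w`. -/
def fam (w : Fin 8 → ℂ) : Gr 10 V := grSpan (famVec h w) (linearIndependent_famVec h w)

theorem isRegularFamily_fam : IsRegularFamily (fam h) := by
  have : FiniteDimensional ℂ V := Module.Finite.of_basis h
  refine isRegularFamily_grSpan (fun j => ?_) (linearIndependent_famVec h)
  fin_cases j <;> simp [famVec] <;>
  repeat' first
    | apply IsPolyMap.const
    | apply IsPolyMap.sub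
    | apply IsPolyMap.add
    | apply IsPolyMap.smul
    | apply IsPolyFun.div_const
    | apply IsPolyFun.coord

theorem famVec_mem (w : Fin 8 → ℂ) (j : Fin 10) : famVec h w j ∈ (fam h w).1 :=
  Submodule.subset_span ⟨j, rfl⟩

/-- The member is a graph over the ten leading coordinates; these are its six equations. -/
theorem mem_fam_iff (w : Fin 8 → ℂ) (x : V) : x ∈ (fam h w).1 ↔
    h.repr x (0, 0) = 0 ∧ h.repr x (1, 0) = -w 1 * h.repr x (0, 3) ∧
    h.repr x (0, 1) = -w 0 * h.repr x (3, 0) ∧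
    h.repr x (2, 0) = -(w 4 / 2) * h.repr x (3, 0) - w 5 / 6 * h.repr x (2, 1)
      - w 6 / 6 * h.repr x (1, 2) - w 7 / 2 * h.repr x (0, 3) + w 1 / 2 * h.repr x (1, 3) ∧
    h.repr x (0, 2) = -(w 2 / 2) * h.repr x (3, 0) - w 3 / 6 * h.repr x (2, 1)
      - w 4 / 6 * h.repr x (1, 2) - w 5 / 2 * h.repr x (0, 3) + w 0 / 2 * h.repr x (3, 1) ∧
    h.repr x (1, 1) = -w 3 * h.repr x (3, 0) - w 4 / 3 * h.repr x (2, 1)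
      - w 5 / 3 * h.repr x (1, 2) - w 6 * h.repr x (0, 3) := by
  constructor
  · intro hx
    induction hx using Submodule.span_induction with
    | mem x hx =>
      obtain ⟨j, rfl⟩ := hx
      fin_cases j <;> simp [famVec]
    | zero => simp
    | add x y _ _ hx hy =>
      obtain ⟨x0, x1, x2, x3, x4, x5⟩ := hx
      obtain ⟨y0, y1, y2, y3, y4, y5⟩ := hy
      simp only [map_add, Finsupp.add_apply]
      rw [x0, x1, x2, x3, x4, x5, y0, y1, y2, y3, y4, y5]
      refine ⟨by ring, by ring, by ring, by ring, by ring, by ring⟩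
    | smul c x _ hx =>
      obtain ⟨x0, x1, x2, x3, x4, x5⟩ := hx
      simp only [map_smul, Finsupp.smul_apply, smul_eq_mul]
      rw [x0, x1, x2, x3, x4, x5]
      refine ⟨by ring, by ring, by ring, by ring, by ring, by ring⟩
  · rintro ⟨h0, h1, h2, h3, h4, h5⟩
    have : x = ∑ j, leadCoord h x j • famVec h w j := by
      apply h.repr.injective
      ext ⟨i, j⟩
      rw [map_sum, Finsupp.finsetSum_apply]
      simp only [map_smul, Finsupp.smul_apply, smul_eq_mul, Fin.sum_univ_succ, leadCoord, lead,
        famVec]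
      fin_cases i <;> fin_cases j <;>
        simp [h0, h1, h2, h3, h4, h5] <;> ring
    rw [this]
    exact Submodule.sum_mem _ fun j _ => Submodule.smul_mem _ _ (famVec_mem h w j)

end Family

/-! ### Irreducible components -/

theorem IsIrreducible.subset_or_subset_or_subset {α : Type*} [TopologicalSpace α] {Z A B C : Set α}
    (hZ : IsIrreducible Z) (hA : IsClosed A) (hB : IsClosed B) (hC : IsClosed C)
    (h : Z ⊆ A ∪ B ∪ C) : Z ⊆ A ∨ Z ⊆ B ∨ Z ⊆ C := by
  rcases isPreirreducible_iff_isClosed_union_isClosed.1 hZ.2 _ _ (hA.union hB) hC h with h | h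
  · rcases isPreirreducible_iff_isClosed_union_isClosed.1 hZ.2 _ _ hA hB h with h | h
    · exact .inl h
    · exact .inr (.inl h)
  · exact .inr (.inr h)

theorem isComponentOf_union_iff {α : Type*} [TopologicalSpace α] {A B C Z : Set α}
    (hA : IsClosed A) (hB : IsClosed B) (hC : IsClosed C)
    (iA : IsIrreducible A) (iB : IsIrreducible B) (iC : IsIrreducible C)
    (hAB : ¬A ⊆ B) (hAC : ¬A ⊆ C) (hBA : ¬B ⊆ A) (hBC : ¬B ⊆ C) (hCA : ¬C ⊆ A) (hCB : ¬C ⊆ B) :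
    IsComponentOf (A ∪ B ∪ C) Z ↔ Z = A ∨ Z = B ∨ Z = C := by
  have sA : A ⊆ A ∪ B ∪ C := fun x hx => .inl (.inl hx)
  have sB : B ⊆ A ∪ B ∪ C := fun x hx => .inl (.inr hx)
  have sC : C ⊆ A ∪ B ∪ C := fun x hx => .inr hx
  constructor
  · rintro ⟨⟨hZ, hZs⟩, hmax⟩
    rcases IsIrreducible.subset_or_subset_or_subset hZ hA hB hC hZs with h | h | h
    · exact .inl (h.antisymm (hmax ⟨iA, sA⟩ h))
    · exact .inr (.inl (h.antisymm (hmax ⟨iB, sB⟩ h)))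
    · exact .inr (.inr (h.antisymm (hmax ⟨iC, sC⟩ h)))
  · rintro (rfl | rfl | rfl)
    · refine ⟨⟨iA, sA⟩, ?_⟩
      rintro Y ⟨hY, hYs⟩ hAY
      rcases IsIrreducible.subset_or_subset_or_subset hY hA hB hC hYs with h | h | h
      · exact h
      · exact absurd (hAY.trans h) hAB
      · exact absurd (hAY.trans h) hAC
    · refine ⟨⟨iB, sB⟩, ?_⟩
      rintro Y ⟨hY, hYs⟩ hAY
      rcases IsIrreducible.subset_or_subset_or_subset hY hA hB hC hYs with h | h | h
      · exact absurd (hAY.trans h) hBA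
      · exact h
      · exact absurd (hAY.trans h) hBC
    · refine ⟨⟨iC, sC⟩, ?_⟩
      rintro Y ⟨hY, hYs⟩ hAY
      rcases IsIrreducible.subset_or_subset_or_subset hY hA hB hC hYs with h | h | h
      · exact absurd (hAY.trans h) hCA
      · exact absurd (hAY.trans h) hCB
      · exact h

/-! ### The parameters of ideals, and the three components of the family -/

/-- The equations of the parameters `w` for which the member of the family is the cubic part of an
ideal. -/
structure IsParam (w : Fin 8 → ℂ) : Prop where
  q₁ : 3 * w 2 * w 6 - 2 * w 3 * w 5 - w 4 ^ 2 = 0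
  q₂ : 3 * w 2 * w 7 + w 3 * w 6 - 4 * w 4 * w 5 = 0
  q₃ : 3 * w 3 * w 7 - 2 * w 4 * w 6 - w 5 ^ 2 = 0
  aa : w 0 * w 1 = 0
  a₅ : w 0 * w 5 = 0
  a₆ : w 0 * w 6 = 0
  a₇ : w 0 * w 7 = 0
  c₂ : w 1 * w 2 = 0
  c₃ : w 1 * w 3 = 0
  c₄ : w 1 * w 4 = 0

/-- A parametrization of the main component. -/
def par₀ (s : Fin 3 → ℂ) : Fin 8 → ℂ :=
  ![0, 0, s 0, s 1 + 3 * s 2 * s 0, 2 * s 2 * s 1, -2 * s 2 ^ 2 * s 1 - 18 * s 2 ^ 3 * s 0,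
    -16 * s 2 ^ 3 * s 1 - 36 * s 2 ^ 4 * s 0, -20 * s 2 ^ 4 * s 1 + 36 * s 2 ^ 5 * s 0]

/-- The parametrization of the main component with the parameters in the opposite order. -/
def par₀' (s : Fin 3 → ℂ) : Fin 8 → ℂ :=
  ![0, 0, -20 * s 2 ^ 4 * s 1 + 36 * s 2 ^ 5 * s 0, -16 * s 2 ^ 3 * s 1 - 36 * s 2 ^ 4 * s 0,
    -2 * s 2 ^ 2 * s 1 - 18 * s 2 ^ 3 * s 0, 2 * s 2 * s 1, s 1 + 3 * s 2 * s 0, s 0]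

/-- The parametrization of the component attached to the first ruling. -/
def par₁ (s : Fin 3 → ℂ) : Fin 8 → ℂ := ![s 0, 0, s 1, s 2, 0, 0, 0, 0]

/-- The parametrization of the component attached to the second ruling. -/
def par₂ (s : Fin 3 → ℂ) : Fin 8 → ℂ := ![0, s 0, 0, 0, 0, 0, s 2, s 1]

theorem isPolyFun_par₀ (i : Fin 8) : IsPolyFun fun s => par₀ s i := by
  fin_cases i <;> simp [par₀] <;>
  repeat' first
    | apply IsPolyFun.const
    | apply IsPolyFun.coord
    | apply IsPolyFun.sub
    | apply IsPolyFun.add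
    | apply IsPolyFun.neg
    | apply IsPolyFun.pow
    | apply IsPolyFun.mul

theorem isPolyFun_par₀' (i : Fin 8) : IsPolyFun fun s => par₀' s i := by
  fin_cases i <;> simp [par₀'] <;>
  repeat' first
    | apply IsPolyFun.const
    | apply IsPolyFun.coord
    | apply IsPolyFun.sub
    | apply IsPolyFun.add
    | apply IsPolyFun.neg
    | apply IsPolyFun.pow
    | apply IsPolyFun.mul

theorem isPolyFun_par₁ (i : Fin 8) : IsPolyFun fun s => par₁ s i := by
  fin_cases i <;> simp [par₁] <;> first | apply IsPolyFun.const | apply IsPolyFun.coord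

theorem isPolyFun_par₂ (i : Fin 8) : IsPolyFun fun s => par₂ s i := by
  fin_cases i <;> simp [par₂] <;> first | apply IsPolyFun.const | apply IsPolyFun.coord

theorem isParam_par₀ (s : Fin 3 → ℂ) : IsParam (par₀ s) := by
  constructor <;> simp [par₀] <;> ring

theorem isParam_par₁ (s : Fin 3 → ℂ) : IsParam (par₁ s) := by
  constructor <;> simp [par₁]

theorem isParam_par₂ (s : Fin 3 → ℂ) : IsParam (par₂ s) := by
  constructor <;> simp [par₂]

/-- Both charts describe the same one-parameter family of planes. The ruling parameters correspond
under s₂ ↦ 1/(6s₂), so only s₂ = 0 in the second chart is new. -/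
theorem par₀'_eq_par₀ (s : Fin 3 → ℂ) (hs : s 2 ≠ 0) :
    ∃ r, par₀' s = par₀ r := by
  refine ⟨![-20 * s 2 ^ 4 * s 1 + 36 * s 2 ^ 5 * s 0,
    -16 * s 2 ^ 3 * s 1 - 36 * s 2 ^ 4 * s 0 -
      3 * (6 * s 2)⁻¹ * (-20 * s 2 ^ 4 * s 1 + 36 * s 2 ^ 5 * s 0), (6 * s 2)⁻¹], ?_⟩
  ext i
  fin_cases i <;> simp [par₀, par₀'] <;> field_simp <;> ring

/-- If `w 0` or `w 1` is nonzero, the monomial equations kill most of the others. If both vanish,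
the three quadrics describe a family of planes, and the task is to find a ruling parameter for the
given point. -/
theorem exists_param (w : Fin 8 → ℂ) (hw : IsParam w) :
    (∃ s, w = par₀ s) ∨ (∃ s, w = par₀' s) ∨ (∃ s, w = par₁ s) ∨ ∃ s, w = par₂ s := by
  obtain ⟨q₁, q₂, q₃, aa, a₅, a₆, a₇, c₂, c₃, c₄⟩ := hw
  by_cases h0 : w 0 = 0
  · by_cases h1 : w 1 = 0
    · by_cases h2 : w 2 = 0
      · by_cases h3 : w 3 = 0
        · have h4 : w 4 = 0 := by simpa [h2, h3] using q₁
          have h5 : w 5 = 0 := by simpa [h4, h3] using q₃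
          refine .inr (.inl ⟨![w 7, w 6, 0], ?_⟩)
          ext i
          fin_cases i <;> simp [par₀', h0, h1, h2, h3, h4, h5]
        · refine .inl ⟨![0, w 3, w 4 / (2 * w 3)], ?_⟩
          have e5 : w 5 = -w 4 ^ 2 / (2 * w 3) := by
            field_simp
            linear_combination (-1 : ℂ) * q₁ + 3 * w 6 * h2
          have e6 : w 6 = -2 * w 4 ^ 3 / w 3 ^ 2 := by
            rw [e5, h2] at q₂
            field_simp at q₂ ⊢
            linear_combination q₂ / 2
          have e7 : w 7 = -20 * w 4 ^ 4 / (16 * w 3 ^ 3) := by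
            rw [e5, e6] at q₃
            field_simp at q₃ ⊢
            linear_combination 4 / 3 * q₃
          ext i
          fin_cases i <;> simp [par₀, h0, h1, h2, e5, e6, e7] <;> field_simp <;> ring
      -- The square root of the discriminant splits z² − (w₃/3w₂)z + w₄/6w₂, whose roots `k` and `l`
      -- are the candidate ruling parameters.
      · obtain ⟨c, hc⟩ := IsAlgClosed.exists_pow_nat_eq (w 3 ^ 2 - 6 * w 2 * w 4) (n := 2) two_pos
        obtain ⟨k, l, h3, h4⟩ : ∃ k l, w 3 = 3 * w 2 * (k + l) ∧ w 4 = 6 * w 2 * k * l := by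
          refine ⟨(w 3 + c) / (6 * w 2), (w 3 - c) / (6 * w 2), ?_, ?_⟩
          · field_simp
            ring
          · field_simp
            linear_combination hc
        have h6 : w 6 = 2 * (k + l) * w 5 + 12 * w 2 * k ^ 2 * l ^ 2 := by
          have : w 2 * (w 6 - (2 * (k + l) * w 5 + 12 * w 2 * k ^ 2 * l ^ 2)) = 0 := by
            rw [h3, h4] at q₁
            linear_combination q₁ / 3
          exact sub_eq_zero.1 ((mul_eq_zero.1 this).resolve_left h2)
        have h7 : w 7 = 8 * k * l * w 5 - (k + l) * w 6 := by
          have : w 2 * (w 7 - (8 * k * l * w 5 - (k + l) * w 6)) = 0 := by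
            rw [h3, h4] at q₂
            linear_combination q₂ / 3
          exact sub_eq_zero.1 ((mul_eq_zero.1 this).resolve_left h2)
        -- With `w 6` and `w 7` eliminated, the third quadric is quadratic in `w 5`. Its factors
        -- correspond to choosing `k` or `l` as the ruling parameter.
        have h5 : (w 5 + 6 * w 2 * k ^ 2 * (l + 3 * k)) * (w 5 + 6 * w 2 * l ^ 2 * (k + 3 * l)) =
            0 := by
          rw [h7, h6, h3, h4] at q₃
          linear_combination (-1 : ℂ) * q₃
        rcases mul_eq_zero.1 h5 with h5 | h5
        · refine .inl ⟨![w 2, 3 * w 2 * l, k], ?_⟩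
          have h5 := eq_neg_of_add_eq_zero_left h5
          ext i
          fin_cases i <;> simp [par₀, h0, h1, h7, h6, h5, h4, h3] <;> ring
        · refine .inl ⟨![w 2, 3 * w 2 * k, l], ?_⟩
          have h5 := eq_neg_of_add_eq_zero_left h5
          ext i
          fin_cases i <;> simp [par₀, h0, h1, h7, h6, h5, h4, h3] <;> ring
    · refine .inr (.inr (.inr ⟨![w 1, w 7, w 6], ?_⟩))
      have h2 : w 2 = 0 := (mul_eq_zero.1 c₂).resolve_left h1
      have h3 : w 3 = 0 := (mul_eq_zero.1 c₃).resolve_left h1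
      have h4 : w 4 = 0 := (mul_eq_zero.1 c₄).resolve_left h1
      have h5 : w 5 = 0 := by simpa [h4, h3] using q₃
      ext i
      fin_cases i <;> simp [par₂, h0, h2, h3, h4, h5]
  · refine .inr (.inr (.inl ⟨![w 0, w 2, w 3], ?_⟩))
    have h1 : w 1 = 0 := (mul_eq_zero.1 aa).resolve_left h0
    have h5 : w 5 = 0 := (mul_eq_zero.1 a₅).resolve_left h0
    have h6 : w 6 = 0 := (mul_eq_zero.1 a₆).resolve_left h0
    have h7 : w 7 = 0 := (mul_eq_zero.1 a₇).resolve_left h0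
    have h4 : w 4 = 0 := by simpa [h5, h6] using q₁
    ext i
    fin_cases i <;> simp [par₁, h1, h4, h5, h6, h7]

/-! ### The closed components and the coordinates that separate them. -/

section Components

variable {V : Type*} [AddCommGroup V] [Module ℂ V] (h : Module.Basis (Fin 4 × Fin 4) ℂ V)

/-- The main component. -/
def comp₀ : Set (Gr 10 V) := closure (Set.range fun s => fam h (par₀ s))

/-- The component attached to the first ruling. -/
def comp₁ : Set (Gr 10 V) := closure (Set.range fun s => fam h (par₁ s))

/-- The component attached to the second ruling. -/
def comp₂ : Set (Gr 10 V) := closure (Set.range fun s => fam h (par₂ s))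

theorem isIrreducible_comp₀ : IsIrreducible (comp₀ h) :=
  ((isRegularFamily_fam h).comp isPolyFun_par₀).isIrreducible_range.closure

theorem isIrreducible_comp₁ : IsIrreducible (comp₁ h) :=
  ((isRegularFamily_fam h).comp isPolyFun_par₁).isIrreducible_range.closure

theorem isIrreducible_comp₂ : IsIrreducible (comp₂ h) :=
  ((isRegularFamily_fam h).comp isPolyFun_par₂).isIrreducible_range.closure

/-- Off s₂ = 0 the second chart is covered by the first, so the remaining plane is obtained as a
limit. -/
theorem fam_par₀'_mem (s : Fin 3 → ℂ) : fam h (par₀' s) ∈ comp₀ h := by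
  refine ((isRegularFamily_fam h).comp isPolyFun_par₀').mem_closure (.coord 2) (b₁ := fun _ => 1)
    one_ne_zero s fun b hb => ?_
  obtain ⟨r, hr⟩ := par₀'_eq_par₀ b hb
  exact ⟨r, by simp only [hr]⟩

theorem fam_mem_of_isParam {w : Fin 8 → ℂ} (hw : IsParam w) :
    fam h w ∈ comp₀ h ∪ comp₁ h ∪ comp₂ h := by
  rcases exists_param w hw with ⟨s, rfl⟩ | ⟨s, rfl⟩ | ⟨s, rfl⟩ | ⟨s, rfl⟩
  · exact .inl (.inl (subset_closure ⟨s, rfl⟩))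
  · exact .inl (.inl (fam_par₀'_mem h s))
  · exact .inl (.inr (subset_closure ⟨s, rfl⟩))
  · exact .inr (subset_closure ⟨s, rfl⟩)

variable {h}

/-- Containing a given vector is a closed condition, so it is enough to check it on the parametrized
members. The complementary vanishing statements follow in the same way. -/
theorem mem_of_mem_comp₀ {Λ : Gr 10 V} (hΛ : Λ ∈ comp₀ h) {i : Fin 4 × Fin 4}
    (hi : i ∈ ({(3, 1), (1, 3), (2, 2), (3, 2), (2, 3), (3, 3)} : Set (Fin 4 × Fin 4))) :
    h i ∈ Λ.1 := by
  have := Module.Finite.of_basis h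
  refine closure_minimal ?_ (isClosed_mem (h i)) hΛ
  rintro _ ⟨s, rfl⟩
  refine (mem_fam_iff h _ _).2 ?_
  rcases hi with rfl | rfl | rfl | rfl | rfl | rfl <;> simp [par₀]

theorem repr_eq_zero_of_mem_comp₀ {Λ : Gr 10 V} (hΛ : Λ ∈ comp₀ h) {i : Fin 4 × Fin 4}
    (hi : i ∈ ({(0, 0), (1, 0), (0, 1)} : Set (Fin 4 × Fin 4))) :
    ∀ x ∈ Λ.1, h.repr x i = 0 := by
  have := Module.Finite.of_basis h
  refine closure_minimal ?_ (isClosed_forall_mem_eq_zero (h.coord i)) hΛ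
  rintro _ ⟨s, rfl⟩ x hx
  obtain ⟨h0, h1, h2, -⟩ := (mem_fam_iff h _ _).1 hx
  rcases hi with rfl | rfl | rfl
  · exact h0
  · simpa [par₀] using h1
  · simpa [par₀] using h2

theorem mem_of_mem_comp₁ {Λ : Gr 10 V} (hΛ : Λ ∈ comp₁ h) {i : Fin 4 × Fin 4}
    (hi : i ∈ ({(0, 3), (1, 3), (2, 2), (3, 2), (2, 3), (3, 3), (1, 2)} :
      Set (Fin 4 × Fin 4))) :
    h i ∈ Λ.1 := by
  have := Module.Finite.of_basis h
  refine closure_minimal ?_ (isClosed_mem (h i)) hΛ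
  rintro _ ⟨s, rfl⟩
  refine (mem_fam_iff h _ _).2 ?_
  rcases hi with rfl | rfl | rfl | rfl | rfl | rfl | rfl <;> simp [par₁]

theorem repr_eq_zero_of_mem_comp₁ {Λ : Gr 10 V} (hΛ : Λ ∈ comp₁ h) {i : Fin 4 × Fin 4}
    (hi : i ∈ ({(0, 0), (1, 0), (2, 0)} : Set (Fin 4 × Fin 4))) :
    ∀ x ∈ Λ.1, h.repr x i = 0 := by
  have := Module.Finite.of_basis h
  refine closure_minimal ?_ (isClosed_forall_mem_eq_zero (h.coord i)) hΛ
  rintro _ ⟨s, rfl⟩ x hx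
  obtain ⟨h0, h1, h2, h3, -⟩ := (mem_fam_iff h _ _).1 hx
  rcases hi with rfl | rfl | rfl
  · exact h0
  · simpa [par₁] using h1
  · simpa [par₁] using h3

theorem repr_eq_zero_of_mem_comp₂ {Λ : Gr 10 V} (hΛ : Λ ∈ comp₂ h) {i : Fin 4 × Fin 4}
    (hi : i ∈ ({(0, 1), (0, 2)} : Set (Fin 4 × Fin 4))) :
    ∀ x ∈ Λ.1, h.repr x i = 0 := by
  have := Module.Finite.of_basis h
  refine closure_minimal ?_ (isClosed_forall_mem_eq_zero (h.coord i)) hΛ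
  rintro _ ⟨s, rfl⟩ x hx
  obtain ⟨h0, h1, h2, h3, h4, -⟩ := (mem_fam_iff h _ _).1 hx
  rcases hi with rfl | rfl
  · simpa [par₂] using h2
  · simpa [par₂] using h4

variable (h)

theorem exists_mem_comp₀ : ∃ Λ ∈ comp₀ h, (∃ x ∈ Λ.1, h.repr x (2, 0) ≠ 0) ∧
    ∃ x ∈ Λ.1, h.repr x (0, 2) ≠ 0 :=
  ⟨_, subset_closure ⟨![0, 1, 1], rfl⟩, ⟨_, famVec_mem h _ 0, by simp [famVec, par₀]⟩,
    ⟨_, famVec_mem h _ 1, by simp [famVec, par₀]⟩⟩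

theorem exists_mem_comp₁ : ∃ Λ ∈ comp₁ h, ∃ x ∈ Λ.1, h.repr x (0, 1) ≠ 0 :=
  ⟨_, subset_closure ⟨![1, 0, 0], rfl⟩, _, famVec_mem h _ 0, by simp [famVec, par₁]⟩

theorem exists_mem_comp₂ : ∃ Λ ∈ comp₂ h, (∃ x ∈ Λ.1, h.repr x (1, 0) ≠ 0) ∧
    ∃ x ∈ Λ.1, h.repr x (2, 0) ≠ 0 :=
  ⟨_, subset_closure ⟨![1, 0, 0], rfl⟩, ⟨_, famVec_mem h _ 3, by simp [famVec, par₂]⟩,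
    ⟨_, famVec_mem h _ 5, by simp [famVec, par₂]⟩⟩

theorem isComponentOf_iff (Z : Set (Gr 10 V)) :
    IsComponentOf (comp₀ h ∪ comp₁ h ∪ comp₂ h) Z ↔ Z = comp₀ h ∨ Z = comp₁ h ∨ Z = comp₂ h := by
  obtain ⟨Λ₀, m₀, ⟨x₀, hx₀, n₀⟩, ⟨y₀, hy₀, n₀'⟩⟩ := exists_mem_comp₀ h
  obtain ⟨Λ₁, m₁, ⟨x₁, hx₁, n₁⟩⟩ := exists_mem_comp₁ h
  obtain ⟨Λ₂, m₂, ⟨x₂, hx₂, n₂⟩, -⟩ := exists_mem_comp₂ h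
  refine isComponentOf_union_iff isClosed_closure isClosed_closure isClosed_closure
    (isIrreducible_comp₀ h) (isIrreducible_comp₁ h) (isIrreducible_comp₂ h)
    (fun s => n₀ ?_) (fun s => n₀' ?_) (fun s => n₁ ?_) (fun s => n₁ ?_) (fun s => n₂ ?_)
    fun s => n₂ ?_
  · exact repr_eq_zero_of_mem_comp₁ (s m₀) (by simp) _ hx₀
  · exact repr_eq_zero_of_mem_comp₂ (s m₀) (by simp) _ hy₀
  · exact repr_eq_zero_of_mem_comp₀ (s m₁) (by simp) _ hx₁
  · exact repr_eq_zero_of_mem_comp₂ (s m₁) (by simp) _ hx₁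
  · exact repr_eq_zero_of_mem_comp₀ (s m₂) (by simp) _ hx₂
  · exact repr_eq_zero_of_mem_comp₁ (s m₂) (by simp) _ hx₂

end Components

/-! ### Cones over conics in coordinates -/

/-- The conic is 6y₁² = y₀y₂ in the plane spanned by the first three vectors, and the fourth
coordinate, which the equation does not involve, runs along the lines through the vertex. -/
theorem isConeOverConic_of_coordinates {E : Type*} [AddCommGroup E] [Module ℂ E] {n : Fin 4 → E}
    (hn : LinearIndependent ℂ n) {v : ℙ ℂ E} (hv : v = Projectivization.mk ℂ (n 3) (hn.ne_zero 3))
    {X : Set (ℙ ℂ E)}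
    (hX : ∀ P, P ∈ X ↔ ∃ y : Fin 4 → ℂ, y 0 * y 2 = 6 * y 1 ^ 2 ∧ P.rep = ∑ i, y i • n i) :
    IsConeOverConic v X := by
  obtain ⟨α, hα⟩ := exists_dual_coordinates hn
  have hαs : ∀ y : Fin 4 → ℂ, α (∑ i, y i • n i) = y := fun y => by
    ext j
    simp [hα, Finset.sum_apply, Pi.single_apply]
  let N : Submodule ℂ E := Submodule.span ℂ (Set.range fun i : Fin 3 => n i.castSucc)
  have hN : ∀ x, x ∈ N ↔ ∃ y : Fin 3 → ℂ, ∑ i, y i • n i.castSucc = x := fun x =>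
    Submodule.mem_span_range_iff_exists_fun ℂ
  have hNα : ∀ x ∈ N, x = α x 0 • n 0 + α x 1 • n 1 + α x 2 • n 2 ∧ α x 3 = 0 := fun x hx => by
    obtain ⟨y, rfl⟩ := (hN x).1 hx
    have e : ∑ i, y i • n i.castSucc = ∑ i, (![y 0, y 1, y 2, 0] : Fin 4 → ℂ) i • n i := by
      simp [Fin.sum_univ_succ]
    rw [e, hαs]
    simp [Fin.sum_univ_succ, add_assoc]
  have hNmem : ∀ a b c : ℂ, a • n 0 + b • n 1 + c • n 2 ∈ N := fun a b c =>
    (hN _).2 ⟨![a, b, c], by simp [Fin.sum_univ_succ, add_assoc]⟩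
  let c : Fin 4 → Module.Dual ℂ N := fun i => LinearMap.proj i ∘ₗ α ∘ₗ N.subtype
  let Q : QuadraticForm ℂ N :=
    QuadraticMap.linMulLin (c 0) (c 2) - (6 : ℂ) • QuadraticMap.linMulLin (c 1) (c 1)
  have hQ : ∀ x : N, Q x = α x 0 * α x 2 - 6 * (α x 1 * α x 1) := fun x => rfl
  have hli : LinearIndependent ℂ fun i : Fin 3 => n i.castSucc :=
    hn.comp _ (Fin.castSucc_injective 3)
  obtain ⟨u, hu⟩ := Projectivization.exists_smul_eq_mk_rep ℂ _ (hn.ne_zero 3)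
  have hvs : v.submodule = ℂ ∙ n 3 := by rw [hv, Projectivization.submodule_mk]
  refine ⟨N, {P | ∃ h : P.rep ∈ N, Q ⟨P.rep, h⟩ = 0}, ⟨?_, Q, ?_, rfl⟩, ?_, ?_⟩
  · simpa using finrank_span_eq_card hli
  · have hp : ∀ x y : N, Q.polarBilin x y =
        α x 0 * α y 2 + α y 0 * α x 2 - 12 * (α x 1 * α y 1) := fun x y => by
      rw [QuadraticMap.polarBilin_apply_apply, QuadraticMap.polar, hQ, hQ, hQ]
      simp
      ring
    have hsep : ∀ x : N, (∀ y, Q.polarBilin x y = 0) → x = 0 := fun x hx => by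
      have h0 := hx ⟨_, hNmem 1 0 0⟩
      have h1 := hx ⟨_, hNmem 0 1 0⟩
      have h2 := hx ⟨_, hNmem 0 0 1⟩
      rw [hp] at h0 h1 h2
      simp [hα] at h0 h1 h2
      ext
      rw [(hNα x x.2).1, h0, h1, h2]
      simp
    refine ⟨hsep, fun y hy => hsep y fun x => ?_⟩
    have := hy x
    rw [hp] at this ⊢
    linear_combination this
  · intro h
    have h3 := (hNα _ h).2
    rw [hv, ← hu, Units.smul_def, map_smul, hα] at h3
    simp at h3
  · ext P
    rw [hX]
    constructor
    · rintro ⟨y, hy, hP⟩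
      -- When P is the vertex it lies on every line of the cone, so any point of the conic serves;
      -- `n 0` is one.
      by_cases hz : y 0 • n 0 + y 1 • n 1 + y 2 • n 2 = 0
      · refine ⟨Projectivization.mk ℂ (n 0) (hn.ne_zero 0), ?_, ?_⟩
        · obtain ⟨u, hu⟩ := Projectivization.exists_smul_eq_mk_rep ℂ _ (hn.ne_zero 0)
          have hm : (Projectivization.mk ℂ (n 0) (hn.ne_zero 0)).rep ∈ N := by
            rw [← hu]
            exact N.smul_mem _ (by simpa using hNmem 1 0 0)
          refine ⟨hm, ?_⟩
          rw [hQ]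
          simp [← hu, Units.smul_def, hα]
        · refine le_trans ?_ le_sup_left
          rw [Projectivization.submodule_eq, hP, hvs, Submodule.span_singleton_le_iff_mem,
            Submodule.mem_span_singleton]
          refine ⟨y 3, ?_⟩
          simp only [Fin.sum_univ_four]
          rw [hz, zero_add]
      · refine ⟨Projectivization.mk ℂ _ hz, ?_, ?_⟩
        · obtain ⟨u, hu⟩ := Projectivization.exists_smul_eq_mk_rep ℂ _ hz
          have hm : (Projectivization.mk ℂ _ hz).rep ∈ N := by
            rw [← hu]
            exact N.smul_mem _ (hNmem _ _ _)
          refine ⟨hm, ?_⟩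
          rw [hQ]
          simp [← hu, Units.smul_def, hα]
          linear_combination (u : ℂ) ^ 2 * hy
        · rw [Projectivization.submodule_eq, hP, hvs, Submodule.span_singleton_le_iff_mem,
            Projectivization.submodule_mk]
          simp only [Fin.sum_univ_four]
          exact add_mem (Submodule.mem_sup_right (Submodule.mem_span_singleton_self _))
            (Submodule.mem_sup_left (Submodule.smul_mem _ _ (Submodule.mem_span_singleton_self _)))
    · rintro ⟨C, ⟨hC, hC0⟩, hP⟩
      have hm : P.rep ∈ v.submodule ⊔ C.submodule :=
        hP (by rw [Projectivization.submodule_eq]; exact Submodule.mem_span_singleton_self _)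
      rw [hvs, Projectivization.submodule_eq, Submodule.mem_sup] at hm
      obtain ⟨_, ha, _, hb, hab⟩ := hm
      obtain ⟨a, rfl⟩ := Submodule.mem_span_singleton.1 ha
      obtain ⟨b, rfl⟩ := Submodule.mem_span_singleton.1 hb
      rw [hQ] at hC0
      refine ⟨![b * α C.rep 0, b * α C.rep 1, b * α C.rep 2, a], ?_, ?_⟩
      · simp
        linear_combination b ^ 2 * hC0
      · rw [← hab]
        nth_rw 1 [(hNα _ hC).1]
        simp [Fin.sum_univ_four, mul_smul]
        abel

theorem det_eq_of_block (M : Matrix (Fin 10) (Fin 10) ℂ)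
    (h₁ : ∀ (i : Fin 2) (j : Fin 8), M (Fin.castAdd 8 i) (Fin.natAdd 2 j) = 0)
    (h₂ : ∀ i j : Fin 8, M (Fin.natAdd 2 i) (Fin.natAdd 2 j) = (1 : Matrix (Fin 8) (Fin 8) ℂ) i j) :
    M.det = M 0 0 * M 1 1 - M 0 1 * M 1 0 := by
  let e : Fin 2 ⊕ Fin 8 ≃ Fin 10 := finSumFinEquiv
  rw [← Matrix.det_submatrix_equiv_self e]
  have : M.submatrix e e = Matrix.fromBlocks (M.submatrix (Fin.castAdd 8) (Fin.castAdd 8)) 0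
      (M.submatrix (Fin.natAdd 2) (Fin.castAdd 8)) 1 := by
    ext (i | i) (j | j)
    · rfl
    · exact h₁ i j
    · rfl
    · exact h₂ i j
  rw [this, Matrix.det_fromBlocks_zero₁₂, Matrix.det_one, mul_one, Matrix.det_fin_two]
  rfl

/-! ### Members common to the main component and to that of the first ruling. -/

section Intersection

open exteriorPower

variable {V : Type*} [AddCommGroup V] [Module ℂ V] (h : Module.Basis (Fin 4 × Fin 4) ℂ V)

/-- The vectors `u`, `v`, followed by eight vectors of the basis. -/
def pairVec (u v : V) : Fin 10 → V :=
  ![u, v, h (1, 2), h (0, 3), h (3, 1), h (1, 3), h (2, 2), h (3, 2), h (2, 3), h (3, 3)]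

/-- The indices of the basis vectors in `pairVec`, preceded by `i` and `j`. -/
def pairIdx (i j : Fin 4 × Fin 4) : Fin 10 → Fin 4 × Fin 4 :=
  ![i, j, (1, 2), (0, 3), (3, 1), (1, 3), (2, 2), (3, 2), (2, 3), (3, 3)]

/-- The coordinates at the indices `pairIdx i j`. -/
def pairCoord (i j : Fin 4 × Fin 4) : V →ₗ[ℂ] (Fin 10 → ℂ) :=
  LinearMap.pi fun r => h.coord (pairIdx i j r)

/-- The coordinates of `x` at the eight fixed basis vectors of `pairVec` vanish. -/
def IsFree (x : V) : Prop := ∀ r : Fin 8, h.repr x (pairIdx (0, 0) (0, 0) (Fin.natAdd 2 r)) = 0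

theorem pairIdx_natAdd (i j : Fin 4 × Fin 4) (r : Fin 8) :
    pairIdx i j (Fin.natAdd 2 r) = pairIdx (0, 0) (0, 0) (Fin.natAdd 2 r) := by
  fin_cases r <;> rfl

/-- The eight fixed coordinates contribute an identity block, and the first two vectors vanish
there, so the determinant reduces to a 2 × 2 minor. -/
theorem detForm_pairVec (i j : Fin 4 × Fin 4) (e : Fin 10 → V) (hu : IsFree h (e 0))
    (hv : IsFree h (e 1)) (he : ∀ r s : Fin 8,
      h.repr (e (Fin.natAdd 2 r)) (pairIdx (0, 0) (0, 0) (Fin.natAdd 2 s)) =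
        (1 : Matrix (Fin 8) (Fin 8) ℂ) r s) :
    detForm (pairCoord h i j) e =
      h.repr (e 0) i * h.repr (e 1) j - h.repr (e 0) j * h.repr (e 1) i := by
  rw [detForm_apply, det_eq_of_block]
  · rfl
  · intro a r
    fin_cases a
    · exact (congrArg _ (pairIdx_natAdd i j r)).trans (hu r)
    · exact (congrArg _ (pairIdx_natAdd i j r)).trans (hv r)
  · intro r s
    exact (congrArg _ (pairIdx_natAdd i j s)).trans (he r s)

theorem repr_pairVec (u v : V) (r s : Fin 8) :
    h.repr (pairVec h u v (Fin.natAdd 2 r)) (pairIdx (0, 0) (0, 0) (Fin.natAdd 2 s)) =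
      (1 : Matrix (Fin 8) (Fin 8) ℂ) r s := by
  have e₁ : pairVec h u v (Fin.natAdd 2 r) = h (pairIdx (0, 0) (0, 0) (Fin.natAdd 2 r)) := by
    fin_cases r <;> rfl
  have e₂ : Function.Injective fun r : Fin 8 => pairIdx (0, 0) (0, 0) (Fin.natAdd 2 r) := by
    decide
  rw [e₁, h.repr_self, Finsupp.single_apply, Matrix.one_apply]
  exact if_congr e₂.eq_iff rfl rfl

/-- The relation between the Plücker coordinates on the component attached to the first ruling. -/
def ruledForm : V [⋀^Fin 10]→ₗ[ℂ] ℂ :=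
  detForm (pairCoord h (1, 1) (2, 1)) - (6 : ℂ) • detForm (pairCoord h (3, 0) (0, 2))

/-- The lists `famVec` and `pairVec` have the same order. -/
theorem repr_famVec_par₁ (t : Fin 3 → ℂ) (r s : Fin 8) :
    h.repr (famVec h (par₁ t) (Fin.natAdd 2 r)) (pairIdx (0, 0) (0, 0) (Fin.natAdd 2 s)) =
      (1 : Matrix (Fin 8) (Fin 8) ℂ) r s := by
  rw [← repr_pairVec h 0 0]
  fin_cases r <;> fin_cases s <;> simp [famVec, pairVec, pairIdx, par₁]

theorem isFree_famVec_par₁ (t : Fin 3 → ℂ) :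
    IsFree h (famVec h (par₁ t) 0) ∧ IsFree h (famVec h (par₁ t) 1) := by
  constructor <;> intro r <;> fin_cases r <;> simp [famVec, pairIdx]

variable {h}

/-- On a parametrized member the coefficient `w 3` occurs as −w₃ at (1,1) in the first vector and as
−w₃/6 at (0,2) in the second. This gives the factor 6; both relations are Plücker-linear and survive
the closure. -/
theorem forms_eq_zero_of_mem_comp₁ {Λ : Gr 10 V} (hΛ : Λ ∈ comp₁ h) {v : Fin 10 → V}
    (hv : ∀ i, v i ∈ Λ.1) :
    detForm (pairCoord h (3, 0) (1, 1)) v = 0 ∧ ruledForm h v = 0 := by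
  constructor
  · refine closure_minimal ?_ (isClosed_alternating _) hΛ v hv
    rintro _ ⟨s, rfl⟩ w hw
    refine alternating_eq_zero_of_mem ?_ hw
    rw [detForm_pairVec h _ _ _ (isFree_famVec_par₁ h s).1 (isFree_famVec_par₁ h s).2
      (repr_famVec_par₁ h s)]
    simp [famVec, par₁]
  · refine closure_minimal ?_ (isClosed_alternating _) hΛ v hv
    rintro _ ⟨s, rfl⟩ w hw
    refine alternating_eq_zero_of_mem ?_ hw
    rw [ruledForm, AlternatingMap.sub_apply, AlternatingMap.smul_apply,
      detForm_pairVec h _ _ _ (isFree_famVec_par₁ h s).1 (isFree_famVec_par₁ h s).2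
      (repr_famVec_par₁ h s), detForm_pairVec h _ _ _ (isFree_famVec_par₁ h s).1
      (isFree_famVec_par₁ h s).2 (repr_famVec_par₁ h s)]
    simp [famVec, par₁]
    ring

theorem exists_ne_zero_of_finrank_lt {k m : ℕ} [FiniteDimensional ℂ V] (Λ : Gr k V) (hm : m < k)
    (β : V →ₗ[ℂ] (Fin m → ℂ)) : ∃ x ∈ Λ.1, x ≠ 0 ∧ β x = 0 := by
  have := LinearMap.ker_ne_bot_of_finrank_lt (f := β ∘ₗ Λ.1.subtype) (by simp [Λ.2, hm])
  obtain ⟨x, hx, hx0⟩ := Submodule.exists_mem_ne_zero_of_ne_bot this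
  exact ⟨x, x.2, fun h => hx0 (Subtype.ext h), hx⟩

theorem eq_grSpan_of_mem {k : ℕ} [FiniteDimensional ℂ V] {Λ : Gr k V} {e : Fin k → V}
    (he : LinearIndependent ℂ e) (hm : ∀ j, e j ∈ Λ.1) : Λ = grSpan e he := by
  refine Subtype.ext (Submodule.eq_of_le_of_finrank_eq ?_ ?_).symm
  · exact Submodule.span_le.2 (Set.range_subset_iff.2 hm)
  · rw [(grSpan e he).2, Λ.2]

theorem linearIndependent_pairVec {u v : V} (hu : IsFree h u) (hv : IsFree h v)
    {i j : Fin 4 × Fin 4} (hne : h.repr u i * h.repr v j - h.repr u j * h.repr v i ≠ 0) :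
    LinearIndependent ℂ (pairVec h u v) := by
  by_contra hli
  refine hne ?_
  rw [← (detForm (pairCoord h i j)).map_linearDependent _ hli,
    detForm_pairVec h i j _ hu hv (repr_pairVec h u v)]
  rfl

theorem isFree_iff (x : V) : IsFree h x ↔ h.repr x (1, 2) = 0 ∧ h.repr x (0, 3) = 0 ∧
    h.repr x (3, 1) = 0 ∧ h.repr x (1, 3) = 0 ∧ h.repr x (2, 2) = 0 ∧ h.repr x (3, 2) = 0 ∧
    h.repr x (2, 3) = 0 ∧ h.repr x (3, 3) = 0 := by
  constructor
  · intro hx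
    exact ⟨hx 0, hx 1, hx 2, hx 3, hx 4, hx 5, hx 6, hx 7⟩
  · rintro ⟨h0, h1, h2, h3, h4, h5, h6, h7⟩ r
    fin_cases r
    exacts [h0, h1, h2, h3, h4, h5, h6, h7]

/-- The members of the intersection of the components are spanned by eight basis vectors and a pair
of one of two forms. -/
theorem exists_pairVec_of_mem {Λ : Gr 10 V} (h₀ : Λ ∈ comp₀ h) (h₁ : Λ ∈ comp₁ h) :
    ∃ (u v : V) (hli : LinearIndependent ℂ (pairVec h u v)), Λ = grSpan _ hli ∧
      ((∃ b c : ℂ, u = h (3, 0) - b • h (0, 2) - c • h (1, 1) ∧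
          v = h (2, 1) - (c / 6) • h (0, 2)) ∨
        ∃ a b : ℂ, u = h (0, 2) ∧ v = a • h (1, 1) + b • h (2, 1)) := by
  have hfin : FiniteDimensional ℂ V := Module.Finite.of_basis h
  have hK : ∀ r : Fin 8, h (pairIdx (0, 0) (0, 0) (Fin.natAdd 2 r)) ∈ Λ.1 := fun r => by
    fin_cases r
    · exact mem_of_mem_comp₁ h₁ (by simp [pairIdx])
    · exact mem_of_mem_comp₁ h₁ (by simp [pairIdx])
    · exact mem_of_mem_comp₀ h₀ (by simp [pairIdx])
    · exact mem_of_mem_comp₀ h₀ (by simp [pairIdx])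
    · exact mem_of_mem_comp₀ h₀ (by simp [pairIdx])
    · exact mem_of_mem_comp₀ h₀ (by simp [pairIdx])
    · exact mem_of_mem_comp₀ h₀ (by simp [pairIdx])
    · exact mem_of_mem_comp₀ h₀ (by simp [pairIdx])
  have hmem : ∀ u ∈ Λ.1, ∀ v ∈ Λ.1, ∀ r, pairVec h u v r ∈ Λ.1 := fun u hu v hv r => by
    fin_cases r
    exacts [hu, hv, hK 0, hK 1, hK 2, hK 3, hK 4, hK 5, hK 6, hK 7]
  have hfree : ∀ x ∈ Λ.1, IsFree h x → x = h.repr x (3, 0) • h (3, 0) + h.repr x (1, 1) • h (1, 1)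
      + h.repr x (2, 1) • h (2, 1) + h.repr x (0, 2) • h (0, 2) := fun x hx hf => by
    obtain ⟨f0, f1, f2, f3, f4, f5, f6, f7⟩ := (isFree_iff x).1 hf
    have z0 := repr_eq_zero_of_mem_comp₀ h₀ (i := (0, 0)) (by simp) x hx
    have z1 := repr_eq_zero_of_mem_comp₀ h₀ (i := (1, 0)) (by simp) x hx
    have z2 := repr_eq_zero_of_mem_comp₀ h₀ (i := (0, 1)) (by simp) x hx
    have z3 := repr_eq_zero_of_mem_comp₁ h₁ (i := (2, 0)) (by simp) x hx
    conv_lhs => rw [← h.sum_repr x]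
    simp only [Fintype.sum_prod_type, Fin.sum_univ_four, f0, f1, f2, f3, f4, f5, f6, f7, z0, z1, z2,
      z3, zero_smul]
    abel
  have hrel : ∀ u ∈ Λ.1, ∀ v ∈ Λ.1, IsFree h u → IsFree h v →
      h.repr u (3, 0) * h.repr v (1, 1) - h.repr u (1, 1) * h.repr v (3, 0) = 0 ∧
      (h.repr u (1, 1) * h.repr v (2, 1) - h.repr u (2, 1) * h.repr v (1, 1)) -
        6 * (h.repr u (3, 0) * h.repr v (0, 2) - h.repr u (0, 2) * h.repr v (3, 0)) = 0 := by
    intro u hu v hv fu fv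
    obtain ⟨r₁, r₂⟩ := forms_eq_zero_of_mem_comp₁ h₁ (hmem u hu v hv)
    rw [ruledForm, AlternatingMap.sub_apply, AlternatingMap.smul_apply,
      detForm_pairVec h _ _ _ fu fv (repr_pairVec h u v),
      detForm_pairVec h _ _ _ fu fv (repr_pairVec h u v)] at r₂
    rw [detForm_pairVec h _ _ _ fu fv (repr_pairVec h u v)] at r₁
    exact ⟨r₁, r₂⟩
  -- Eight vanishing coordinates and one more are nine linear conditions on a ten-dimensional space.
  have hex : ∀ i : Fin 4 × Fin 4, ∃ x ∈ Λ.1, x ≠ 0 ∧ IsFree h x ∧ h.repr x i = 0 := fun i => by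
    let β : V →ₗ[ℂ] (Fin 9 → ℂ) := LinearMap.pi (Fin.snoc (fun r : Fin 8 =>
      h.coord (pairIdx (0, 0) (0, 0) (Fin.natAdd 2 r))) (h.coord i))
    obtain ⟨x, hx, hx0, hβ⟩ := exists_ne_zero_of_finrank_lt Λ (by norm_num) β
    refine ⟨x, hx, hx0, fun r => ?_, ?_⟩
    · have := congrFun hβ r.castSucc
      simpa [β, -Fin.castSucc_natAdd] using this
    · have := congrFun hβ (Fin.last 8)
      simp only [β, LinearMap.pi_apply, Fin.snoc_last] at this
      exact this
  -- A nonzero (3,0) coordinate gives the affine chart of the cone; otherwise the member lies on the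
  -- line of the cone where y₀ = y₁ = 0.
  by_cases hA : ∃ x ∈ Λ.1, h.repr x (3, 0) ≠ 0
  · obtain ⟨x, hx, hx0⟩ := hA
    obtain ⟨y, hy, hy0, hyf, hyr⟩ := hex (3, 0)
    let z : V := (h.repr x (3, 0))⁻¹ • (x - ∑ r : Fin 8,
      h.repr x (pairIdx (0, 0) (0, 0) (Fin.natAdd 2 r)) •
        h (pairIdx (0, 0) (0, 0) (Fin.natAdd 2 r)))
    have hz : z ∈ Λ.1 := Λ.1.smul_mem _ (Λ.1.sub_mem hx
      (Λ.1.sum_mem fun r _ => Λ.1.smul_mem _ (hK r)))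
    have hzf : IsFree h z := by
      rw [isFree_iff]
      simp [z, Fin.sum_univ_succ, pairIdx]
    have hz1 : h.repr z (3, 0) = 1 := by
      simp [z, Fin.sum_univ_succ, pairIdx, hx0]
    obtain ⟨r₁, r₂⟩ := hrel z hz y hy hzf hyf
    rw [hz1, hyr] at r₁ r₂
    have y1 : h.repr y (1, 1) = 0 := by linear_combination r₁
    rw [y1] at r₂
    -- The relation `ruledForm` ties the (0,2) coordinate of the second vector to the (1,1)
    -- coordinate of the first, so a single constant appears in both.
    have y2 : h.repr y (0, 2) = h.repr z (1, 1) * h.repr y (2, 1) / 6 := by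
      linear_combination (-1 / 6 : ℂ) * r₂
    have ye := hfree y hy hyf
    have y3 : h.repr y (2, 1) ≠ 0 := fun h0 => hy0 (by rw [ye, hyr, y1, y2, h0]; simp)
    let v : V := (h.repr y (2, 1))⁻¹ • y
    have hv : v ∈ Λ.1 := Λ.1.smul_mem _ hy
    have ve : v = h (2, 1) - (-h.repr z (1, 1) / 6) • h (0, 2) := by
      simp only [v]
      nth_rw 2 [ye]
      rw [hyr, y1, y2]
      match_scalars <;> first | ring1 | field_simp
    have hu : z - h.repr z (2, 1) • v ∈ Λ.1 := Λ.1.sub_mem hz (Λ.1.smul_mem _ hv)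
    have ue : z - h.repr z (2, 1) • v = h (3, 0) -
        (-(h.repr z (0, 2) - h.repr z (2, 1) * h.repr z (1, 1) / 6)) • h (0, 2) -
        (-h.repr z (1, 1)) • h (1, 1) := by
      nth_rw 1 [hfree z hz hzf]
      rw [hz1, ve]
      match_scalars <;> ring
    have hli : LinearIndependent ℂ (pairVec h (z - h.repr z (2, 1) • v) v) := by
      refine linearIndependent_pairVec (i := (3, 0)) (j := (2, 1)) ?_ ?_ ?_
      · rw [ue, isFree_iff]
        simp
      · rw [ve, isFree_iff]
        simp
      · rw [ue, ve]
        simp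
    exact ⟨_, _, hli, eq_grSpan_of_mem hli (hmem _ hu _ hv), .inl ⟨_, _, ue, ve⟩⟩
  · push Not at hA
    -- Without (3,0) coordinates, `ruledForm` says that the minor at (1,1), (2,1) vanishes on a
    -- plane in the span of three basis vectors, so the plane contains the third one.
    have h02 : h (0, 2) ∈ Λ.1 := by
      obtain ⟨y, hy, hy0, hyf, hyr⟩ := hex (1, 1)
      have ye := hfree y hy hyf
      rw [hA y hy, hyr] at ye
      by_cases y3 : h.repr y (2, 1) = 0
      · have y4 : h.repr y (0, 2) ≠ 0 := fun h0 => hy0 (by rw [ye, y3, h0]; simp)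
        have : h (0, 2) = (h.repr y (0, 2))⁻¹ • y := by
          nth_rw 2 [ye]
          rw [y3]
          match_scalars <;> first | ring1 | field_simp
        rw [this]
        exact Λ.1.smul_mem _ hy
      · obtain ⟨x, hx, hx0, hxf, hxr⟩ := hex (2, 1)
        have r₂ := (hrel x hx y hy hxf hyf).2
        rw [hA x hx, hA y hy, hyr, hxr] at r₂
        have x1 : h.repr x (1, 1) = 0 := by
          have : h.repr x (1, 1) * h.repr y (2, 1) = 0 := by linear_combination r₂
          exact (mul_eq_zero.1 this).resolve_right y3
        have xe := hfree x hx hxf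
        rw [hA x hx, x1, hxr] at xe
        have x4 : h.repr x (0, 2) ≠ 0 := fun h0 => hx0 (by rw [xe, h0]; simp)
        have : h (0, 2) = (h.repr x (0, 2))⁻¹ • x := by
          nth_rw 2 [xe]
          match_scalars <;> first | ring1 | field_simp
        rw [this]
        exact Λ.1.smul_mem _ hx
    obtain ⟨v, hv, hv0, hvf, hvr⟩ := hex (0, 2)
    have ve := hfree v hv hvf
    rw [hA v hv, hvr, zero_smul, zero_smul, zero_add, add_zero] at ve
    have hf : IsFree h (h (0, 2)) := (isFree_iff _).2 (by simp)
    have hli : LinearIndependent ℂ (pairVec h (h (0, 2)) v) := by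
      by_cases v1 : h.repr v (1, 1) = 0
      · have v2 : h.repr v (2, 1) ≠ 0 := fun h0 => hv0 (by rw [ve, v1, h0]; simp)
        exact linearIndependent_pairVec (i := (0, 2)) (j := (2, 1)) hf hvf (by simp [v2])
      · exact linearIndependent_pairVec (i := (0, 2)) (j := (1, 1)) hf hvf (by simp [v1])
    exact ⟨_, _, hli, eq_grSpan_of_mem hli (hmem _ h02 _ hv), .inr ⟨_, _, rfl, ve⟩⟩

end Intersection

/-! ### The intersection as a quadric cone in Plücker space. -/

section Cone

open exteriorPower

variable {V : Type*} [AddCommGroup V] [Module ℂ V] (h : Module.Basis (Fin 4 × Fin 4) ℂ V)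

/-- The plane of ruling parameter s₂ = 0 in the main component coincides with the plane w₀ = 0 in
the other one. -/
theorem fam_mem_inter (b c : ℂ) : fam h (par₁ ![0, b, c]) ∈ comp₀ h ∩ comp₁ h := by
  refine ⟨subset_closure ⟨![b, c, 0], ?_⟩, subset_closure ⟨_, rfl⟩⟩
  have : par₀ ![b, c, 0] = par₁ ![0, b, c] := by
    ext i
    fin_cases i <;> simp [par₀, par₁]
  simp only [this]

theorem mem_fam_par₁_of_isFree {u : V} (hu : IsFree h u) (b c : ℂ) :
    u ∈ (fam h (par₁ ![0, b, c])).1 ↔ h.repr u (0, 0) = 0 ∧ h.repr u (1, 0) = 0 ∧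
      h.repr u (0, 1) = 0 ∧ h.repr u (2, 0) = 0 ∧
      h.repr u (0, 2) = -(b / 2) * h.repr u (3, 0) - c / 6 * h.repr u (2, 1) ∧
      h.repr u (1, 1) = -c * h.repr u (3, 0) := by
  obtain ⟨f0, f1, f2, f3, f4, f5, f6, f7⟩ := (isFree_iff u).1 hu
  rw [mem_fam_iff]
  simp [par₁, f0, f1, f2, f3]

theorem grSpan_pairVec_eq_fam {u v : V} (hli : LinearIndependent ℂ (pairVec h u v)) (b c : ℂ)
    (hu : u ∈ (fam h (par₁ ![0, b, c])).1) (hv : v ∈ (fam h (par₁ ![0, b, c])).1) :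
    grSpan _ hli = fam h (par₁ ![0, b, c]) := by
  have := Module.Finite.of_basis h
  refine (eq_grSpan_of_mem hli fun r => ?_).symm
  fin_cases r
  · exact hu
  · exact hv
  all_goals
    refine (mem_fam_iff h _ _).2 ?_
    simp [pairVec, par₁]

theorem left_mem_grSpan_pairVec {u v : V} (hli : LinearIndependent ℂ (pairVec h u v)) :
    u ∈ (grSpan _ hli).1 := Submodule.subset_span ⟨0, rfl⟩

theorem right_mem_grSpan_pairVec {u v : V} (hli : LinearIndependent ℂ (pairVec h u v)) :
    v ∈ (grSpan _ hli).1 := Submodule.subset_span ⟨1, rfl⟩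

theorem grSpan_pairVec_eq {u v u' v' : V} (hli : LinearIndependent ℂ (pairVec h u v))
    (hli' : LinearIndependent ℂ (pairVec h u' v')) (hu : u ∈ (grSpan _ hli').1)
    (hv : v ∈ (grSpan _ hli').1) : grSpan _ hli = grSpan _ hli' := by
  have := Module.Finite.of_basis h
  refine (eq_grSpan_of_mem hli fun r => ?_).symm
  fin_cases r
  · exact hu
  · exact hv
  all_goals
    refine Submodule.subset_span ?_
    simp [pairVec]

theorem isPolyMap_pairVec {n : ℕ} {u v : (Fin n → ℂ) → V} (hu : IsPolyMap u) (hv : IsPolyMap v)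
    (j : Fin 10) : IsPolyMap fun b => pairVec h (u b) (v b) j := by
  fin_cases j
  · exact hu
  · exact hv
  all_goals exact .const _

theorem linearIndependent_pairVec_sub (b c : ℂ) : LinearIndependent ℂ
    (pairVec h (h (3, 0) - b • h (0, 2) - c • h (1, 1)) (h (2, 1) - (c / 6) • h (0, 2))) := by
  refine linearIndependent_pairVec (i := (3, 0)) (j := (2, 1)) ?_ ?_ ?_
  · rw [isFree_iff]
    simp
  · rw [isFree_iff]
    simp
  · simp

theorem linearIndependent_pairVec_add {a b : ℂ} (hab : a ≠ 0 ∨ b ≠ 0) : LinearIndependent ℂ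
    (pairVec h (h (0, 2)) (a • h (1, 1) + b • h (2, 1))) := by
  have f₁ : IsFree h (h (0, 2)) := (isFree_iff _).2 (by simp)
  have f₂ : IsFree h (a • h (1, 1) + b • h (2, 1)) := (isFree_iff _).2 (by simp)
  rcases hab with h0 | h0
  · exact linearIndependent_pairVec (i := (0, 2)) (j := (1, 1)) f₁ f₂ (by simp [h0])
  · exact linearIndependent_pairVec (i := (0, 2)) (j := (2, 1)) f₁ f₂ (by simp [h0])

theorem grSpan_pairVec_sub_mem (b c : ℂ) :
    grSpan _ (linearIndependent_pairVec_sub h b c) ∈ comp₀ h ∩ comp₁ h := by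
  rw [grSpan_pairVec_eq_fam h _ (2 * b) c]
  · exact fam_mem_inter h _ _
  · rw [mem_fam_par₁_of_isFree h ((isFree_iff _).2 (by simp))]
    simp
  · rw [mem_fam_par₁_of_isFree h ((isFree_iff _).2 (by simp))]
    simp

/-- These points lie outside the parametrized chart. Each is the limit at 0 of a curve of pairs
whose members with nonzero parameter are in the chart, and whose vectors stay independent at 0. -/
theorem grSpan_pairVec_add_mem {a b : ℂ} (hab : a ≠ 0 ∨ b ≠ 0) :
    grSpan _ (linearIndependent_pairVec_add h hab) ∈ comp₀ h ∩ comp₁ h := by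
  have := Module.Finite.of_basis h
  have hcl : IsClosed (comp₀ h ∩ comp₁ h) := isClosed_closure.inter isClosed_closure
  rw [← hcl.closure_eq]
  by_cases ha : a = 0
  · have hb : b ≠ 0 := hab.resolve_left (not_not.2 ha)
    let u : (Fin 1 → ℂ) → V := fun e => e 0 • h (3, 0) + h (0, 2)
    let v : (Fin 1 → ℂ) → V := fun _ => h (2, 1)
    have hu : IsPolyMap u := (IsPolyMap.smul (.coord 0) (.const _)).add (.const _)
    have hv : IsPolyMap v := .const _
    have hfu : ∀ e, IsFree h (u e) := fun e => (isFree_iff _).2 (by simp [u])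
    have hfv : ∀ e, IsFree h (v e) := fun e => (isFree_iff _).2 (by simp [v])
    have hli : ∀ e, LinearIndependent ℂ (pairVec h (u e) (v e)) := fun e =>
      linearIndependent_pairVec (i := (0, 2)) (j := (2, 1)) (hfu e) (hfv e) (by simp [u, v])
    have key := (isRegularFamily_grSpan (isPolyMap_pairVec h hu hv) hli).mem_closure (.coord 0)
      (b₁ := fun _ => 1) one_ne_zero (fun _ => 0) (S := comp₀ h ∩ comp₁ h) fun e he => by
        rw [grSpan_pairVec_eq_fam h _ (-2 / e 0) 0]
        · exact fam_mem_inter h _ _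
        · rw [mem_fam_par₁_of_isFree h (hfu e)]
          simp [u]
          field_simp
        · rw [mem_fam_par₁_of_isFree h (hfv e)]
          simp [v]
    convert! key using 1
    refine grSpan_pairVec_eq h _ _ ?_ ?_
    · convert! left_mem_grSpan_pairVec h (hli fun _ => 0) using 1
      simp [u]
    · rw [ha, zero_smul, zero_add]
      exact Submodule.smul_mem _ _ (right_mem_grSpan_pairVec h _)
  · let u : (Fin 1 → ℂ) → V := fun e => e 0 • h (3, 0) + (6 : ℂ) • h (1, 1) + (6 * b / a) • h (2, 1)
    let v : (Fin 1 → ℂ) → V := fun e => e 0 • h (2, 1) + h (0, 2)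
    have hu : IsPolyMap u :=
      ((IsPolyMap.smul (.coord 0) (.const _)).add (.const _)).add (.const _)
    have hv : IsPolyMap v := (IsPolyMap.smul (.coord 0) (.const _)).add (.const _)
    have hfu : ∀ e, IsFree h (u e) := fun e => (isFree_iff _).2 (by simp [u])
    have hfv : ∀ e, IsFree h (v e) := fun e => (isFree_iff _).2 (by simp [v])
    have hli : ∀ e, LinearIndependent ℂ (pairVec h (u e) (v e)) := fun e =>
      linearIndependent_pairVec (i := (1, 1)) (j := (0, 2)) (hfu e) (hfv e) (by simp [u, v])
    have key := (isRegularFamily_grSpan (isPolyMap_pairVec h hu hv) hli).mem_closure (.coord 0)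
      (b₁ := fun _ => 1) one_ne_zero (fun _ => 0) (S := comp₀ h ∩ comp₁ h) fun e he => by
        -- The second vector forces c = −6/e; the vanishing (0,2) coordinate of the first then
        -- forces the other parameter.
        rw [grSpan_pairVec_eq_fam h _ (12 * b / a / e 0 ^ 2) (-6 / e 0)]
        · exact fam_mem_inter h _ _
        · rw [mem_fam_par₁_of_isFree h (hfu e)]
          simp [u]
          constructor <;> field_simp <;> ring
        · rw [mem_fam_par₁_of_isFree h (hfv e)]
          simp [v]
          field_simp
    convert! key using 1
    refine grSpan_pairVec_eq h _ _ ?_ ?_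
    · convert! right_mem_grSpan_pairVec h (hli fun _ => 0) using 1
      simp [v]
    · have e : a • h (1, 1) + b • h (2, 1) = (a / 6) • u fun _ => 0 := by
        simp only [u]
        match_scalars <;> field_simp <;> ring
      rw [e]
      exact Submodule.smul_mem _ _ (left_mem_grSpan_pairVec h _)

/-- The bilinear map that completes `u ∧ v` to an element of the tenth exterior power. -/
def pairWedge : V →ₗ[ℂ] V →ₗ[ℂ] ⋀[ℂ]^10 V :=
  LinearMap.mk₂ ℂ (fun u v => ιMulti ℂ 10 (pairVec h u v))
    (fun u u' v => by
      have e : ∀ x, pairVec h x v = Function.update (pairVec h 0 v) 0 x := fun x => by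
        ext r; fin_cases r <;> rfl
      rw [e, e u, e u', AlternatingMap.map_update_add])
    (fun c u v => by
      have e : ∀ x, pairVec h x v = Function.update (pairVec h 0 v) 0 x := fun x => by
        ext r; fin_cases r <;> rfl
      rw [e, e u, AlternatingMap.map_update_smul])
    (fun u v v' => by
      have e : ∀ x, pairVec h u x = Function.update (pairVec h u 0) 1 x := fun x => by
        ext r; fin_cases r <;> rfl
      rw [e, e v, e v', AlternatingMap.map_update_add])
    fun c u v => by
      have e : ∀ x, pairVec h u x = Function.update (pairVec h u 0) 1 x := fun x => by
        ext r; fin_cases r <;> rfl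
      rw [e, e v, AlternatingMap.map_update_smul]

theorem pairWedge_apply (u v : V) : pairWedge h u v = ιMulti ℂ 10 (pairVec h u v) := rfl

theorem pairWedge_self (u : V) : pairWedge h u u = 0 :=
  (ιMulti ℂ 10).map_eq_zero_of_eq (pairVec h u u) (i := 0) (j := 1) rfl (by decide)

theorem pairWedge_swap (u v : V) : pairWedge h u v = -pairWedge h v u := by
  have := pairWedge_self h (u + v)
  simp only [map_add, LinearMap.add_apply, pairWedge_self, zero_add, add_zero] at this
  exact eq_neg_of_add_eq_zero_right this

/-- The coordinate of `pairWedge` at a pair of indices. -/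
def wedgeCoord (i j : Fin 4 × Fin 4) : Module.Dual ℂ (⋀[ℂ]^10 V) :=
  alternatingMapLinearEquiv (detForm (pairCoord h i j))

theorem wedgeCoord_pairWedge (i j : Fin 4 × Fin 4) {u v : V} (hu : IsFree h u) (hv : IsFree h v) :
    wedgeCoord h i j (pairWedge h u v) =
      h.repr u i * h.repr v j - h.repr u j * h.repr v i := by
  rw [wedgeCoord, pairWedge_apply, alternatingMapLinearEquiv_apply_ιMulti,
    detForm_pairVec h i j _ hu hv (repr_pairVec h u v)]
  rfl

/-- The Plücker vectors that span the cone; the last one is its vertex. -/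
def coneVec : Fin 4 → ⋀[ℂ]^10 V :=
  ![pairWedge h (h (3, 0)) (h (2, 1)),
    pairWedge h (h (3, 0)) (h (0, 2)) + (6 : ℂ) • pairWedge h (h (1, 1)) (h (2, 1)),
    pairWedge h (h (1, 1)) (h (0, 2)),
    pairWedge h (h (2, 1)) (h (0, 2))]

/-- The second vector is a sum of two wedges, but the minor at (3,0), (0,2) sees only one of them,
which makes these four minors dual coordinates. -/
theorem linearIndependent_coneVec : LinearIndependent ℂ (coneVec h) := by
  have f₁ : IsFree h (h (3, 0)) := (isFree_iff _).2 (by simp)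
  have f₂ : IsFree h (h (2, 1)) := (isFree_iff _).2 (by simp)
  have f₃ : IsFree h (h (1, 1)) := (isFree_iff _).2 (by simp)
  have f₄ : IsFree h (h (0, 2)) := (isFree_iff _).2 (by simp)
  refine linearIndependent_of_dual_coordinates
    (LinearMap.pi ![wedgeCoord h (3, 0) (2, 1), wedgeCoord h (3, 0) (0, 2),
      wedgeCoord h (1, 1) (0, 2), wedgeCoord h (2, 1) (0, 2)]) fun j => ?_
  ext i
  fin_cases j <;> fin_cases i <;> simp [coneVec, wedgeCoord_pairWedge, f₁, f₂, f₃, f₄]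

theorem pairWedge_sub (b c : ℂ) :
    pairWedge h (h (3, 0) - b • h (0, 2) - c • h (1, 1)) (h (2, 1) - (c / 6) • h (0, 2)) =
      ∑ i, ![1, -c / 6, c ^ 2 / 6, b] i • coneVec h i := by
  simp only [map_sub, LinearMap.sub_apply, map_smul, LinearMap.smul_apply, Fin.sum_univ_four,
    coneVec]
  rw [pairWedge_swap h (h (0, 2)) (h (2, 1)), pairWedge_self]
  simp
  module

theorem pairWedge_add (a b : ℂ) :
    pairWedge h (h (0, 2)) (a • h (1, 1) + b • h (2, 1)) =
      ∑ i, ![0, 0, -a, -b] i • coneVec h i := by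
  simp only [map_add, map_smul, Fin.sum_univ_four, coneVec]
  rw [pairWedge_swap h (h (0, 2)) (h (2, 1)), pairWedge_swap h (h (0, 2)) (h (1, 1))]
  simp
  module

/-- After the shared eight vectors are split off, this is the Klein quadric of a four-dimensional
space cut by p₃₀,₁₁ = 0 and p₁₁,₂₁ = 6p₃₀,₀₂; the Plücker relation becomes y₀y₂ = 6y₁². -/
theorem isConeOverConic_inter (v : Gr 10 V)
    (hli : LinearIndependent ℂ (pairVec h (h (2, 1)) (h (0, 2)))) (hv : v = grSpan _ hli) :
    IsConeOverConic (plucker v) (plucker '' (comp₀ h ∩ comp₁ h)) := by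
  refine isConeOverConic_of_coordinates (linearIndependent_coneVec h) ?_ fun P => ?_
  · rw [hv, plucker_grSpan]
    rfl
  constructor
  · rintro ⟨Λ, ⟨h₀, h₁⟩, rfl⟩
    obtain ⟨u, v, hli, rfl, h2⟩ := exists_pairVec_of_mem h₀ h₁
    rw [plucker_grSpan]
    obtain ⟨t, ht⟩ := Projectivization.exists_smul_eq_mk_rep ℂ _ (ιMulti_ne_zero hli)
    rcases h2 with ⟨b, c, rfl, rfl⟩ | ⟨a, b, rfl, rfl⟩
    · rw [← ht, ← pairWedge_apply, pairWedge_sub]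
      refine ⟨fun i => t * ![1, -c / 6, c ^ 2 / 6, b] i, ?_, ?_⟩
      · simp
        ring
      · simp [Finset.smul_sum, mul_smul, Units.smul_def]
    · rw [← ht, ← pairWedge_apply, pairWedge_add]
      refine ⟨fun i => t * ![0, 0, -a, -b] i, ?_, ?_⟩
      · simp
      · simp [Finset.smul_sum, mul_smul, Units.smul_def]
  · rintro ⟨y, hy, hP⟩
    -- Here y₁ = 0 as well, which leaves the line of limit points; for y₀ ≠ 0 the chart parameters
    -- are read off from the coordinates.
    by_cases h0 : y 0 = 0
    · have h1 : y 1 = 0 := by simpa [h0] using hy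
      have hab : -y 2 ≠ 0 ∨ -y 3 ≠ 0 := by
        by_contra! hc
        refine P.rep_nonzero ?_
        rw [hP, Fin.sum_univ_four, h0, h1, neg_eq_zero.1 hc.1, neg_eq_zero.1 hc.2]
        simp
      refine ⟨_, grSpan_pairVec_add_mem h hab, ?_⟩
      rw [plucker_grSpan, ← P.mk_rep, Projectivization.mk_eq_mk_iff']
      refine ⟨1, ?_⟩
      rw [← pairWedge_apply, pairWedge_add, hP]
      simp [Fin.sum_univ_four, h0, h1]
    · refine ⟨_, grSpan_pairVec_sub_mem h (y 3 / y 0) (-6 * y 1 / y 0), ?_⟩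
      rw [plucker_grSpan, ← P.mk_rep, Projectivization.mk_eq_mk_iff']
      refine ⟨(y 0)⁻¹, ?_⟩
      rw [← pairWedge_apply, pairWedge_sub, hP]
      have h2 : y 2 = 6 * y 1 ^ 2 / y 0 := by
        field_simp
        linear_combination hy
      simp only [Fin.sum_univ_four, h2]
      simp
      match_scalars <;> field_simp

end Cone

/-! ### Apolarity in terms of a linear form on polynomials -/

section Apolarity

open MvPolynomial

/-- The exponent of `x₀ᵃx₁ᵇx₂ᶜx₃ᵈ`. -/
def ex (a b c d : ℕ) : Fin 4 →₀ ℕ := Finsupp.equivFunOnFinite.symm ![a, b, c, d]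

/-- The monomial `x₀ᵃx₁ᵇx₂ᶜx₃ᵈ`. -/
def mono (a b c d : ℕ) : T := monomial (ex a b c d) 1

theorem ex_inj {a b c d a' b' c' d' : ℕ} :
    ex a b c d = ex a' b' c' d' ↔ a = a' ∧ b = b' ∧ c = c' ∧ d = d' := by
  rw [ex, ex, Equiv.apply_eq_iff_eq]
  constructor
  · intro h
    exact ⟨congrFun h 0, congrFun h 1, congrFun h 2, congrFun h 3⟩
  · rintro ⟨rfl, rfl, rfl, rfl⟩
    rfl

theorem exists_ex (m : Fin 4 →₀ ℕ) : ∃ a b c d, m = ex a b c d :=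
  ⟨m 0, m 1, m 2, m 3, by ext i; fin_cases i <;> rfl⟩

theorem ex_add (a b c d a' b' c' d' : ℕ) :
    ex a b c d + ex a' b' c' d' = ex (a + a') (b + b') (c + c') (d + d') := by
  ext i; fin_cases i <;> rfl

theorem degree_ex (a b c d : ℕ) : (ex a b c d).degree = a + b + c + d := by
  rw [Finsupp.degree_eq_sum, Fin.sum_univ_four]
  rfl

theorem coeff_mono (a b c d a' b' c' d' : ℕ) : coeff (ex a b c d) (mono a' b' c' d') =
    if a' = a ∧ b' = b ∧ c' = c ∧ d' = d then (1 : ℂ) else 0 := by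
  rw [mono, coeff_monomial]
  exact if_congr ex_inj rfl rfl

theorem mono_mul (a b c d a' b' c' d' : ℕ) :
    mono a b c d * mono a' b' c' d' = mono (a + a') (b + b') (c + c') (d + d') := by
  rw [mono, mono, monomial_mul, ex_add, one_mul, mono]

theorem mono_eq (a b c d : ℕ) : mono a b c d = X 0 ^ a * X 1 ^ b * X 2 ^ c * X 3 ^ d := by
  rw [mono, monomial_eq, Finsupp.prod_fintype _ _ (by simp), Fin.prod_univ_four]
  simp [ex]

theorem isHomogeneous_mono (a b c d : ℕ) : (mono a b c d).IsHomogeneous (a + b + c + d) :=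
  isHomogeneous_monomial _ (degree_ex a b c d)

/-- The linear form `f ↦ f(∂)(q²)` on quartics, extended by zero. -/
def phi : T →ₗ[ℂ] ℂ :=
  (4 : ℂ) • lcoeff ℂ (ex 2 2 0 0) + (2 : ℂ) • lcoeff ℂ (ex 1 1 1 1) + (4 : ℂ) • lcoeff ℂ (ex 0 0 2 2)

theorem phi_apply (f : T) :
    phi f = 4 * coeff (ex 2 2 0 0) f + 2 * coeff (ex 1 1 1 1) f + 4 * coeff (ex 0 0 2 2) f := rfl

theorem coeff_iterate_pderiv (i : Fin 4) (k : ℕ) (f : T) (n : Fin 4 →₀ ℕ) :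
    coeff n ((pderiv i)^[k] f) =
      coeff (n + Finsupp.single i k) f * ((n i + 1).ascFactorial k : ℂ) := by
  induction k generalizing f with
  | zero => simp
  | succ k ih =>
    rw [Function.iterate_succ_apply, ih, coeff_pderiv, add_assoc, ← Finsupp.single_add,
      Nat.ascFactorial_succ]
    push_cast
    simp
    ring

/-- The iterated derivative attached to a monomial. -/
def derivAt (m : Fin 4 →₀ ℕ) (f : T) : T :=
  (pderiv 0)^[m 0] ((pderiv 1)^[m 1] ((pderiv 2)^[m 2] ((pderiv 3)^[m 3] f)))

theorem diffOn_monomial (f : T) (m : Fin 4 →₀ ℕ) : diffOn f (monomial m 1) = derivAt m f := by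
  have := (basisMonomials (Fin 4) ℂ).constr_basis ℂ (fun m => derivAt m f) m
  rwa [coe_basisMonomials] at this

theorem coeff_derivAt (m n : Fin 4 →₀ ℕ) (f : T) :
    coeff n (derivAt m f) = coeff (n + m) f * ∏ i, ((n i + 1).ascFactorial (m i) : ℂ) := by
  have e : n + Finsupp.single 0 (m 0) + Finsupp.single 1 (m 1) + Finsupp.single 2 (m 2) +
      Finsupp.single 3 (m 3) = n + m := by
    ext i
    fin_cases i <;> simp
  rw [derivAt, coeff_iterate_pderiv, coeff_iterate_pderiv, coeff_iterate_pderiv,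
    coeff_iterate_pderiv, e, Fin.prod_univ_four]
  simp
  ring

/-- Differentiating once more by ∂ⁿ and evaluating at 0 extracts the n-th coefficient times n!.
Hence constant terms alone detect apolarity. -/
theorem constantCoeff_diffOn_mul (f g : T) (n : Fin 4 →₀ ℕ) :
    coeff 0 (diffOn f (monomial n 1 * g)) = (∏ i, ((n i).factorial : ℂ)) * coeff n (diffOn f g) := by
  induction g using MvPolynomial.induction_on' with
  | monomial m c =>
    have e : monomial m c = c • (monomial m (1 : ℂ) : T) := by rw [smul_monomial, smul_eq_mul, mul_one]
    rw [e, mul_smul_comm, map_smul, map_smul, coeff_smul, coeff_smul, monomial_mul, one_mul,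
      diffOn_monomial, diffOn_monomial, coeff_derivAt, coeff_derivAt, zero_add]
    have : ∀ i, ((0 : ℕ) + 1).ascFactorial ((n + m) i) =
        (n i).factorial * (n i + 1).ascFactorial (m i) := fun i => by
      rw [Nat.factorial_mul_ascFactorial, zero_add, Nat.one_ascFactorial, Finsupp.add_apply]
    have e2 : (∏ i, (((0 : Fin 4 →₀ ℕ) i + 1).ascFactorial ((n + m) i) : ℂ)) =
        (∏ i, ((n i).factorial : ℂ)) * ∏ i, ((n i + 1).ascFactorial (m i) : ℂ) := by
      rw [← Finset.prod_mul_distrib]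
      refine Finset.prod_congr rfl fun i _ => ?_
      exact_mod_cast this i
    rw [e2, smul_eq_mul, smul_eq_mul]
    ring
  | add p r hp hr =>
    rw [mul_add, map_add, coeff_add, hp, hr, map_add, coeff_add]
    ring

theorem q_sq : q ^ 2 = mono 2 2 0 0 + (2 : ℂ) • mono 1 1 1 1 + mono 0 0 2 2 := by
  simp only [mono_eq, q, smul_eq_C_mul]
  have : (C 2 : T) = 2 := rfl
  rw [this]
  ring

/-- The weights 4, 2, 4 are the coefficients 1, 2, 1 of q² times the factorials 2!2!, 1, 2!2!. -/
theorem phi_eq (f : T) : phi f = coeff 0 (diffOn (q ^ 2) f) := by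
  induction f using MvPolynomial.induction_on' with
  | monomial m c =>
    have e : monomial m c = c • (monomial m (1 : ℂ) : T) := by rw [smul_monomial, smul_eq_mul, mul_one]
    rw [e, map_smul, map_smul, coeff_smul]
    congr 1
    rw [diffOn_monomial, coeff_derivAt, zero_add, q_sq, phi_apply]
    obtain ⟨a, b, c, d, rfl⟩ := exists_ex m
    change 4 * coeff _ (mono a b c d) + 2 * coeff _ (mono a b c d) + 4 * coeff _ (mono a b c d) = _
    rw [coeff_add, coeff_add, coeff_smul]
    simp only [coeff_mono]
    have hp : (∏ i, (((0 : Fin 4 →₀ ℕ) i + 1).ascFactorial (ex a b c d i) : ℂ)) =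
        (a.factorial * b.factorial * c.factorial * d.factorial : ℕ) := by
      rw [Fin.prod_univ_four]
      simp [ex, Nat.one_ascFactorial]
    rw [hp]
    by_cases h1 : a = 2 ∧ b = 2 ∧ c = 0 ∧ d = 0
    · obtain ⟨rfl, rfl, rfl, rfl⟩ := h1
      norm_num [Nat.factorial]
    by_cases h2 : a = 1 ∧ b = 1 ∧ c = 1 ∧ d = 1
    · obtain ⟨rfl, rfl, rfl, rfl⟩ := h2
      norm_num [Nat.factorial]
    by_cases h3 : a = 0 ∧ b = 0 ∧ c = 2 ∧ d = 2
    · obtain ⟨rfl, rfl, rfl, rfl⟩ := h3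
      norm_num [Nat.factorial]
    have h1' : ¬(2 = a ∧ 2 = b ∧ 0 = c ∧ 0 = d) := by omega
    have h2' : ¬(1 = a ∧ 1 = b ∧ 1 = c ∧ 1 = d) := by omega
    have h3' : ¬(0 = a ∧ 0 = b ∧ 2 = c ∧ 2 = d) := by omega
    simp only [h1, h2, h3, h1', h2', h3', if_false]
    simp
  | add p r hp hr => rw [map_add, hp, hr, map_add, coeff_add]

theorem diffOn_eq_zero_iff (g : T) : diffOn (q ^ 2) g = 0 ↔ ∀ f, phi (f * g) = 0 := by
  constructor
  · intro h f
    induction f using MvPolynomial.induction_on' with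
    | monomial m c =>
      have e : monomial m c = c • (monomial m (1 : ℂ) : T) := by
        rw [smul_monomial, smul_eq_mul, mul_one]
      rw [e, smul_mul_assoc, map_smul, phi_eq, constantCoeff_diffOn_mul, h, coeff_zero, mul_zero,
        smul_zero]
    | add p r hp hr => rw [add_mul, map_add, hp, hr, add_zero]
  · intro h
    ext n
    have := h (monomial n 1)
    rw [phi_eq, constantCoeff_diffOn_mul] at this
    have hne : (∏ i, ((n i).factorial : ℂ)) ≠ 0 :=
      Finset.prod_ne_zero_iff.2 fun i _ => Nat.cast_ne_zero.2 (Nat.factorial_ne_zero _)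
    exact (mul_eq_zero.1 this).resolve_left hne

theorem phi_eq_zero_of_isHomogeneous {f : T} {d : ℕ} (hf : f.IsHomogeneous d) (hd : d ≠ 4) :
    phi f = 0 := by
  rw [phi_apply, hf.coeff_eq_zero, hf.coeff_eq_zero, hf.coeff_eq_zero]
  · simp
  all_goals
    rw [degree_ex]
    omega

theorem phi_mono (a b c d : ℕ) : phi (mono a b c d) =
    if (a = 2 ∧ b = 2 ∧ c = 0 ∧ d = 0) ∨ (a = 0 ∧ b = 0 ∧ c = 2 ∧ d = 2) then 4
      else if a = 1 ∧ b = 1 ∧ c = 1 ∧ d = 1 then 2 else 0 := by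
  rw [phi_apply]
  simp only [coeff_mono]
  split_ifs <;> first | omega | norm_num

/-- Since `phi` lives in degree four, only linear multipliers of a cubic matter. -/
theorem mem_W_iff (g : T) : g ∈ W ↔ g.IsHomogeneous 3 ∧ ∀ i, phi (X i * g) = 0 := by
  constructor
  · rintro ⟨h1, h2⟩
    exact ⟨h1, fun i => (diffOn_eq_zero_iff g).1 h2 _⟩
  · rintro ⟨h1, h2⟩
    refine ⟨h1, (diffOn_eq_zero_iff g).2 fun f => ?_⟩
    induction f using MvPolynomial.induction_on' with
    | monomial m c =>
      have e : monomial m c = c • (monomial m (1 : ℂ) : T) := by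
        rw [smul_monomial, smul_eq_mul, mul_one]
      rw [e, smul_mul_assoc, map_smul]
      by_cases hm : m.degree = 1
      · obtain ⟨i, hi⟩ : ∃ i, (monomial m (1 : ℂ) : T) = X i := by
          obtain ⟨a, b, c, d, rfl⟩ := exists_ex m
          rw [degree_ex] at hm
          change ∃ i, mono a b c d = X i
          have : (a = 1 ∧ b = 0 ∧ c = 0 ∧ d = 0) ∨ (a = 0 ∧ b = 1 ∧ c = 0 ∧ d = 0) ∨
            (a = 0 ∧ b = 0 ∧ c = 1 ∧ d = 0) ∨ (a = 0 ∧ b = 0 ∧ c = 0 ∧ d = 1) := by omega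
          rcases this with ⟨rfl, rfl, rfl, rfl⟩ | ⟨rfl, rfl, rfl, rfl⟩ | ⟨rfl, rfl, rfl, rfl⟩ |
            ⟨rfl, rfl, rfl, rfl⟩
          exacts [⟨0, by simp [mono_eq]⟩, ⟨1, by simp [mono_eq]⟩, ⟨2, by simp [mono_eq]⟩,
            ⟨3, by simp [mono_eq]⟩]
        rw [hi, h2 i, smul_zero]
      · rw [phi_eq_zero_of_isHomogeneous ((isHomogeneous_monomial _ rfl).mul h1) (by omega),
          smul_zero]
    | add p r hp hr => rw [add_mul, map_add, hp, hr, add_zero]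

end Apolarity

/-! ### The monomial basis of the apolar cubics. -/

section Harmonic

open MvPolynomial

theorem X_eq_mono : (X 0 : T) = mono 1 0 0 0 ∧ (X 1 : T) = mono 0 1 0 0 ∧
    (X 2 : T) = mono 0 0 1 0 ∧ (X 3 : T) = mono 0 0 0 1 := by
  simp [mono_eq]

/-- The apolar cubic whose restriction to the quadric is the monomial of bidegree `p`. -/
def harm (p : Fin 4 × Fin 4) : T :=
  (![![mono 3 0 0 0, mono 2 0 0 1, mono 1 0 0 2, mono 0 0 0 3],
    ![mono 2 0 1 0, (1 / 3 : ℂ) • ((2 : ℂ) • mono 1 0 1 1 - mono 2 1 0 0),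
      (1 / 3 : ℂ) • (mono 0 0 1 2 - (2 : ℂ) • mono 1 1 0 1), -mono 0 1 0 2],
    ![mono 1 0 2 0, (1 / 3 : ℂ) • (mono 0 0 2 1 - (2 : ℂ) • mono 1 1 1 0),
      (1 / 3 : ℂ) • (mono 1 2 0 0 - (2 : ℂ) • mono 0 1 1 1), mono 0 2 0 1],
    ![mono 0 0 3 0, -mono 0 1 2 0, mono 0 2 1 0, -mono 0 3 0 0]] : Fin 4 → Fin 4 → T) p.1 p.2

/-- The coordinates of a cubic with respect to the apolar cubics `harm p`. -/
def harmCoord : T →ₗ[ℂ] (Fin 4 × Fin 4 → ℂ) :=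
  LinearMap.pi fun p =>
    (![![lcoeff ℂ (ex 3 0 0 0), lcoeff ℂ (ex 2 0 0 1), lcoeff ℂ (ex 1 0 0 2), lcoeff ℂ (ex 0 0 0 3)],
      ![lcoeff ℂ (ex 2 0 1 0), -(3 : ℂ) • lcoeff ℂ (ex 2 1 0 0), (3 : ℂ) • lcoeff ℂ (ex 0 0 1 2),
        -lcoeff ℂ (ex 0 1 0 2)],
      ![lcoeff ℂ (ex 1 0 2 0), (3 : ℂ) • lcoeff ℂ (ex 0 0 2 1), (3 : ℂ) • lcoeff ℂ (ex 1 2 0 0),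
        lcoeff ℂ (ex 0 2 0 1)],
      ![lcoeff ℂ (ex 0 0 3 0), -lcoeff ℂ (ex 0 1 2 0), lcoeff ℂ (ex 0 2 1 0),
        -lcoeff ℂ (ex 0 3 0 0)]] : Fin 4 → Fin 4 → T →ₗ[ℂ] ℂ) p.1 p.2

set_option maxHeartbeats 2000000 in
theorem harmCoord_harm (p : Fin 4 × Fin 4) : harmCoord (harm p) = Pi.single p 1 := by
  obtain ⟨i, j⟩ := p
  ext ⟨k, l⟩
  fin_cases i <;> fin_cases j <;> fin_cases k <;> fin_cases l <;>
    simp [harm, harmCoord, lcoeff_apply, coeff_mono]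

theorem harm_mem_W (p : Fin 4 × Fin 4) : harm p ∈ W := by
  obtain ⟨i, j⟩ := p
  obtain ⟨e0, e1, e2, e3⟩ := X_eq_mono
  rw [mem_W_iff]
  refine ⟨?_, fun r => ?_⟩
  · rw [← mem_homogeneousSubmodule]
    have hm : ∀ a b c d, a + b + c + d = 3 → mono a b c d ∈ homogeneousSubmodule (Fin 4) ℂ 3 :=
      fun a b c d h => h ▸ isHomogeneous_mono a b c d
    fin_cases i <;> fin_cases j <;> simp only [harm] <;>
    repeat' first
      | exact hm _ _ _ _ rfl
      | apply Submodule.smul_mem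
      | apply Submodule.neg_mem
      | apply Submodule.sub_mem
  · fin_cases i <;> fin_cases j <;> fin_cases r <;>
      simp [harm, e0, e1, e2, e3, mul_sub, mono_mul, phi_mono] <;> norm_num

theorem coeff_ex_X_mul (a b c d : ℕ) (g : T) :
    coeff (ex a b c d) (X 0 * g) = (if a = 0 then 0 else coeff (ex (a - 1) b c d) g) ∧
    coeff (ex a b c d) (X 1 * g) = (if b = 0 then 0 else coeff (ex a (b - 1) c d) g) ∧
    coeff (ex a b c d) (X 2 * g) = (if c = 0 then 0 else coeff (ex a b (c - 1) d) g) ∧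
    coeff (ex a b c d) (X 3 * g) = if d = 0 then 0 else coeff (ex a b c (d - 1)) g := by
  have h0 : ex a b c d - Finsupp.single 0 1 = ex (a - 1) b c d := by
    ext i; fin_cases i <;> simp [ex]
  have h1 : ex a b c d - Finsupp.single 1 1 = ex a (b - 1) c d := by
    ext i; fin_cases i <;> simp [ex]
  have h2 : ex a b c d - Finsupp.single 2 1 = ex a b (c - 1) d := by
    ext i; fin_cases i <;> simp [ex]
  have h3 : ex a b c d - Finsupp.single 3 1 = ex a b c (d - 1) := by
    ext i; fin_cases i <;> simp [ex]
  refine ⟨?_, ?_, ?_, ?_⟩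
  · rw [coeff_X_mul', h0]
    by_cases h : a = 0 <;> simp [ex, h]
  · rw [coeff_X_mul', h1]
    by_cases h : b = 0 <;> simp [ex, h]
  · rw [coeff_X_mul', h2]
    by_cases h : c = 0 <;> simp [ex, h]
  · rw [coeff_X_mul', h3]
    by_cases h : d = 0 <;> simp [ex, h]

/-- The four linear conditions on the coefficients of an apolar cubic. -/
theorem mem_W_iff_coeff (g : T) : g ∈ W ↔ g.IsHomogeneous 3 ∧
    4 * coeff (ex 1 2 0 0) g + 2 * coeff (ex 0 1 1 1) g = 0 ∧
    4 * coeff (ex 2 1 0 0) g + 2 * coeff (ex 1 0 1 1) g = 0 ∧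
    2 * coeff (ex 1 1 0 1) g + 4 * coeff (ex 0 0 1 2) g = 0 ∧
    2 * coeff (ex 1 1 1 0) g + 4 * coeff (ex 0 0 2 1) g = 0 := by
  rw [mem_W_iff, Fin.forall_fin_succ, Fin.forall_fin_succ, Fin.forall_fin_two]
  have e : (Fin.succ 0 : Fin 3) = 1 ∧ (Fin.succ 1 : Fin 3) = 2 := by decide
  simp only [phi_apply, Fin.succ_zero_eq_one, e.1, e.2, Fin.succ_one_eq_two]
  change _ ∧ _ ∧ _ ∧ _ ∧ 4 * coeff _ (X 3 * g) + 2 * coeff _ (X 3 * g) + 4 * coeff _ (X 3 * g) = 0 ↔ _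
  simp [(coeff_ex_X_mul _ _ _ _ g).1, (coeff_ex_X_mul _ _ _ _ g).2.1,
    (coeff_ex_X_mul _ _ _ _ g).2.2.1, (coeff_ex_X_mul _ _ _ _ g).2.2.2]

/-- The coordinates read sixteen of the twenty coefficients of a cubic; the four apolarity relations
determine the others. -/
theorem eq_zero_of_harmCoord_eq_zero {g : T} (hg : g ∈ W) (h : harmCoord g = 0) : g = 0 := by
  obtain ⟨h3, r0, r1, r2, r3⟩ := (mem_W_iff_coeff g).1 hg
  have hc : ∀ i j, harmCoord g (i, j) = 0 := fun i j => congrFun h _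
  simp only [Fin.forall_fin_succ] at hc
  simp [harmCoord, lcoeff_apply] at hc
  obtain ⟨⟨c00, c01, c02, c03⟩, ⟨c10, c11, c12, c13⟩, ⟨c20, c21, c22, c23⟩, c30, c31, c32, c33⟩ := hc
  rw [c22, mul_zero, zero_add, mul_eq_zero] at r0
  rw [c11, mul_zero, zero_add, mul_eq_zero] at r1
  rw [c12, mul_zero, add_zero, mul_eq_zero] at r2
  rw [c21, mul_zero, add_zero, mul_eq_zero] at r3
  replace r0 := r0.resolve_left two_ne_zero
  replace r1 := r1.resolve_left two_ne_zero
  replace r2 := r2.resolve_left two_ne_zero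
  replace r3 := r3.resolve_left two_ne_zero
  ext m
  obtain ⟨a, b, c, d, rfl⟩ := exists_ex m
  rw [coeff_zero]
  by_cases hd : a + b + c + d = 3
  · have hda : d = 3 - a - b - c := by omega
    subst hda
    have ha : a ≤ 3 := by omega
    have hb : b ≤ 3 - a := by omega
    have hc : c ≤ 3 - a - b := by omega
    clear hd h hg h3
    interval_cases a <;> interval_cases b <;> interval_cases c <;> assumption
  · exact h3.coeff_eq_zero (by rw [degree_ex]; exact hd)

/-- The basis of the space of apolar cubics. -/
def harmBasis : Module.Basis (Fin 4 × Fin 4) ℂ W :=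
  Module.Basis.ofEquivFun (LinearEquiv.ofBijective (harmCoord ∘ₗ W.subtype) (by
    constructor
    · rw [← LinearMap.ker_eq_bot, LinearMap.ker_eq_bot']
      exact fun g hg => Subtype.ext (eq_zero_of_harmCoord_eq_zero g.2 hg)
    · intro x
      refine ⟨∑ p, x p • ⟨harm p, harm_mem_W p⟩, ?_⟩
      simp only [map_sum, map_smul, LinearMap.comp_apply, Submodule.subtype_apply, harmCoord_harm]
      ext p
      simp [Finset.sum_apply, Pi.single_apply]))

theorem harmBasis_repr (g : W) (p : Fin 4 × Fin 4) : harmBasis.repr g p = harmCoord g p := rfl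

theorem harmBasis_apply (p : Fin 4 × Fin 4) : (harmBasis p : T) = harm p := by
  have : harmBasis p = ⟨harm p, harm_mem_W p⟩ := by
    apply harmBasis.repr.injective
    ext r
    rw [harmBasis.repr_self, harmBasis_repr, harmCoord_harm, Finsupp.single_apply, Pi.single_apply]
    simp only [eq_comm]
  rw [this]

theorem sum_harm (g : W) : (g : T) = ∑ p, harmCoord g p • harm p := by
  conv_lhs => rw [← harmBasis.sum_repr g]
  simp [harmBasis_repr, harmBasis_apply]

end Harmonic

/-! ### Apolar ideals through the point `(1 : 0 : 0 : 0)` that miss the plane `y₀ = 0` -/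

section Classification

open MvPolynomial

/-- Multiplication by y₀ on T/I is an injective linear map, so it has a linear left inverse; compose
with it. -/
theorem exists_lift {I : Ideal T} (hI : ∀ g, X 0 * g ∈ I → g ∈ I) (t : T →ₗ[ℂ] ℂ)
    (ht : ∀ g ∈ I, t g = 0) :
    ∃ t' : T →ₗ[ℂ] ℂ, (∀ g ∈ I, t' g = 0) ∧ ∀ g, t' (X 0 * g) = t g := by
  let J : Submodule ℂ T := I.restrictScalars ℂ
  let m : (T ⧸ J) →ₗ[ℂ] T ⧸ J := J.mapQ J (LinearMap.mulLeft ℂ (X 0))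
    fun g hg => I.mul_mem_left (X 0) hg
  have hm : LinearMap.ker m = ⊥ := by
    rw [LinearMap.ker_eq_bot']
    intro x hx
    obtain ⟨g, rfl⟩ := J.mkQ_surjective x
    have : X 0 * g ∈ J := (Submodule.Quotient.mk_eq_zero _).1 hx
    exact (Submodule.Quotient.mk_eq_zero _).2 (hI g this)
  obtain ⟨n, hn⟩ := LinearMap.exists_leftInverse_of_injective m hm
  refine ⟨(J.liftQ t ht) ∘ₗ n ∘ₗ J.mkQ, fun g hg => ?_, fun g => ?_⟩
  · have : J.mkQ g = 0 := (Submodule.Quotient.mk_eq_zero _).2 hg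
    rw [LinearMap.comp_apply, LinearMap.comp_apply, this, map_zero, map_zero]
  · have : J.mkQ (X 0 * g) = m (J.mkQ g) := rfl
    rw [LinearMap.comp_apply, LinearMap.comp_apply, this, ← LinearMap.comp_apply n, hn]
    rfl

theorem X_zero_mul_mono (a b c d : ℕ) : X 0 * mono a b c d = mono (a + 1) b c d := by
  rw [X_eq_mono.1, mono_mul]
  simp only [add_comm, add_zero]

/-- Expansion of a linear form on the multiples of an apolar cubic. -/
theorem map_mul_eq_sum (t : T →ₗ[ℂ] ℂ) {g : T} (hg : g ∈ W) (f : T) :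
    t (g * f) = ∑ i, ∑ j, harmCoord g (i, j) * t (harm (i, j) * f) := by
  have e : g = ∑ p, harmCoord g p • harm p := sum_harm ⟨g, hg⟩
  conv_lhs => rw [e]
  rw [Finset.sum_mul, map_sum, Fintype.sum_prod_type]
  simp only [smul_mul_assoc, map_smul, smul_eq_mul]

/-- Multiply by the six quadratic monomials in y₁, y₂, y₃ and apply t. The basis cubics with i + j ≤
2 are multiples of y₀, so t on their products reduces to `phi`, and each test monomial isolates
exactly one of their coordinates. -/
theorem coord_eqs {t : T →ₗ[ℂ] ℂ} (ht : ∀ g, t (X 0 * g) = phi g) {g : T} (hg : g ∈ W)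
    (h0 : ∀ f, t (g * f) = 0) (x : Fin 4 → Fin 4 → ℂ) (hx : ∀ i j : Fin 4, harmCoord g (i, j) = x i j)
    (τ : ℕ → ℕ → ℕ → ℂ) (hτ : ∀ b c d, t (mono 0 b c d) = τ b c d) :
    4 * x 0 0 + x 3 0 * τ 2 3 0 + x 2 1 * τ 2 2 1 / 3 + x 1 2 * τ 2 1 2 / 3 + x 0 3 * τ 2 0 3
      - x 3 1 * τ 3 2 0 - x 1 3 * τ 3 0 2 - x 2 2 * τ 3 1 1 * (2 / 3) + x 3 2 * τ 4 1 0
      + x 2 3 * τ 4 0 1 - x 3 3 * τ 5 0 0 = 0 ∧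
    2 * x 1 0 + x 3 0 * τ 1 3 1 + x 2 1 * τ 1 2 2 / 3 + x 1 2 * τ 1 1 3 / 3 + x 0 3 * τ 1 0 4
      - x 3 1 * τ 2 2 1 - x 1 3 * τ 2 0 3 - x 2 2 * τ 2 1 2 * (2 / 3) + x 3 2 * τ 3 1 1
      + x 2 3 * τ 3 0 2 - x 3 3 * τ 4 0 1 = 0 ∧
    2 * x 0 1 + x 3 0 * τ 1 4 0 + x 2 1 * τ 1 3 1 / 3 + x 1 2 * τ 1 2 2 / 3 + x 0 3 * τ 1 1 3
      - x 3 1 * τ 2 3 0 - x 1 3 * τ 2 1 2 - x 2 2 * τ 2 2 1 * (2 / 3) + x 3 2 * τ 3 2 0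
      + x 2 3 * τ 3 1 1 - x 3 3 * τ 4 1 0 = 0 ∧
    4 * x 2 0 + x 3 0 * τ 0 3 2 + x 2 1 * τ 0 2 3 / 3 + x 1 2 * τ 0 1 4 / 3 + x 0 3 * τ 0 0 5
      - x 3 1 * τ 1 2 2 - x 1 3 * τ 1 0 4 - x 2 2 * τ 1 1 3 * (2 / 3) + x 3 2 * τ 2 1 2
      + x 2 3 * τ 2 0 3 - x 3 3 * τ 3 0 2 = 0 ∧
    4 * x 0 2 + x 3 0 * τ 0 5 0 + x 2 1 * τ 0 4 1 / 3 + x 1 2 * τ 0 3 2 / 3 + x 0 3 * τ 0 2 3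
      - x 3 1 * τ 1 4 0 - x 1 3 * τ 1 2 2 - x 2 2 * τ 1 3 1 * (2 / 3) + x 3 2 * τ 2 3 0
      + x 2 3 * τ 2 2 1 - x 3 3 * τ 3 2 0 = 0 ∧
    2 * x 1 1 + x 3 0 * τ 0 4 1 + x 2 1 * τ 0 3 2 / 3 + x 1 2 * τ 0 2 3 / 3 + x 0 3 * τ 0 1 4
      - x 3 1 * τ 1 3 1 - x 1 3 * τ 1 1 3 - x 2 2 * τ 1 2 2 * (2 / 3) + x 3 2 * τ 2 2 1
      + x 2 3 * τ 2 1 2 - x 3 3 * τ 3 1 1 = 0 := by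
  have e : ∀ a b c d, t (mono (a + 1) b c d) = phi (mono a b c d) := fun a b c d => by
    rw [← X_zero_mul_mono, ht]
  have e1 : ∀ b c d, t (mono 1 b c d) = phi (mono 0 b c d) := e 0
  have e2 : ∀ b c d, t (mono 2 b c d) = phi (mono 1 b c d) := e 1
  have e3 : ∀ b c d, t (mono 3 b c d) = phi (mono 2 b c d) := e 2
  have key : ∀ b c d, _ := fun b c d => (map_mul_eq_sum t hg (mono 0 b c d)).symm.trans (h0 _)
  simp only [Fin.sum_univ_four, hx] at key
  simp [harm, sub_mul, mono_mul, e1, e2, e3, hτ] at key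
  refine ⟨?_, ?_, ?_, ?_, ?_, ?_⟩
  · have := key 2 0 0
    simp [phi_mono] at this
    linear_combination this
  · have := key 1 0 1
    simp [phi_mono] at this
    linear_combination this
  · have := key 1 1 0
    simp [phi_mono] at this
    linear_combination this
  · have := key 0 0 2
    simp [phi_mono] at this
    linear_combination this
  · have := key 0 2 0
    simp [phi_mono] at this
    linear_combination this
  · have := key 0 1 1
    simp [phi_mono] at this
    linear_combination this

/-- The same expansion one degree higher: each factor y₀ lowers θ to t, and t to `phi`, so the only
new unknowns are the values σ on monomials free of y₀. -/
theorem coord_eqs_lift {t θ : T →ₗ[ℂ] ℂ} (ht : ∀ g, t (X 0 * g) = phi g)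
    (hθ : ∀ g, θ (X 0 * g) = t g) {g : T} (hg : g ∈ W)
    (h0 : ∀ f, θ (g * f) = 0) (x : Fin 4 → Fin 4 → ℂ) (hx : ∀ i j : Fin 4, harmCoord g (i, j) = x i j)
    (τ σ : ℕ → ℕ → ℕ → ℂ) (hτ : ∀ b c d, t (mono 0 b c d) = τ b c d)
    (hσ : ∀ b c d, θ (mono 0 b c d) = σ b c d) (b c d : ℕ) :
    x 0 0 * phi (mono 1 b c d) + x 1 0 * phi (mono 0 b (c + 1) d)
      + x 0 1 * phi (mono 0 b c (d + 1)) + x 2 0 * τ b (c + 2) d + x 0 2 * τ b c (d + 2)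
      + x 1 1 * (2 * τ b (c + 1) (d + 1) - phi (mono 0 (b + 1) c d)) / 3
      + x 3 0 * σ b (c + 3) d + x 2 1 * (σ b (c + 2) (d + 1) - 2 * τ (b + 1) (c + 1) d) / 3
      + x 1 2 * (σ b (c + 1) (d + 2) - 2 * τ (b + 1) c (d + 1)) / 3 + x 0 3 * σ b c (d + 3)
      - x 3 1 * σ (b + 1) (c + 2) d - x 1 3 * σ (b + 1) c (d + 2)
      + x 2 2 * (τ (b + 2) c d - 2 * σ (b + 1) (c + 1) (d + 1)) / 3
      + x 3 2 * σ (b + 2) (c + 1) d + x 2 3 * σ (b + 2) c (d + 1) - x 3 3 * σ (b + 3) c d = 0 := by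
  have e : ∀ a b c d, t (mono (a + 1) b c d) = phi (mono a b c d) := fun a b c d => by
    rw [← X_zero_mul_mono, ht]
  have e' : ∀ a b c d, θ (mono (a + 1) b c d) = t (mono a b c d) := fun a b c d => by
    rw [← X_zero_mul_mono, hθ]
  have e1 : ∀ b c d, t (mono 1 b c d) = phi (mono 0 b c d) := e 0
  have e2 : ∀ b c d, t (mono 2 b c d) = phi (mono 1 b c d) := e 1
  have e1' : ∀ b c d, θ (mono 1 b c d) = t (mono 0 b c d) := e' 0
  have e2' : ∀ b c d, θ (mono 2 b c d) = t (mono 1 b c d) := e' 1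
  have e3' : ∀ b c d, θ (mono 3 b c d) = t (mono 2 b c d) := e' 2
  have key := (map_mul_eq_sum θ hg (mono 0 b c d)).symm.trans (h0 _)
  simp only [Fin.sum_univ_four, hx] at key
  simp [harm, sub_mul, mono_mul, e1, e2, e1', e2', e3', hτ, hσ, add_comm _ b, add_comm _ c,
    add_comm _ d] at key
  linear_combination key

set_option linter.unusedSimpArgs false in
-- The values σ are unknown, but each occurs for several choices of leading coordinate and test
-- monomial. Eliminating it between two instances of `H` gives a relation in the entries A and B
-- alone.
theorem isParam_of_relations {τ σ φ : ℕ → ℕ → ℕ → ℂ} {A0 A1 A2 A3 A4 B0 B1 B2 B3 B4 B5 : ℂ}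
    (hφ : ∀ b c d, φ b c d = if b = 0 ∧ c = 2 ∧ d = 2 then 4 else 0)
    (hτ : τ 1 4 0 = 2 * A0 ∧ τ 1 3 1 = 2 * A1 ∧ τ 1 2 2 = 2 * A2 ∧ τ 1 1 3 = 2 * A3 ∧
      τ 1 0 4 = 2 * A4 ∧ τ 0 5 0 = 2 * B0 ∧ τ 0 4 1 = 2 * B1 ∧ τ 0 3 2 = 2 * B2 ∧
      τ 0 2 3 = 2 * B3 ∧ τ 0 1 4 = 2 * B4 ∧ τ 0 0 5 = 2 * B5)
    (hτ2 : ∀ c d, c + d = 3 → τ 2 c d = 0) (hτ3 : ∀ c d, c + d = 2 → τ 3 c d = 0)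
    (hτ4 : ∀ c d, c + d = 1 → τ 4 c d = 0)
    (H : ∀ (y0 y1 y2 y3 y4 y5 y6 : ℂ) (b c d : ℕ), b + c + d = 3 →
      -(y0 * A1 + y1 * A2 / 3 + y2 * A3 / 3 + y3 * A4) * φ b (c + 1) d
      - (y0 * A0 + y1 * A1 / 3 + y2 * A2 / 3 + y3 * A3) * φ b c (d + 1)
      - (y0 * B2 / 2 + y1 * B3 / 6 + y2 * B4 / 6 + y3 * B5 / 2 - y4 * A2 / 2 - y5 * A4 / 2
        - y6 * A3 / 3) * τ b (c + 2) d
      - (y0 * B0 / 2 + y1 * B1 / 6 + y2 * B2 / 6 + y3 * B3 / 2 - y4 * A0 / 2 - y5 * A2 / 2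
        - y6 * A1 / 3) * τ b c (d + 2)
      - (y0 * B1 + y1 * B2 / 3 + y2 * B3 / 3 + y3 * B4 - y4 * A1 - y5 * A3 - y6 * A2 * (2 / 3)) *
        (2 * τ b (c + 1) (d + 1) - φ (b + 1) c d) / 3
      + y0 * σ b (c + 3) d + y1 * (σ b (c + 2) (d + 1) - 2 * τ (b + 1) (c + 1) d) / 3
      + y2 * (σ b (c + 1) (d + 2) - 2 * τ (b + 1) c (d + 1)) / 3 + y3 * σ b c (d + 3)
      - y4 * σ (b + 1) (c + 2) d - y5 * σ (b + 1) c (d + 2)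
      + y6 * (τ (b + 2) c d - 2 * σ (b + 1) (c + 1) (d + 1)) / 3 = 0) :
    A1 = 0 ∧ A2 = 0 ∧ A3 = 0 ∧ IsParam ![A0, A4, B0, B1, B2, B3, B4, B5] := by
  have e : (τ 2 3 0 = 0 ∧ τ 2 2 1 = 0 ∧ τ 2 1 2 = 0 ∧ τ 2 0 3 = 0) ∧
      (τ 3 2 0 = 0 ∧ τ 3 1 1 = 0 ∧ τ 3 0 2 = 0) ∧ τ 4 1 0 = 0 ∧ τ 4 0 1 = 0 :=
    ⟨⟨hτ2 _ _ rfl, hτ2 _ _ rfl, hτ2 _ _ rfl, hτ2 _ _ rfl⟩, ⟨hτ3 _ _ rfl, hτ3 _ _ rfl, hτ3 _ _ rfl⟩,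
      hτ4 _ _ rfl, hτ4 _ _ rfl⟩
  have r1 : A0 * A2 + 2 / 3 * A1 * A1 = 0 := by
    have h1 := H 1 0 0 0 0 0 0 2 1 0 rfl
    have h2 := H 0 0 0 0 1 0 0 1 2 0 rfl
    simp only [Nat.reduceAdd, hφ, hτ, e, Nat.reduceEqDiff, OfNat.ofNat_ne_zero, one_ne_zero,
      and_self, and_false, false_and, if_true, if_false, OfNat.ofNat_ne_one] at h1 h2
    linear_combination (1 / 2) * h1 + (1 / 2) * h2
  have r2 : A0 * A3 + 7 / 3 * A1 * A2 = 0 := by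
    have h1 := H 1 0 0 0 0 0 0 2 0 1 rfl
    have h2 := H 0 0 0 0 1 0 0 1 1 1 rfl
    simp only [Nat.reduceAdd, hφ, hτ, e, Nat.reduceEqDiff, OfNat.ofNat_ne_zero, one_ne_zero,
      and_self, and_false, false_and, if_true, if_false, OfNat.ofNat_ne_one] at h1 h2
    linear_combination (1) * h1 + (1) * h2
  have r3 : A1 * A3 + 2 / 3 * A2 * A2 = 0 := by
    have h1 := H 0 1 0 0 0 0 0 2 0 1 rfl
    have h2 := H 0 0 0 0 0 0 1 1 1 1 rfl
    simp only [Nat.reduceAdd, hφ, hτ, e, Nat.reduceEqDiff, OfNat.ofNat_ne_zero, one_ne_zero,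
      and_self, and_false, false_and, if_true, if_false, OfNat.ofNat_ne_one] at h1 h2
    linear_combination (3 / 2) * h1 + (3 / 4) * h2
  have r5 : A2 * A4 + 2 / 3 * A3 * A3 = 0 := by
    have h1 := H 0 0 0 1 0 0 0 2 0 1 rfl
    have h2 := H 0 0 0 0 0 1 0 1 0 2 rfl
    simp only [Nat.reduceAdd, hφ, hτ, e, Nat.reduceEqDiff, OfNat.ofNat_ne_zero, one_ne_zero,
      and_self, and_false, false_and, if_true, if_false, OfNat.ofNat_ne_one] at h1 h2
    linear_combination (1 / 2) * h1 + (1 / 2) * h2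
  have r6 : A0 * A4 + 4 / 3 * A1 * A3 + A2 * A2 = 0 := by
    have h1 := H 0 1 0 0 0 0 0 2 0 1 rfl
    have h2 := H 0 0 0 0 1 0 0 1 0 2 rfl
    simp only [Nat.reduceAdd, hφ, hτ, e, Nat.reduceEqDiff, OfNat.ofNat_ne_zero, one_ne_zero,
      and_self, and_false, false_and, if_true, if_false, OfNat.ofNat_ne_one] at h1 h2
    linear_combination (3) * h1 + (1) * h2
  have r8 : A1 - 1 / 4 * B0 * B4 + 1 / 6 * B1 * B3 + 1 / 12 * B2 * B2 = 0 := by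
    have h1 := H 0 1 0 0 0 0 0 0 2 1 rfl
    have h2 := H 1 0 0 0 0 0 0 0 1 2 rfl
    simp only [Nat.reduceAdd, hφ, hτ, e, Nat.reduceEqDiff, OfNat.ofNat_ne_zero, one_ne_zero,
      and_self, and_false, false_and, if_true, if_false, OfNat.ofNat_ne_one] at h1 h2
    linear_combination (-3 / 4) * h1 + (1 / 4) * h2
  have r9 : A3 - 1 / 4 * B1 * B5 + 1 / 6 * B2 * B4 + 1 / 12 * B3 * B3 = 0 := by
    have h1 := H 0 0 1 0 0 0 0 0 1 2 rfl
    have h2 := H 0 1 0 0 0 0 0 0 0 3 rfl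
    simp only [Nat.reduceAdd, hφ, hτ, e, Nat.reduceEqDiff, OfNat.ofNat_ne_zero, one_ne_zero,
      and_self, and_false, false_and, if_true, if_false, OfNat.ofNat_ne_one] at h1 h2
    linear_combination (-3 / 4) * h1 + (3 / 4) * h2
  have r10 : A0 * B3 + 1 / 3 * A1 * B2 - 1 / 3 * A2 * B1 - A3 * B0 = 0 := by
    have h1 := H 1 0 0 0 0 0 0 1 1 1 rfl
    have h2 := H 0 0 0 0 1 0 0 0 2 1 rfl
    simp only [Nat.reduceAdd, hφ, hτ, e, Nat.reduceEqDiff, OfNat.ofNat_ne_zero, one_ne_zero,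
      and_self, and_false, false_and, if_true, if_false, OfNat.ofNat_ne_one] at h1 h2
    linear_combination (1) * h1 + (1) * h2
  have r12 : A1 * B3 + 1 / 3 * A2 * B2 - 1 / 3 * A3 * B1 - A4 * B0 = 0 := by
    have h1 := H 0 1 0 0 0 0 0 1 1 1 rfl
    have h2 := H 1 0 0 0 0 0 0 1 0 2 rfl
    simp only [Nat.reduceAdd, hφ, hτ, e, Nat.reduceEqDiff, OfNat.ofNat_ne_zero, one_ne_zero,
      and_self, and_false, false_and, if_true, if_false, OfNat.ofNat_ne_one] at h1 h2
    linear_combination (-3) * h1 + (1) * h2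
  have r13 : A2 - 1 / 8 * B0 * B5 - 1 / 24 * B1 * B4 + 1 / 6 * B2 * B3 = 0 := by
    have h1 := H 0 1 0 0 0 0 0 0 1 2 rfl
    have h2 := H 1 0 0 0 0 0 0 0 0 3 rfl
    simp only [Nat.reduceAdd, hφ, hτ, e, Nat.reduceEqDiff, OfNat.ofNat_ne_zero, one_ne_zero,
      and_self, and_false, false_and, if_true, if_false, OfNat.ofNat_ne_one] at h1 h2
    linear_combination (-3 / 8) * h1 + (1 / 8) * h2
  have r14 : A0 * B4 + 1 / 3 * A1 * B3 - 1 / 3 * A2 * B2 - A3 * B1 = 0 := by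
    have h1 := H 0 1 0 0 0 0 0 1 1 1 rfl
    have h2 := H 0 0 0 0 1 0 0 0 1 2 rfl
    simp only [Nat.reduceAdd, hφ, hτ, e, Nat.reduceEqDiff, OfNat.ofNat_ne_zero, one_ne_zero,
      and_self, and_false, false_and, if_true, if_false, OfNat.ofNat_ne_one] at h1 h2
    linear_combination (3) * h1 + (1) * h2
  have r16 : A1 * B4 + 1 / 3 * A2 * B3 - 1 / 3 * A3 * B2 - A4 * B1 = 0 := by
    have h1 := H 0 1 0 0 0 0 0 1 0 2 rfl
    have h2 := H 0 0 0 0 0 0 1 0 1 2 rfl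
    simp only [Nat.reduceAdd, hφ, hτ, e, Nat.reduceEqDiff, OfNat.ofNat_ne_zero, one_ne_zero,
      and_self, and_false, false_and, if_true, if_false, OfNat.ofNat_ne_one] at h1 h2
    linear_combination (3) * h1 + (3 / 2) * h2
  have r17 : A1 * B5 + 1 / 3 * A2 * B4 - 1 / 3 * A3 * B3 - A4 * B2 = 0 := by
    have h1 := H 0 0 1 0 0 0 0 1 0 2 rfl
    have h2 := H 0 0 0 0 0 0 1 0 0 3 rfl
    simp only [Nat.reduceAdd, hφ, hτ, e, Nat.reduceEqDiff, OfNat.ofNat_ne_zero, one_ne_zero,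
      and_self, and_false, false_and, if_true, if_false, OfNat.ofNat_ne_one] at h1 h2
    linear_combination (3) * h1 + (3 / 2) * h2
  have r18 : A0 * B5 + 1 / 3 * A1 * B4 - 1 / 3 * A2 * B3 - A3 * B2 = 0 := by
    have h1 := H 0 0 0 1 0 0 0 1 2 0 rfl
    have h2 := H 0 0 1 0 0 0 0 1 1 1 rfl
    simp only [Nat.reduceAdd, hφ, hτ, e, Nat.reduceEqDiff, OfNat.ofNat_ne_zero, one_ne_zero,
      and_self, and_false, false_and, if_true, if_false, OfNat.ofNat_ne_one] at h1 h2
    linear_combination (-1) * h1 + (3) * h2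
  -- In this syzygy of `r1`, `r2`, `r3` the terms containing A₀ cancel, leaving 25/9 times the
  -- monomial.
  have h1 : A1 ^ 2 * A2 = 0 := by
    linear_combination (9 / 25 : ℂ) * (A1 * r2 - A0 * r3 + 2 / 3 * A2 * r1)
  have A12 : A1 = 0 ∧ A2 = 0 := by
    rcases mul_eq_zero.1 h1 with h | h
    · have h := pow_eq_zero_iff (two_ne_zero) |>.1 h
      refine ⟨h, pow_eq_zero_iff (two_ne_zero) |>.1 (?_ : A2 ^ 2 = 0)⟩
      linear_combination (3 / 2 : ℂ) * r3 - (3 / 2 : ℂ) * A3 * h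
    · refine ⟨pow_eq_zero_iff (two_ne_zero) |>.1 (?_ : A1 ^ 2 = 0), h⟩
      linear_combination (3 / 2 : ℂ) * r1 - (3 / 2 : ℂ) * A0 * h
  obtain ⟨z1, z2⟩ := A12
  have z3 : A3 = 0 := by
    refine pow_eq_zero_iff (two_ne_zero) |>.1 (?_ : A3 ^ 2 = 0)
    linear_combination (3 / 2 : ℂ) * r5 - (3 / 2 : ℂ) * A4 * z2
  subst z1 z2 z3
  refine ⟨rfl, rfl, rfl, ?_, ?_, ?_, ?_, ?_, ?_, ?_, ?_, ?_, ?_⟩ <;>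
    simp only [Matrix.cons_val]
  · linear_combination (-12 : ℂ) * r8
  · linear_combination (-24 : ℂ) * r13
  · linear_combination (-12 : ℂ) * r9
  · linear_combination r6
  · linear_combination r10
  · linear_combination r14
  · linear_combination r18
  · linear_combination -r12
  · linear_combination -r16
  · linear_combination -r17

theorem exists_mem_repr_lead_eq {V : Type*} [AddCommGroup V] [Module ℂ V]
    (h : Module.Basis (Fin 4 × Fin 4) ℂ V) {N : Submodule ℂ V} (hN : Module.finrank ℂ N = 10)
    (hinj : ∀ g ∈ N, (∀ j, h.repr g (lead j) = 0) → g = 0) (y : Fin 10 → ℂ) :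
    ∃ g ∈ N, ∀ j, h.repr g (lead j) = y j := by
  have hfin : FiniteDimensional ℂ N := Module.finite_of_finrank_pos (by rw [hN]; norm_num)
  have hinj : Function.Injective ((leadCoord h).domRestrict N) := by
    rw [← LinearMap.ker_eq_bot, LinearMap.ker_eq_bot']
    exact fun g hg => Subtype.ext (hinj g g.2 fun j => congrFun hg j)
  obtain ⟨g, hg⟩ := (LinearMap.injective_iff_surjective_of_finrank_eq_finrank
    (by rw [hN, Module.finrank_fin_fun])).1 hinj y
  exact ⟨g, g.2, fun j => congrFun hg j⟩

/-- With all leading coordinates zero, each equation of `coord_eqs` is a nonzero multiple of one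
remaining coordinate. -/
theorem eq_zero_of_harmCoord_lead_eq_zero {I : Ideal T} (hI : ∀ g, X 0 * g ∈ I → g ∈ I)
    (hphi : ∀ g ∈ I, phi g = 0) {g : T} (hg : g ∈ W) (hgI : g ∈ I)
    (hl : ∀ j, harmCoord g (lead j) = 0) : g = 0 := by
  obtain ⟨t, htI, ht⟩ := exists_lift hI phi hphi
  obtain ⟨e00, e10, e01, e20, e02, e11⟩ := coord_eqs ht hg
    (fun f => htI _ (I.mul_mem_right f hgI)) (fun i j => harmCoord g (i, j)) (fun _ _ => rfl)
    (fun b c d => t (mono 0 b c d)) fun _ _ _ => rfl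
  simp only [Fin.forall_fin_succ] at hl
  simp [lead] at hl
  simp [hl] at e00 e10 e01 e20 e02 e11
  refine eq_zero_of_harmCoord_eq_zero hg ?_
  ext ⟨i, j⟩
  fin_cases i <;> fin_cases j <;> simp [hl, e00, e10, e01, e20, e02, e11]

/-- The cubic part of an apolar ideal through `(1 : 0 : 0 : 0)` without zeros in the plane `y₀ = 0`
lies in a member of the family. -/
theorem exists_isParam_of_le_ideal {I : Ideal T} (hI : ∀ g, X 0 * g ∈ I → g ∈ I)
    (hphi : ∀ g ∈ I, phi g = 0) (hev : ∀ g ∈ I, eval (Pi.single 0 1) g = 0)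
    {N : Submodule ℂ W} (hN : Module.finrank ℂ N = 10) (hmem : ∀ g ∈ N, (g : T) ∈ I) :
    ∃ w, IsParam w ∧ N ≤ (fam harmBasis w).1 := by
  obtain ⟨t, htI, ht⟩ := exists_lift hI phi hphi
  obtain ⟨θ, hθI, hθ⟩ := exists_lift hI t htI
  let τ : ℕ → ℕ → ℕ → ℂ := fun b c d => t (mono 0 b c d)
  let σ : ℕ → ℕ → ℕ → ℂ := fun b c d => θ (mono 0 b c d)
  have E := fun (g : W) (hg : g ∈ N) =>
    coord_eqs ht g.2 (fun f => htI _ (I.mul_mem_right f (hmem g hg)))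
      (fun i j => harmCoord g (i, j)) (fun _ _ => rfl) τ fun _ _ _ => rfl
  have F := fun (g : W) (hg : g ∈ N) =>
    coord_eqs_lift ht hθ g.2 (fun f => hθI _ (I.mul_mem_right f (hmem g hg)))
      (fun i j => harmCoord g (i, j)) (fun _ _ => rfl) τ σ (fun _ _ _ => rfl) fun _ _ _ => rfl
  -- Of the basis cubics only y₀³ is nonzero at the base point.
  have hx00 : ∀ g ∈ N, harmCoord g (0, 0) = 0 := fun g hg => by
    have h := hev g (hmem g hg)
    have e : (g : T) = ∑ i, ∑ j, harmCoord g (i, j) • harm (i, j) := by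
      rw [← Fintype.sum_prod_type (f := fun p => harmCoord g p • harm p)]
      exact sum_harm g
    rw [e, map_sum] at h
    simpa [Fin.sum_univ_four, harm, mono_eq, smul_eval] using h
  have hsurj : ∀ y : Fin 10 → ℂ, ∃ g ∈ N, ∀ j, harmCoord g (lead j) = y j :=
    exists_mem_repr_lead_eq harmBasis hN fun g hg hl =>
      Subtype.ext (eq_zero_of_harmCoord_lead_eq_zero hI hphi g.2 (hmem g hg) hl)
  -- Once the (0,0) coordinate is gone, the first equation of `coord_eqs` is a linear relation
  -- between ten coordinates that take arbitrary values, so all its coefficients vanish.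
  have hlin : ∀ y : Fin 10 → ℂ, y 0 * τ 2 3 0 + y 1 * τ 2 2 1 / 3 + y 2 * τ 2 1 2 / 3 +
      y 3 * τ 2 0 3 - y 4 * τ 3 2 0 - y 5 * τ 3 0 2 - y 6 * τ 3 1 1 * (2 / 3) + y 7 * τ 4 1 0
      + y 8 * τ 4 0 1 - y 9 * τ 5 0 0 = 0 := fun y => by
    obtain ⟨g, hg, hy⟩ := hsurj y
    have e := (E g hg).1
    rw [hx00 g hg, mul_zero, zero_add] at e
    simp only [← hy]
    exact e
  have t230 := hlin (Pi.single 0 1)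
  have t221 := hlin (Pi.single 1 1)
  have t212 := hlin (Pi.single 2 1)
  have t203 := hlin (Pi.single 3 1)
  have t320 := hlin (Pi.single 4 1)
  have t302 := hlin (Pi.single 5 1)
  have t311 := hlin (Pi.single 6 1)
  have t410 := hlin (Pi.single 7 1)
  have t401 := hlin (Pi.single 8 1)
  simp at t230 t221 t212 t203 t320 t302 t311 t410 t401
  simp only [t230, t221, t212, t203, t320, t302, t311, t410, t401] at E
  obtain ⟨z1, z2, z3, hw⟩ := isParam_of_relations (τ := τ) (σ := σ)
    (φ := fun b c d => phi (mono 0 b c d)) (A0 := τ 1 4 0 / 2) (A1 := τ 1 3 1 / 2)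
    (A2 := τ 1 2 2 / 2) (A3 := τ 1 1 3 / 2) (A4 := τ 1 0 4 / 2) (B0 := τ 0 5 0 / 2)
    (B1 := τ 0 4 1 / 2) (B2 := τ 0 3 2 / 2) (B3 := τ 0 2 3 / 2) (B4 := τ 0 1 4 / 2)
    (B5 := τ 0 0 5 / 2) (fun b c d => by simp [phi_mono])
    (by refine ⟨?_, ?_, ?_, ?_, ?_, ?_, ?_, ?_, ?_, ?_, ?_⟩ <;> ring)
    (fun c d h => by
      obtain rfl : d = 3 - c := by omega
      have : c ≤ 3 := by omega
      interval_cases c <;> assumption)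
    (fun c d h => by
      obtain rfl : d = 2 - c := by omega
      have : c ≤ 2 := by omega
      interval_cases c <;> assumption)
    (fun c d h => by
      obtain rfl : d = 1 - c := by omega
      have : c ≤ 1 := by omega
      interval_cases c <;> assumption)
    (fun y0 y1 y2 y3 y4 y5 y6 b c d _ => by
      obtain ⟨g, hg, hy⟩ := hsurj ![y0, y1, y2, y3, y4, y5, y6, 0, 0, 0]
      simp only [Fin.forall_fin_succ] at hy
      simp [lead] at hy
      have f := F g hg b c d
      obtain ⟨-, e10, e01, e20, e02, e11⟩ := E g hg
      have x00 := hx00 g hg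
      simp only [hy] at e10 e01 e20 e02 e11 f
      rw [x00] at f
      -- The five remaining nonleading coordinates are eliminated by means of the equations for t.
      linear_combination f - phi (mono 0 b (c + 1) d) / 2 * e10 - phi (mono 0 b c (d + 1)) / 2 * e01
        - τ b (c + 2) d / 4 * e20 - τ b c (d + 2) / 4 * e02
        - (2 * τ b (c + 1) (d + 1) - phi (mono 0 (b + 1) c d)) / 6 * e11)
  refine ⟨_, hw, fun g hg => ?_⟩
  have y1 : τ 1 3 1 = 0 := by linear_combination 2 * z1
  have y2 : τ 1 2 2 = 0 := by linear_combination 2 * z2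
  have y3 : τ 1 1 3 = 0 := by linear_combination 2 * z3
  obtain ⟨-, e10, e01, e20, e02, e11⟩ := E g hg
  simp only [y1, y2, y3] at e10 e01 e20 e02 e11
  rw [mem_fam_iff]
  simp only [harmBasis_repr, Matrix.cons_val]
  refine ⟨hx00 g hg, ?_, ?_, ?_, ?_, ?_⟩
  · linear_combination e10 / 2
  · linear_combination e01 / 2
  · linear_combination e20 / 4
  · linear_combination e02 / 4
  · linear_combination e11 / 2

end Classification

/-! ### The algebra of dimension ten attached to the parameters -/

section Algebra

/-- Multiplication by `y₁` on the basis `1, y₁, y₂, y₃, y₁², y₁y₂, y₁y₃, y₂², y₂y₃, y₃²`. -/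
def mul1 (w : Fin 8 → ℂ) : Module.End ℂ (Fin 10 → ℂ) where
  toFun v := ![0, v 0, 0, 0, v 1 + v 8 / 2, v 2, v 3, w 1 * v 9 / 2, 0, w 0 * v 7 / 2]
  map_add' u v := by
    ext i
    fin_cases i <;> simp <;> ring
  map_smul' c v := by
    ext i
    fin_cases i <;> simp <;> ring

/-- Multiplication by `y₂`. -/
def mul2 (w : Fin 8 → ℂ) : Module.End ℂ (Fin 10 → ℂ) where
  toFun v := ![0, -(w 3 * v 7 + w 4 * v 8 + w 5 * v 9) / 3, v 0, w 0 * v 7, v 6 / 2, v 1 + 2 * v 8,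
    2 * v 9, v 2 + (w 4 * v 7 + w 5 * v 8 + w 6 * v 9) / 2,
    v 3 + (w 3 * v 7 + w 4 * v 8 + w 5 * v 9) * 2 / 3,
    w 0 * v 5 / 2 + (w 2 * v 7 + w 3 * v 8 + w 4 * v 9) / 2]
  map_add' u v := by
    ext i
    fin_cases i <;> simp <;> ring
  map_smul' c v := by
    ext i
    fin_cases i <;> simp <;> ring

/-- Multiplication by `y₃`. -/
def mul3 (w : Fin 8 → ℂ) : Module.End ℂ (Fin 10 → ℂ) where
  toFun v := ![0, -(w 4 * v 7 + w 5 * v 8 + w 6 * v 9) / 3, w 1 * v 9, v 0, v 5 / 2, 2 * v 7,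
    v 1 + 2 * v 8, w 1 * v 6 / 2 + (w 5 * v 7 + w 6 * v 8 + w 7 * v 9) / 2,
    v 2 + (w 4 * v 7 + w 5 * v 8 + w 6 * v 9) * 2 / 3,
    v 3 + (w 3 * v 7 + w 4 * v 8 + w 5 * v 9) / 2]
  map_add' u v := by
    ext i
    fin_cases i <;> simp <;> ring
  map_smul' c v := by
    ext i
    fin_cases i <;> simp <;> ring

theorem mul1_apply (w : Fin 8 → ℂ) (v : Fin 10 → ℂ) : mul1 w v =
    ![0, v 0, 0, 0, v 1 + v 8 / 2, v 2, v 3, w 1 * v 9 / 2, 0, w 0 * v 7 / 2] := rfl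

theorem mul2_apply (w : Fin 8 → ℂ) (v : Fin 10 → ℂ) : mul2 w v =
    ![0, -(w 3 * v 7 + w 4 * v 8 + w 5 * v 9) / 3, v 0, w 0 * v 7, v 6 / 2, v 1 + 2 * v 8,
      2 * v 9, v 2 + (w 4 * v 7 + w 5 * v 8 + w 6 * v 9) / 2,
      v 3 + (w 3 * v 7 + w 4 * v 8 + w 5 * v 9) * 2 / 3,
      w 0 * v 5 / 2 + (w 2 * v 7 + w 3 * v 8 + w 4 * v 9) / 2] := rfl

theorem mul3_apply (w : Fin 8 → ℂ) (v : Fin 10 → ℂ) : mul3 w v =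
    ![0, -(w 4 * v 7 + w 5 * v 8 + w 6 * v 9) / 3, w 1 * v 9, v 0, v 5 / 2, 2 * v 7,
      v 1 + 2 * v 8, w 1 * v 6 / 2 + (w 5 * v 7 + w 6 * v 8 + w 7 * v 9) / 2,
      v 2 + (w 4 * v 7 + w 5 * v 8 + w 6 * v 9) * 2 / 3,
      v 3 + (w 3 * v 7 + w 4 * v 8 + w 5 * v 9) / 2] := rfl

set_option linter.unusedSimpArgs false in
theorem commute_mul1_mul2 {w : Fin 8 → ℂ} (hw : IsParam w) :
    Commute (mul1 w) (mul2 w) := by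
  refine LinearMap.ext fun v => funext fun i => ?_
  change mul1 w (mul2 w v) i = mul2 w (mul1 w v) i
  fin_cases i <;> simp only [mul1_apply, mul2_apply, mul3_apply, Fin.reduceFinMk, Fin.zero_eta,
    Fin.mk_one, Matrix.cons_val] <;> ring_nf
  · linear_combination 1 / 6 * v 7 * hw.a₅ + 1 / 6 * v 9 * hw.c₃
  · linear_combination -(1 / 2) * v 9 * hw.aa
  · linear_combination 1 / 4 * v 5 * hw.aa - 1 / 4 * v 7 * hw.a₆ + 1 / 4 * v 7 * hw.c₂
      + 1 / 4 * v 8 * hw.c₃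
  · linear_combination -(1 / 3) * v 7 * hw.a₅ - 1 / 3 * v 9 * hw.c₃
  · linear_combination 1 / 4 * v 8 * hw.a₅ + 1 / 4 * v 9 * hw.a₆ - 1 / 4 * v 9 * hw.c₂

set_option linter.unusedSimpArgs false in
theorem commute_mul1_mul3 {w : Fin 8 → ℂ} (hw : IsParam w) :
    Commute (mul1 w) (mul3 w) := by
  refine LinearMap.ext fun v => funext fun i => ?_
  change mul1 w (mul3 w v) i = mul3 w (mul1 w v) i
  fin_cases i <;> simp only [mul1_apply, mul2_apply, mul3_apply, Fin.reduceFinMk, Fin.zero_eta,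
    Fin.mk_one, Matrix.cons_val] <;> ring_nf
  · linear_combination 1 / 6 * v 7 * hw.a₆ + 1 / 6 * v 9 * hw.c₄
  · linear_combination -(1 / 2) * v 7 * hw.aa
  · linear_combination -(1 / 4) * v 7 * hw.a₇ + 1 / 4 * v 7 * hw.c₃ + 1 / 4 * v 8 * hw.c₄
  · linear_combination -(1 / 3) * v 7 * hw.a₆ - 1 / 3 * v 9 * hw.c₄
  · linear_combination 1 / 4 * v 6 * hw.aa + 1 / 4 * v 8 * hw.a₆ + 1 / 4 * v 9 * hw.a₇
      - 1 / 4 * v 9 * hw.c₃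

set_option linter.unusedSimpArgs false in
theorem commute_mul2_mul3 {w : Fin 8 → ℂ} (hw : IsParam w) :
    Commute (mul2 w) (mul3 w) := by
  refine LinearMap.ext fun v => funext fun i => ?_
  change mul2 w (mul3 w v) i = mul3 w (mul2 w v) i
  fin_cases i <;> simp only [mul1_apply, mul2_apply, mul3_apply, Fin.reduceFinMk, Fin.zero_eta,
    Fin.mk_one, Matrix.cons_val] <;> ring_nf
  · linear_combination 1 / 6 * v 5 * hw.a₆ - 1 / 6 * v 6 * hw.c₃ + 1 / 18 * v 7 * hw.q₁
      - 1 / 18 * v 9 * hw.q₃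
  · linear_combination -(1 / 2) * v 5 * hw.aa - 1 / 2 * v 7 * hw.c₂ - 1 / 2 * v 8 * hw.c₃
      - 1 / 2 * v 9 * hw.c₄
  · linear_combination 1 / 2 * v 6 * hw.aa + 1 / 2 * v 7 * hw.a₅ + 1 / 2 * v 8 * hw.a₆
      + 1 / 2 * v 9 * hw.a₇
  · linear_combination -(1 / 4) * v 5 * hw.a₇ + 1 / 4 * v 6 * hw.c₄ - 1 / 12 * v 7 * hw.q₂
      - 1 / 12 * v 8 * hw.q₃
  · linear_combination -(1 / 3) * v 5 * hw.a₆ + 1 / 3 * v 6 * hw.c₃ - 1 / 9 * v 7 * hw.q₁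
      + 1 / 9 * v 9 * hw.q₃
  · linear_combination -(1 / 4) * v 5 * hw.a₅ + 1 / 4 * v 6 * hw.c₂ + 1 / 12 * v 8 * hw.q₁
      + 1 / 12 * v 9 * hw.q₂

/-- Polynomial evaluation needs a commutative target; the subalgebra generated by the commuting
elements is one. -/
theorem exists_algHom_of_commute {A : Type*} [Ring A] [Algebra ℂ A] (M : Fin 4 → A)
    (hM : ∀ i j, Commute (M i) (M j)) :
    ∃ E : T →ₐ[ℂ] A, ∀ i, E (MvPolynomial.X i) = M i := by
  have hc : ∀ a ∈ Set.range M, ∀ b ∈ Set.range M, a * b = b * a := by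
    rintro _ ⟨i, rfl⟩ _ ⟨j, rfl⟩
    exact hM i j
  have := Algebra.isMulCommutative_adjoin ℂ hc
  open scoped IsMulCommutative in
  let F : T →ₐ[ℂ] Algebra.adjoin ℂ (Set.range M) :=
    MvPolynomial.aeval fun i => ⟨M i, Algebra.subset_adjoin ⟨i, rfl⟩⟩
  refine ⟨(Algebra.adjoin ℂ (Set.range M)).val.comp F, fun i => ?_⟩
  simp [F]

theorem exists_algHom_mul {w : Fin 8 → ℂ} (hw : IsParam w) :
    ∃ E : T →ₐ[ℂ] Module.End ℂ (Fin 10 → ℂ), E (MvPolynomial.X 0) = 1 ∧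
      E (MvPolynomial.X 1) = mul1 w ∧ E (MvPolynomial.X 2) = mul2 w ∧
      E (MvPolynomial.X 3) = mul3 w := by
  have h12 := commute_mul1_mul2 hw
  have h13 := commute_mul1_mul3 hw
  have h23 := commute_mul2_mul3 hw
  obtain ⟨E, hE⟩ := exists_algHom_of_commute ![1, mul1 w, mul2 w, mul3 w] (fun i j => by
    fin_cases i <;> fin_cases j <;>
      simp [h12, h13, h23, h12.symm, h13.symm, h23.symm])
  exact ⟨E, hE 0, hE 1, hE 2, hE 3⟩

end Algebra

/-! ### Homogeneous ideals -/

section Homogeneous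

open MvPolynomial

theorem homogeneousComponent_mul {l : T} {k : ℕ} (hl : l.IsHomogeneous k) (g : T) (d : ℕ) :
    homogeneousComponent (d + k) (l * g) = l * homogeneousComponent d g := by
  conv_lhs => rw [← sum_homogeneousComponent g, Finset.mul_sum, map_sum]
  have h : ∀ i, homogeneousComponent (d + k) (l * homogeneousComponent i g) =
      if i = d then l * homogeneousComponent i g else 0 := fun i => by
    have hm : l * homogeneousComponent i g ∈ homogeneousSubmodule (Fin 4) ℂ (k + i) :=
      hl.mul (homogeneousComponent_isHomogeneous i g)
    rw [homogeneousComponent_of_mem hm]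
    exact if_congr ⟨fun h => by omega, fun h => by omega⟩ rfl rfl
  simp only [h, Finset.sum_ite_eq', Finset.mem_range]
  split_ifs with hd
  · rfl
  · rw [homogeneousComponent_eq_zero _ _ (by omega), mul_zero]

theorem mem_iff_homogeneousComponent {I : Ideal T}
    (hI : I.IsHomogeneous (homogeneousSubmodule (Fin 4) ℂ)) (g : T) :
    g ∈ I ↔ ∀ d, homogeneousComponent d g ∈ I := by
  rw [hI.mem_iff]
  exact forall_congr' fun d => by rw [← decomposition.decompose'_apply]; rfl

theorem mem_homogeneousCore_iff (K : Ideal T) (g : T) :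
    g ∈ (K.homogeneousCore (homogeneousSubmodule (Fin 4) ℂ)).toIdeal ↔
      ∀ d, homogeneousComponent d g ∈ K := by
  rw [mem_iff_homogeneousComponent (HomogeneousIdeal.isHomogeneous _)]
  refine forall_congr' fun d => ⟨fun h => Ideal.toIdeal_homogeneousCore_le _ K h, fun h => ?_⟩
  exact Ideal.mem_homogeneousCore_of_homogeneous_of_mem
    ⟨d, homogeneousComponent_isHomogeneous d g⟩ h

theorem coeff_ex_mono_mul (a b c d a' b' c' d' : ℕ) (g : T) :
    coeff (ex a b c d) (mono a' b' c' d' * g) =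
      if a' ≤ a ∧ b' ≤ b ∧ c' ≤ c ∧ d' ≤ d then coeff (ex (a - a') (b - b') (c - c') (d - d')) g
        else 0 := by
  have h1 : ex a' b' c' d' ≤ ex a b c d ↔ a' ≤ a ∧ b' ≤ b ∧ c' ≤ c ∧ d' ≤ d := by
    rw [← Finsupp.coe_le_coe, Pi.le_def]
    simp [Fin.forall_fin_succ, ex]
  have h2 : ex a b c d - ex a' b' c' d' = ex (a - a') (b - b') (c - c') (d - d') := by
    ext i; fin_cases i <;> simp [ex]
  rw [mono, coeff_monomial_mul', h2, one_mul]
  exact if_congr h1 rfl rfl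

/-- The pairing of quadratic monomials is monomial except on y₀y₁ and y₂y₃, where its 2 × 2 block is
invertible. So an apolar ideal contains no nonzero quadric. -/
theorem eq_zero_of_forall_phi_mul_eq_zero {g : T} (hg : g.IsHomogeneous 2)
    (h : ∀ f, phi (g * f) = 0) : g = 0 := by
  have key : ∀ a b c d, phi (mono a b c d * g) = 0 := fun a b c d => by rw [mul_comm, h]
  ext m
  obtain ⟨a, b, c, d, rfl⟩ := exists_ex m
  rw [coeff_zero]
  by_cases hd : a + b + c + d = 2
  · have k1 := key 2 0 0 0
    have k2 := key 0 2 0 0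
    have k3 := key 0 0 2 0
    have k4 := key 0 0 0 2
    have k5 := key 1 0 1 0
    have k6 := key 1 0 0 1
    have k7 := key 0 1 1 0
    have k8 := key 0 1 0 1
    have k9 := key 1 1 0 0
    have k10 := key 0 0 1 1
    simp [phi_apply, coeff_ex_mono_mul] at k1 k2 k3 k4 k5 k6 k7 k8 k9 k10
    have k11 : coeff (ex 1 1 0 0) g = 0 := by linear_combination 1 / 3 * k9 - 1 / 6 * k10
    have k12 : coeff (ex 0 0 1 1) g = 0 := by linear_combination 1 / 3 * k10 - 1 / 6 * k9
    have ha : a ≤ 2 := by omega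
    have hb : b ≤ 2 - a := by omega
    have hc : c ≤ 2 - a - b := by omega
    obtain rfl : d = 2 - a - b - c := by omega
    clear hd h hg key
    interval_cases a <;> interval_cases b <;> interval_cases c <;> assumption
  · exact hg.coeff_eq_zero (by rw [degree_ex]; exact hd)

end Homogeneous

/-! ### The ideals of the members of the family -/

section Ideals

open MvPolynomial

/-- The quadratic monomials. -/
def quadMono : Fin 10 → T :=
  ![mono 2 0 0 0, mono 1 1 0 0, mono 1 0 1 0, mono 1 0 0 1, mono 0 2 0 0, mono 0 1 1 0,
    mono 0 1 0 1, mono 0 0 2 0, mono 0 0 1 1, mono 0 0 0 2]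

theorem isHomogeneous_quadMono (j : Fin 10) : (quadMono j).IsHomogeneous 2 := by
  fin_cases j <;> exact isHomogeneous_mono _ _ _ _

/-- `E` is the representation of the polynomial ring with `y₀ = 1` attached to `w`. -/
structure IsRep (w : Fin 8 → ℂ) (E : T →ₐ[ℂ] Module.End ℂ (Fin 10 → ℂ)) : Prop where
  zero : E (X 0) = 1
  one : E (X 1) = mul1 w
  two : E (X 2) = mul2 w
  three : E (X 3) = mul3 w

variable {w : Fin 8 → ℂ} {E : T →ₐ[ℂ] Module.End ℂ (Fin 10 → ℂ)}

theorem IsRep.mono_apply (hE : IsRep w E) (a b c d : ℕ) (v : Fin 10 → ℂ) :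
    E (mono a b c d) v = (mul1 w)^[b] ((mul2 w)^[c] ((mul3 w)^[d] v)) := by
  rw [mono_eq, map_mul, map_mul, map_mul, map_pow, map_pow, map_pow, map_pow, hE.zero, hE.one,
    hE.two, hE.three, one_pow, one_mul]
  simp [Module.End.pow_apply]

/-- The unit of the algebra. -/
def unit : Fin 10 → ℂ := ![1, 0, 0, 0, 0, 0, 0, 0, 0, 0]

/-- The ten homogenized basis monomials recover the standard basis, so `unit` is a cyclic vector. -/
theorem IsRep.quadMono_apply (hE : IsRep w E) (j : Fin 10) :
    E (quadMono j) unit = Pi.single j 1 := by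
  ext i
  fin_cases j <;> simp only [quadMono, Fin.reduceFinMk, Fin.zero_eta, Fin.mk_one, Matrix.cons_val,
    hE.mono_apply, Function.iterate_zero, id, Function.iterate_succ, Function.comp,
    mul1_apply, mul2_apply, mul3_apply, unit] <;>
  fin_cases i <;> simp

/-- The image of `E` is commutative and `unit` is cyclic, so an operator killing `unit` kills
everything. -/
theorem IsRep.eq_zero_iff (hE : IsRep w E) (g : T) : E g = 0 ↔ E g unit = 0 := by
  refine ⟨fun h => by rw [h]; rfl, fun h => ?_⟩
  refine (Pi.basisFun ℂ (Fin 10)).ext fun j => ?_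
  rw [Pi.basisFun_apply, ← hE.quadMono_apply j, ← Module.End.mul_apply, ← map_mul, mul_comm,
    map_mul, Module.End.mul_apply, h, map_zero, LinearMap.zero_apply]

theorem IsRep.exists_quadric (hE : IsRep w E) (v : Fin 10 → ℂ) :
    ∃ g : T, g.IsHomogeneous 2 ∧ E g unit = v := by
  refine ⟨∑ j, v j • quadMono j, ?_, ?_⟩
  · rw [← mem_homogeneousSubmodule]
    exact Submodule.sum_mem _ fun j _ => Submodule.smul_mem _ _ (isHomogeneous_quadMono j)
  · rw [map_sum, LinearMap.sum_apply]
    simp only [map_smul, LinearMap.smul_apply, hE.quadMono_apply]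
    ext i
    simp [Finset.sum_apply, Pi.single_apply]

/-- The operators of y₁, y₂, y₃ have zero first row, so the first coordinate is the character of the
base point; hence the scheme contains it. -/
theorem IsRep.eval_eq (hE : IsRep w E) (g : T) (v : Fin 10 → ℂ) :
    (E g v) 0 = eval (Pi.single 0 1) g * v 0 := by
  induction g using MvPolynomial.induction_on generalizing v with
  | C c =>
    rw [← algebraMap_eq, AlgHom.commutes, Module.algebraMap_end_apply]
    simp [algebraMap_eq]
  | add p r hp hr => rw [map_add, LinearMap.add_apply, Pi.add_apply, hp, hr, map_add, add_mul]
  | mul_X p i hp =>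
    rw [map_mul, Module.End.mul_apply, hp, map_mul, mul_assoc]
    congr 1
    fin_cases i
    · simp [hE.zero]
    · simp [hE.one, mul1_apply]
    · simp [hE.two, mul2_apply]
    · simp [hE.three, mul3_apply]

/-- The coordinate of y₁² is, up to the factor 4 = phi(y₀²y₁²), the functional `phi` on the algebra.
Its table of values on products is independent of `w`. -/
theorem IsRep.quadMono_apply_four (hE : IsRep w E) (j : Fin 10) (v : Fin 10 → ℂ) :
    (E (quadMono j) v) 4 = (![v 4, v 1 + v 8 / 2, v 6 / 2, v 5 / 2, v 0, v 3 / 2, v 2 / 2, v 9,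
      v 1 / 2 + v 8, v 7] : Fin 10 → ℂ) j := by
  fin_cases j <;> simp [quadMono, hE.mono_apply, mul1_apply, mul2_apply, mul3_apply] <;> ring

theorem exists_quadMono {a b c d : ℕ} (h : a + b + c + d = 2) : ∃ j, mono a b c d = quadMono j := by
  have ha : a ≤ 2 := by omega
  have hb : b ≤ 2 - a := by omega
  have hc : c ≤ 2 - a - b := by omega
  obtain rfl : d = 2 - a - b - c := by omega
  clear h
  interval_cases a <;> interval_cases b <;> interval_cases c
  exacts [⟨9, rfl⟩, ⟨8, rfl⟩, ⟨7, rfl⟩, ⟨6, rfl⟩, ⟨5, rfl⟩, ⟨4, rfl⟩, ⟨3, rfl⟩, ⟨2, rfl⟩, ⟨1, rfl⟩,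
    ⟨0, rfl⟩]

theorem IsRep.phi_quadMono_mul (hE : IsRep w E) (i j : Fin 10) :
    phi (quadMono i * quadMono j) = 4 * (E (quadMono i * quadMono j) unit) 4 := by
  rw [map_mul E, Module.End.mul_apply, hE.quadMono_apply, hE.quadMono_apply_four]
  fin_cases i <;> fin_cases j <;> simp [quadMono, mono_mul, phi_mono] <;> norm_num

theorem IsRep.phi_eq (hE : IsRep w E) {g : T} (hg : g.IsHomogeneous 4) :
    phi g = 4 * (E g unit) 4 := by
  have hmono : ∀ a b c d, a + b + c + d = 4 → phi (mono a b c d) = 4 * (E (mono a b c d) unit) 4 :=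
      fun a b c d h => by
    obtain ⟨a', b', c', d', h1, h2, h3, h4, h5⟩ : ∃ a' b' c' d', a' + b' + c' + d' = 2 ∧ a' ≤ a ∧
        b' ≤ b ∧ c' ≤ c ∧ d' ≤ d := by
      refine ⟨min a 2, min b (2 - min a 2), min c (2 - min a 2 - min b (2 - min a 2)),
        2 - min a 2 - min b (2 - min a 2) - min c (2 - min a 2 - min b (2 - min a 2)), ?_, ?_, ?_,
        ?_, ?_⟩ <;> omega
    have e := mono_mul a' b' c' d' (a - a') (b - b') (c - c') (d - d')
    rw [Nat.add_sub_of_le h2, Nat.add_sub_of_le h3, Nat.add_sub_of_le h4,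
      Nat.add_sub_of_le h5] at e
    obtain ⟨i, hi⟩ := exists_quadMono h1
    obtain ⟨j, hj⟩ := exists_quadMono (a := a - a') (b := b - b') (c := c - c') (d := d - d')
      (by omega)
    rw [← e, hi, hj, hE.phi_quadMono_mul]
  rw [g.as_sum, map_sum, map_sum, LinearMap.sum_apply, Finset.sum_apply, Finset.mul_sum]
  refine Finset.sum_congr rfl fun m hm => ?_
  obtain ⟨a, b, c, d, rfl⟩ := exists_ex m
  have hd : a + b + c + d = 4 := by
    by_contra h
    exact mem_support_iff.1 hm (hg.coeff_eq_zero (by rwa [degree_ex]))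
  have e : monomial (ex a b c d) (coeff (ex a b c d) g) = coeff (ex a b c d) g • mono a b c d := by
    rw [mono, smul_monomial, smul_eq_mul, mul_one]
  rw [e, map_smul, map_smul, hmono a b c d hd]
  simp
  ring

/-- The homogeneous ideal of the scheme defined by the representation. -/
def idealOf (E : T →ₐ[ℂ] Module.End ℂ (Fin 10 → ℂ)) : Ideal T :=
  ((RingHom.ker E).homogeneousCore (homogeneousSubmodule (Fin 4) ℂ)).toIdeal

theorem mem_idealOf_iff (g : T) : g ∈ idealOf E ↔ ∀ d, E (homogeneousComponent d g) = 0 :=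
  mem_homogeneousCore_iff _ g

theorem map_eq_zero_of_mem_idealOf {g : T} (hg : g ∈ idealOf E) : E g = 0 :=
  Ideal.toIdeal_homogeneousCore_le _ (RingHom.ker E) hg

theorem mem_idealOf_iff_of_isHomogeneous {g : T} {d : ℕ} (hg : g.IsHomogeneous d) :
    g ∈ idealOf E ↔ E g = 0 :=
  ⟨map_eq_zero_of_mem_idealOf, fun h =>
    Ideal.mem_homogeneousCore_of_homogeneous_of_mem ⟨d, hg⟩ h⟩

/-- Every element of the algebra is the value of a quadric, so a zero divisor in any degree produces
a quadric killed by the same linear form. -/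
theorem IsRep.mem_of_mul_mem (hE : IsRep w E) {l : T} (hl : l.IsHomogeneous 1)
    (h2 : ∀ f : T, f.IsHomogeneous 2 → l * f ∈ idealOf E → f = 0) {g : T}
    (hg : l * g ∈ idealOf E) : g ∈ idealOf E := by
  rw [mem_idealOf_iff] at hg ⊢
  intro d
  obtain ⟨f, hf, hfv⟩ := hE.exists_quadric (E (homogeneousComponent d g) unit)
  have h := hg (d + 1)
  rw [homogeneousComponent_mul hl, map_mul] at h
  have hlf : E (l * f) = 0 := by
    rw [hE.eq_zero_iff, map_mul, Module.End.mul_apply, hfv, ← Module.End.mul_apply, h,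
      LinearMap.zero_apply]
  have hf0 := h2 f hf ((mem_idealOf_iff_of_isHomogeneous (hl.mul hf)).2 hlf)
  rw [hE.eq_zero_iff, ← hfv, hf0, map_zero, LinearMap.zero_apply]

theorem IsRep.mem_of_X_zero_mul_mem (hE : IsRep w E) {g : T} (hg : X 0 * g ∈ idealOf E) :
    g ∈ idealOf E := by
  rw [mem_idealOf_iff] at hg ⊢
  intro d
  have h := hg (d + 1)
  rwa [homogeneousComponent_mul (isHomogeneous_X ℂ 0), map_mul, hE.zero, one_mul] at h

/-- Since y₀ acts as the identity, padding quadrics with powers of y₀ shows that each degree d ≥ 2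
maps onto the whole algebra. -/
theorem IsRep.hilb_eq (hE : IsRep w E) {d : ℕ} (hd : 2 ≤ d) : hilb (idealOf E) d = 10 := by
  let S := homogeneousSubmodule (Fin 4) ℂ d
  let F : S →ₗ[ℂ] (Fin 10 → ℂ) := (LinearMap.applyₗ unit) ∘ₗ E.toLinearMap ∘ₗ S.subtype
  have hker : ((idealOf E).restrictScalars ℂ).comap S.subtype = LinearMap.ker F := by
    ext g
    exact (mem_idealOf_iff_of_isHomogeneous g.2).trans (hE.eq_zero_iff g)
  have hsurj : LinearMap.range F = ⊤ := by
    rw [LinearMap.range_eq_top]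
    intro v
    obtain ⟨f, hf, hfv⟩ := hE.exists_quadric v
    refine ⟨⟨X 0 ^ (d - 2) * f, ?_⟩, ?_⟩
    · have := ((isHomogeneous_X ℂ (0 : Fin 4)).pow (d - 2)).mul hf
      rwa [one_mul, Nat.sub_add_cancel hd] at this
    · change E (X 0 ^ (d - 2) * f) unit = v
      rw [map_mul, map_pow, hE.zero, one_pow, one_mul, hfv]
  unfold hilb
  rw [hker, F.quotKerEquivRange.finrank_eq, hsurj, finrank_top, Module.finrank_fin_fun]

theorem IsRep.isIdealOfLength (hE : IsRep w E) : IsIdealOfLength 10 (idealOf E) where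
  homogeneous := HomogeneousIdeal.isHomogeneous _
  saturated _ hg := hE.mem_of_X_zero_mul_mem (hg 0)
  length := Filter.eventually_atTop.2 ⟨2, fun _ => hE.hilb_eq⟩

theorem phi_homogeneousComponent (g : T) : phi (homogeneousComponent 4 g) = phi g := by
  simp only [phi_apply, coeff_homogeneousComponent, degree_ex]
  norm_num

theorem IsRep.phi_eq_zero (hE : IsRep w E) {g : T} (hg : g ∈ idealOf E) : phi g = 0 := by
  rw [← phi_homogeneousComponent, hE.phi_eq (homogeneousComponent_isHomogeneous 4 g),
    (mem_idealOf_iff g).1 hg 4]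
  simp

theorem IsRep.eval_eq_zero (hE : IsRep w E) {g : T} (hg : g ∈ idealOf E) :
    eval (Pi.single 0 1) g = 0 := by
  have h := hE.eval_eq g unit
  rw [map_eq_zero_of_mem_idealOf hg] at h
  simpa [unit] using h.symm

theorem IsRep.famVec_apply (hE : IsRep w E) (j : Fin 10) :
    E (famVec harmBasis w j : W) unit = 0 := by
  ext i
  fin_cases j <;> simp only [famVec, Fin.reduceFinMk, Fin.zero_eta, Fin.mk_one, Matrix.cons_val,
    Submodule.coe_sub, Submodule.coe_add, Submodule.coe_smul, harmBasis_apply, harm, map_sub,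
    map_add, map_smul, map_neg, LinearMap.sub_apply, LinearMap.add_apply, LinearMap.smul_apply,
    LinearMap.neg_apply, hE.mono_apply, Function.iterate_zero, id, Function.iterate_succ,
    Function.comp, mul1_apply, mul2_apply, mul3_apply, unit] <;>
  fin_cases i <;> simp <;> ring

/-- The spanning vectors are killed by `E`. Conversely, subtracting the combination with the same
leading coordinates leaves an ideal member with none, which is zero. -/
theorem IsRep.cubics_fam (hE : IsRep w E) :
    cubics (fam harmBasis w) = degPart (idealOf E) 3 := by
  have hle : ∀ g ∈ (fam harmBasis w).1, (g : T) ∈ idealOf E := fun g hg => by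
    induction hg using Submodule.span_induction with
    | mem x hx =>
      obtain ⟨j, rfl⟩ := hx
      rw [mem_idealOf_iff_of_isHomogeneous ((mem_W_iff _).1 (famVec harmBasis w j).2).1,
        hE.eq_zero_iff]
      exact hE.famVec_apply j
    | zero => exact zero_mem _
    | add x y _ _ hx hy => exact add_mem hx hy
    | smul c x _ hx => exact ((idealOf E).restrictScalars ℂ).smul_mem c hx
  apply le_antisymm
  · rintro _ ⟨g, hg, rfl⟩
    exact ⟨hle g hg, ((mem_W_iff _).1 g.2).1⟩
  · rintro g ⟨hgI, hg3⟩
    have hgW : g ∈ W := (mem_W_iff g).2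
      ⟨hg3, fun i => hE.phi_eq_zero ((idealOf E).mul_mem_left _ hgI)⟩
    let f : W := ∑ j, harmCoord g (lead j) • famVec harmBasis w j
    have hf : f ∈ (fam harmBasis w).1 :=
      Submodule.sum_mem _ fun j _ => Submodule.smul_mem _ _ (famVec_mem harmBasis w j)
    refine ⟨f, hf, ?_⟩
    have h0 : ((⟨g, hgW⟩ - f : W) : T) = 0 := by
      refine eq_zero_of_harmCoord_lead_eq_zero (fun _ => hE.mem_of_X_zero_mul_mem)
        (fun _ => hE.phi_eq_zero) (Subtype.coe_prop _) (sub_mem hgI (hle f hf)) fun j => ?_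
      change leadCoord harmBasis (⟨g, hgW⟩ - f) j = 0
      simp only [f, map_sub, map_sum, map_smul, leadCoord_famVec]
      have : leadCoord harmBasis ⟨g, hgW⟩ j = harmCoord g (lead j) := rfl
      simp [Finset.sum_apply, Pi.single_apply, this]
    exact (sub_eq_zero.1 h0).symm

end Ideals

/-! ### Linear substitutions and isometries -/

section Isometry

open MvPolynomial

/-- The substitution of the linear forms `∑ⱼ Mᵢⱼyⱼ`. -/
def sub (M : Matrix (Fin 4) (Fin 4) ℂ) : T →ₐ[ℂ] T := aeval fun i => ∑ j, C (M i j) * X j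

theorem sub_X (M : Matrix (Fin 4) (Fin 4) ℂ) (i : Fin 4) : sub M (X i) = ∑ j, C (M i j) * X j :=
  aeval_X _ _

theorem aeval_sub {R : Type*} [CommRing R] [Algebra ℂ R] (M : Matrix (Fin 4) (Fin 4) ℂ)
    (z : Fin 4 → R) (f : T) :
    aeval z (sub M f) = aeval (fun i => ∑ j, algebraMap ℂ R (M i j) * z j) f := by
  have : (aeval z).comp (sub M) = aeval (fun i => ∑ j, algebraMap ℂ R (M i j) * z j) := by
    ext i
    simp [sub_X]
  rw [← this]
  rfl

theorem eval_sub (M : Matrix (Fin 4) (Fin 4) ℂ) (z : Fin 4 → ℂ) (f : T) :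
    eval z (sub M f) = eval (M.mulVec z) f := by
  exact aeval_sub M z f

theorem sub_sub (M N : Matrix (Fin 4) (Fin 4) ℂ) (f : T) : sub M (sub N f) = sub (N * M) f := by
  refine MvPolynomial.funext fun z => ?_
  rw [eval_sub, eval_sub, eval_sub, Matrix.mulVec_mulVec]

theorem sub_one (f : T) : sub 1 f = f := by
  refine MvPolynomial.funext fun z => ?_
  rw [eval_sub, Matrix.one_mulVec]

theorem sub_sub_of_mul_eq_one {M N : Matrix (Fin 4) (Fin 4) ℂ} (h : M * N = 1) (f : T) :
    sub N (sub M f) = f := by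
  rw [sub_sub, h, sub_one]

theorem isHomogeneous_sub (M : Matrix (Fin 4) (Fin 4) ℂ) {f : T} {d : ℕ} (hf : f.IsHomogeneous d) :
    (sub M f).IsHomogeneous d := by
  have := hf.aeval (fun i => ∑ j, C (M i j) * X j) (n := 1) fun i =>
    IsHomogeneous.sum _ _ _ fun j _ => isHomogeneous_C_mul_X _ _
  rwa [one_mul] at this

theorem sub_homogeneousComponent (M : Matrix (Fin 4) (Fin 4) ℂ) (f : T) (d : ℕ) :
    sub M (homogeneousComponent d f) = homogeneousComponent d (sub M f) := by
  conv_rhs => rw [← sum_homogeneousComponent f, map_sum, map_sum]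
  have h : ∀ i, homogeneousComponent d (sub M (homogeneousComponent i f)) =
      if d = i then sub M (homogeneousComponent i f) else 0 := fun i =>
    homogeneousComponent_of_mem (isHomogeneous_sub M (homogeneousComponent_isHomogeneous i f))
  simp only [h, Finset.sum_ite_eq, Finset.mem_range]
  split_ifs with hd
  · rfl
  · rw [homogeneousComponent_eq_zero _ _ (by omega), map_zero]

theorem pderiv_sub (M : Matrix (Fin 4) (Fin 4) ℂ) (i : Fin 4) (f : T) :
    pderiv i (sub M f) = ∑ k, C (M k i) * sub M (pderiv k f) := by
  induction f using MvPolynomial.induction_on with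
  | C c => simp [sub]
  | add p r hp hr => simp only [map_add, hp, hr, mul_add, Finset.sum_add_distrib]
  | mul_X p k hp =>
    rw [map_mul, Derivation.leibniz, hp, sub_X]
    have e : pderiv i (∑ j, C (M k j) * X j : T) = C (M k i) := by
      rw [map_sum, Finset.sum_eq_single i]
      · simp
      · intro j _ hj
        simp [pderiv_X, hj]
      · simp
    have e' : ∀ r, C (M r i) * sub M (pderiv r (p * X k)) = (if k = r then C (M r i) * sub M p else 0)
        + sub M (X k) * (C (M r i) * sub M (pderiv r p)) := fun r => by
      rw [Derivation.leibniz, pderiv_X, Pi.single_apply, map_add, smul_eq_mul, smul_eq_mul, map_mul,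
        map_mul]
      split_ifs with h
      · rw [map_one]
        ring
      · rw [map_zero]
        ring
    simp only [e, e', Finset.sum_add_distrib, ← Finset.mul_sum, Finset.sum_ite_eq, Finset.mem_univ,
      if_true, smul_eq_mul, sub_X]
    ring

/-- The Gram matrix of the inverse quadric. -/
def gram : Matrix (Fin 4) (Fin 4) ℂ := !![0, 1, 0, 0; 1, 0, 0, 0; 0, 0, 0, 1; 0, 0, 1, 0]

theorem gram_mul_gram : gram * gram = 1 := by
  ext i j
  fin_cases i <;> fin_cases j <;> simp [gram]

/-- `M` is an isometry of the inverse quadric. -/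
def IsIsom (M : Matrix (Fin 4) (Fin 4) ℂ) : Prop := M.transpose * gram * M = gram

/-- The inverse of an isometry. -/
def isomInv (M : Matrix (Fin 4) (Fin 4) ℂ) : Matrix (Fin 4) (Fin 4) ℂ :=
  gram * M.transpose * gram

theorem IsIsom.inv_mul {M : Matrix (Fin 4) (Fin 4) ℂ} (hM : IsIsom M) : isomInv M * M = 1 := by
  rw [isomInv, Matrix.mul_assoc, Matrix.mul_assoc, ← Matrix.mul_assoc _ gram M, hM, gram_mul_gram]

theorem IsIsom.mul_inv {M : Matrix (Fin 4) (Fin 4) ℂ} (hM : IsIsom M) : M * isomInv M = 1 :=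
  mul_eq_one_comm.1 hM.inv_mul

theorem IsIsom.mul_gram_mul {M : Matrix (Fin 4) (Fin 4) ℂ} (hM : IsIsom M) :
    M * gram * M.transpose = gram := by
  have h := hM.mul_inv
  rw [isomInv, ← Matrix.mul_assoc, ← Matrix.mul_assoc] at h
  calc M * gram * M.transpose = M * gram * M.transpose * gram * gram := by
        rw [Matrix.mul_assoc _ gram gram, gram_mul_gram, Matrix.mul_one]
    _ = gram := by rw [h, Matrix.one_mul]

theorem IsIsom.mul {M N : Matrix (Fin 4) (Fin 4) ℂ} (hM : IsIsom M) (hN : IsIsom N) :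
    IsIsom (M * N) := by
  have : (M * N).transpose * gram * (M * N) = N.transpose * (M.transpose * gram * M) * N := by
    simp only [Matrix.transpose_mul, Matrix.mul_assoc]
  rw [IsIsom, this, hM, hN]

theorem IsIsom.inv {M : Matrix (Fin 4) (Fin 4) ℂ} (hM : IsIsom M) : IsIsom (isomInv M) := by
  have ht : gram.transpose = gram := by
    ext i j
    fin_cases i <;> fin_cases j <;> simp [gram]
  have : (isomInv M).transpose * gram * isomInv M =
      gram * (M * (gram * gram) * gram * M.transpose) * gram := by
    simp only [isomInv, Matrix.transpose_mul, Matrix.mul_assoc, ht, Matrix.transpose_transpose]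
  rw [IsIsom, this, gram_mul_gram, Matrix.mul_one, hM.mul_gram_mul, gram_mul_gram, Matrix.one_mul]

/-- The Laplacian. -/
def lap (f : T) : T := pderiv 0 (pderiv 1 f) + pderiv 2 (pderiv 3 f)

/-- Expanding (∂₀∂₁ + ∂₂∂₃)² gives the weights of `phi`; in this form invariance under isometries is
visible. -/
theorem phi_eq_lap (f : T) : phi f = coeff 0 (lap (lap f)) := by
  have e1 : (Finsupp.single 0 1 + Finsupp.single 1 1 + (Finsupp.single 0 1 + Finsupp.single 1 1) :
      Fin 4 →₀ ℕ) = ex 2 2 0 0 := by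
    ext i; fin_cases i <;> simp [ex]
  have e2 : (Finsupp.single 0 1 + Finsupp.single 1 1 + (Finsupp.single 2 1 + Finsupp.single 3 1) :
      Fin 4 →₀ ℕ) = ex 1 1 1 1 := by
    ext i; fin_cases i <;> simp [ex]
  have e3 : (Finsupp.single 2 1 + Finsupp.single 3 1 + (Finsupp.single 2 1 + Finsupp.single 3 1) :
      Fin 4 →₀ ℕ) = ex 0 0 2 2 := by
    ext i; fin_cases i <;> simp [ex]
  have e4 : (Finsupp.single 2 1 + (Finsupp.single 3 1 + (Finsupp.single 0 1 + Finsupp.single 1 1)) :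
      Fin 4 →₀ ℕ) = Finsupp.single 0 1 + (Finsupp.single 1 1 + (Finsupp.single 2 1 +
        Finsupp.single 3 1)) := by
    ext i; fin_cases i <;> simp
  rw [phi_apply, ← e1, ← e2, ← e3, lap, lap]
  simp only [map_add, coeff_add, coeff_pderiv]
  simp [add_assoc, e4]
  ring

/-- By the chain rule the second derivatives are contracted with M · gram · Mᵀ, which an isometry
preserves. -/
theorem lap_sub {M : Matrix (Fin 4) (Fin 4) ℂ} (hM : IsIsom M) (f : T) :
    lap (sub M f) = sub M (lap f) := by
  have h : ∀ i j, (C (M i 0) * C (M j 1) + C (M i 1) * C (M j 0) + C (M i 2) * C (M j 3)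
      + C (M i 3) * C (M j 2) : T) = C (gram i j) := fun i j => by
    rw [← hM.mul_gram_mul]
    simp only [← map_mul, ← map_add]
    congr 1
    simp [Matrix.mul_apply, gram, Fin.sum_univ_four]
    ring
  have h2 : ∀ i, (C (M i 0) * C (M i 1) + C (M i 2) * C (M i 3) : T) = 0 := fun i => by
    have e : gram i i = 0 := by fin_cases i <;> simp [gram]
    have := h i i
    rw [e, map_zero] at this
    have h3 : (2 : T) * (C (M i 0) * C (M i 1) + C (M i 2) * C (M i 3)) = 0 := by
      linear_combination this
    exact (mul_eq_zero.1 h3).resolve_left two_ne_zero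
  have hc : ∀ i j, pderiv i (pderiv j f) = pderiv j (pderiv i f) := fun i j => by
    by_cases hij : i = j
    · rw [hij]
    · ext n
      simp only [coeff_pderiv, Finsupp.add_apply, Finsupp.single_apply, hij, Ne.symm hij, if_false,
        add_right_comm n]
      ring_nf
  have h01 := h 0 1
  have h02 := h 0 2
  have h03 := h 0 3
  have h12 := h 1 2
  have h13 := h 1 3
  have h23 := h 2 3
  simp [gram] at h01 h02 h03 h12 h13 h23
  simp only [lap, pderiv_sub, Derivation.leibniz, pderiv_C, smul_eq_mul, mul_zero,
    add_zero, Fin.sum_univ_four, map_add]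
  simp only [hc 1 0, hc 2 0, hc 3 0, hc 2 1, hc 3 1, hc 3 2]
  linear_combination sub M (pderiv 0 (pderiv 1 f)) * h01 + sub M (pderiv 0 (pderiv 2 f)) * h02
    + sub M (pderiv 0 (pderiv 3 f)) * h03 + sub M (pderiv 1 (pderiv 2 f)) * h12
    + sub M (pderiv 1 (pderiv 3 f)) * h13 + sub M (pderiv 2 (pderiv 3 f)) * h23
    + sub M (pderiv 0 (pderiv 0 f)) * h2 0 + sub M (pderiv 1 (pderiv 1 f)) * h2 1
    + sub M (pderiv 2 (pderiv 2 f)) * h2 2 + sub M (pderiv 3 (pderiv 3 f)) * h2 3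

theorem phi_sub {M : Matrix (Fin 4) (Fin 4) ℂ} (hM : IsIsom M) (f : T) : phi (sub M f) = phi f := by
  have h : ∀ g : T, coeff 0 g = eval 0 g := fun g => by
    rw [eval_zero, constantCoeff_eq]
  rw [phi_eq_lap, phi_eq_lap, lap_sub hM, lap_sub hM, h, h, eval_sub, Matrix.mulVec_zero]

end Isometry

/-! ### The action of isometries on apolar cubics and ideals -/

section Action

open MvPolynomial

variable {M : Matrix (Fin 4) (Fin 4) ℂ}

theorem IsIsom.sub_inv_sub (hM : IsIsom M) (f : T) : sub (isomInv M) (sub M f) = f :=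
  sub_sub_of_mul_eq_one hM.mul_inv f

theorem IsIsom.sub_sub_inv (hM : IsIsom M) (f : T) : sub M (sub (isomInv M) f) = f :=
  sub_sub_of_mul_eq_one hM.inv_mul f

theorem IsIsom.sub_mem_W (hM : IsIsom M) {g : T} (hg : g ∈ W) : sub M g ∈ W := by
  refine (mem_W_iff _).2 ⟨isHomogeneous_sub M ((mem_W_iff g).1 hg).1, fun i => ?_⟩
  rw [← hM.sub_sub_inv (X i), ← map_mul, phi_sub hM]
  exact (diffOn_eq_zero_iff g).1 hg.2 _

/-- The action of an isometry on apolar cubics. -/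
def subW (hM : IsIsom M) : W ≃ₗ[ℂ] W where
  toFun g := ⟨sub M g, hM.sub_mem_W g.2⟩
  map_add' f g := Subtype.ext (map_add (sub M) (f : T) g)
  map_smul' c f := Subtype.ext (map_smul (sub M) c (f : T))
  invFun g := ⟨sub (isomInv M) g, hM.inv.sub_mem_W g.2⟩
  left_inv g := Subtype.ext (hM.sub_inv_sub g)
  right_inv g := Subtype.ext (hM.sub_sub_inv g)

theorem coe_subW (hM : IsIsom M) (g : W) : (subW hM g : T) = sub M g := rfl

/-- The basis of the space of apolar cubics adapted to an isometry. -/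
def isoBasis (hM : IsIsom M) : Module.Basis (Fin 4 × Fin 4) ℂ W := harmBasis.map (subW hM).symm

theorem isoBasis_repr (hM : IsIsom M) (g : W) (p : Fin 4 × Fin 4) :
    (isoBasis hM).repr g p = harmCoord (sub M g) p := rfl

theorem mem_fam_isoBasis_iff (hM : IsIsom M) (w : Fin 8 → ℂ) (g : W) :
    g ∈ (fam (isoBasis hM) w).1 ↔ subW hM g ∈ (fam harmBasis w).1 := by
  rw [mem_fam_iff, mem_fam_iff]
  rfl

theorem comap_sub_isHomogeneous {I : Ideal T}
    (hI : I.IsHomogeneous (homogeneousSubmodule (Fin 4) ℂ)) (M : Matrix (Fin 4) (Fin 4) ℂ) :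
    (I.comap (sub M)).IsHomogeneous (homogeneousSubmodule (Fin 4) ℂ) := by
  intro d g hg
  change sub M _ ∈ I
  have e : (DirectSum.decompose (homogeneousSubmodule (Fin 4) ℂ) g d : T) =
      homogeneousComponent d g := by
    rw [← decomposition.decompose'_apply]; rfl
  rw [e, sub_homogeneousComponent]
  exact (mem_iff_homogeneousComponent hI _).1 hg d

theorem hilb_comap_sub (hM : IsIsom M) (I : Ideal T) (d : ℕ) :
    hilb (I.comap (sub M)) d = hilb I d := by
  let S := homogeneousSubmodule (Fin 4) ℂ d
  let e : S ≃ₗ[ℂ] S :=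
    { toFun := fun g => ⟨sub M g, isHomogeneous_sub M g.2⟩
      map_add' := fun f g => Subtype.ext (map_add (sub M) (f : T) g)
      map_smul' := fun c f => Subtype.ext (map_smul (sub M) c (f : T))
      invFun := fun g => ⟨sub (isomInv M) g, isHomogeneous_sub _ g.2⟩
      left_inv := fun g => Subtype.ext (hM.sub_inv_sub g)
      right_inv := fun g => Subtype.ext (hM.sub_sub_inv g) }
  refine (Submodule.Quotient.equiv _ _ e ?_).finrank_eq
  rw [Submodule.map_equiv_eq_comap_symm]
  ext g
  change sub M (sub (isomInv M) g) ∈ I ↔ _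
  rw [hM.sub_sub_inv]
  rfl

theorem IsIdealOfLength.comap_sub (hM : IsIsom M) {n : ℕ} {I : Ideal T} (hI : IsIdealOfLength n I) :
    IsIdealOfLength n (I.comap (sub M)) where
  homogeneous := comap_sub_isHomogeneous hI.homogeneous M
  saturated g hg := by
    refine hI.saturated _ fun i => ?_
    have e : X i = ∑ j, C (isomInv M i j) * sub M (X j) := by
      rw [← hM.sub_sub_inv (X i), sub_X, map_sum]
      simp [sub]
    rw [e, Finset.sum_mul]
    refine Ideal.sum_mem _ fun j _ => ?_
    rw [mul_assoc, ← map_mul]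
    exact I.mul_mem_left _ (hg j)
  length := hI.length.mono fun d hd => by rw [hilb_comap_sub hM, hd]

theorem phi_eq_zero_of_mem_comap_sub (hM : IsIsom M) {I : Ideal T} (hI : ∀ g ∈ I, phi g = 0) {g : T}
    (hg : g ∈ I.comap (sub M)) : phi g = 0 := by
  rw [← phi_sub hM]
  exact hI _ hg

theorem diffOn_eq_zero_of_forall_phi {I : Ideal T} (hI : ∀ g ∈ I, phi g = 0) {g : T} (hg : g ∈ I) :
    diffOn (q ^ 2) g = 0 :=
  (diffOn_eq_zero_iff g).2 fun f => hI _ (I.mul_mem_left f hg)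

theorem phi_eq_zero_of_diffOn {g : T} (hg : diffOn (q ^ 2) g = 0) : phi g = 0 := by
  have := (diffOn_eq_zero_iff g).1 hg 1
  rwa [one_mul] at this

/-- The members of the family are points of the variety. -/
theorem fam_isoBasis_mem_apolarThrough (hM : IsIsom M) {w : Fin 8 → ℂ} (hw : IsParam w) :
    fam (isoBasis hM) w ∈ apolarThrough (M.mulVec (Pi.single 0 1)) := by
  obtain ⟨E, h0, h1, h2, h3⟩ := exists_algHom_mul hw
  have hE : IsRep w E := ⟨h0, h1, h2, h3⟩
  have hphi : ∀ g ∈ (idealOf E).comap (sub M), phi g = 0 := fun g hg =>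
    phi_eq_zero_of_mem_comap_sub hM (fun _ => hE.phi_eq_zero) hg
  refine ⟨(idealOf E).comap (sub M), hE.isIdealOfLength.comap_sub hM,
    fun g hg => diffOn_eq_zero_of_forall_phi hphi hg, fun g hg => ?_, ?_⟩
  · rw [← eval_sub]
    exact hE.eval_eq_zero hg
  · ext g
    constructor
    · rintro ⟨x, hx, rfl⟩
      refine ⟨?_, ((mem_W_iff _).1 x.2).1⟩
      have : (subW hM x : T) ∈ cubics (fam harmBasis w) :=
        ⟨_, (mem_fam_isoBasis_iff hM w x).1 hx, rfl⟩
      rw [hE.cubics_fam] at this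
      exact this.1
    · rintro ⟨hgI, hg3⟩
      have hgW : g ∈ W := ⟨hg3, diffOn_eq_zero_of_forall_phi hphi hgI⟩
      have : sub M g ∈ degPart (idealOf E) 3 := ⟨hgI, isHomogeneous_sub M hg3⟩
      rw [← hE.cubics_fam] at this
      obtain ⟨y, hy, hyg⟩ := this
      refine ⟨⟨g, hgW⟩, (mem_fam_isoBasis_iff hM w _).2 ?_, rfl⟩
      have e : subW hM ⟨g, hgW⟩ = y := Subtype.ext hyg.symm
      rw [e]
      exact hy

/-- An apolar scheme that misses the image of the plane `y₀ = 0` is a member of the family. -/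
theorem exists_isParam_of_isoBasis (hM : IsIsom M) {I : Ideal T}
    (hI : ∀ g, sub (isomInv M) (X 0) * g ∈ I → g ∈ I) (hphi : ∀ g ∈ I, phi g = 0)
    (hev : ∀ g ∈ I, eval (M.mulVec (Pi.single 0 1)) g = 0) (Λ : Gr 10 W)
    (hΛ : ∀ g ∈ Λ.1, (g : T) ∈ I) : ∃ w, IsParam w ∧ Λ = fam (isoBasis hM) w := by
  have hN : Module.finrank ℂ (Λ.1.map (subW hM).toLinearMap) = 10 :=
    (LinearEquiv.finrank_map_eq _ _).trans Λ.2
  have h1 : ∀ g, X 0 * g ∈ I.comap (sub (isomInv M)) → g ∈ I.comap (sub (isomInv M)) :=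
      fun g hg => by
    rw [Ideal.mem_comap, map_mul] at hg
    exact hI _ hg
  have h2 : ∀ g ∈ I.comap (sub (isomInv M)), phi g = 0 := fun g hg =>
    phi_eq_zero_of_mem_comap_sub hM.inv hphi hg
  have h3 : ∀ g ∈ I.comap (sub (isomInv M)), eval (Pi.single 0 1) g = 0 := fun g hg => by
    have := hev _ hg
    rwa [eval_sub, Matrix.mulVec_mulVec, hM.inv_mul, Matrix.one_mulVec] at this
  have h4 : ∀ g ∈ Λ.1.map (subW hM).toLinearMap, (g : T) ∈ I.comap (sub (isomInv M)) := by
    rintro _ ⟨x, hx, rfl⟩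
    have e : sub (isomInv M) ((subW hM).toLinearMap x : W) = x := hM.sub_inv_sub x
    rw [Ideal.mem_comap, e]
    exact hΛ x hx
  obtain ⟨w, hw, h⟩ := exists_isParam_of_le_ideal h1 h2 h3 hN h4
  refine ⟨w, hw, Subtype.ext ?_⟩
  have : FiniteDimensional ℂ W := Module.Finite.of_basis harmBasis
  exact Submodule.eq_of_le_of_finrank_eq
    (fun g hg => (mem_fam_isoBasis_iff hM w g).2 (h ⟨g, hg, rfl⟩))
    (Λ.2.trans (fam _ w).2.symm)

end Action

/-! ### Isotropic planes that miss a scheme -/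

section Charts

open MvPolynomial

/-- Zero divisors on T/I lie in finitely many associated primes. By saturation none contains all
four forms, so each meets their span in a proper subspace. The curve (1, −b⁴, b, b³) meets a
hyperplane finitely often, hence some b avoids them all. -/
theorem exists_isotropic_nonZeroDivisor {I : Ideal T} (l : Fin 4 → T)
    (hI : ∀ g, (∀ i, l i * g ∈ I) → g ∈ I) :
    ∃ b c : ℂ, ∀ g, (l 0 - C (b * c) * l 1 + C b * l 2 + C c * l 3) * g ∈ I → g ∈ I := by
  let L : ℂ → T := fun b => l 0 - C (b * b ^ 3) * l 1 + C b * l 2 + C (b ^ 3) * l 3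
  suffices h : ∃ b, ∀ P ∈ associatedPrimes T (T ⧸ I), L b ∉ P by
    obtain ⟨b, hb⟩ := h
    refine ⟨b, b ^ 3, fun g hg => ?_⟩
    by_contra hgI
    have hz : L b ∈ ⋃ P ∈ associatedPrimes T (T ⧸ I), (P : Set T) := by
      rw [biUnion_associatedPrimes_eq_zero_divisors]
      refine ⟨Ideal.Quotient.mk I g, fun h => hgI (Ideal.Quotient.eq_zero_iff_mem.1 h), ?_⟩
      exact Ideal.Quotient.eq_zero_iff_mem.2 hg
    obtain ⟨P, hP, hm⟩ := Set.mem_iUnion₂.1 hz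
    exact hb P hP hm
  have hfin : ∀ P ∈ associatedPrimes T (T ⧸ I), {b | L b ∈ P}.Finite := fun P hP => by
    obtain ⟨hprime, x, hx⟩ := isAssociatedPrime_iff.1 hP
    obtain ⟨g, rfl⟩ := Ideal.Quotient.mk_surjective x
    let F : (Fin 4 → ℂ) →ₗ[ℂ] T := ∑ i, (LinearMap.proj i).smulRight (l i)
    have hF : ∀ a, F a = ∑ i, C (a i) * l i := fun a => by
      simp [F, smul_eq_C_mul]
    have hlt : (P.restrictScalars ℂ).comap F < ⊤ := by
      rw [lt_top_iff_ne_top]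
      intro htop
      have hl : ∀ i, l i ∈ P := fun i => by
        have : Pi.single i 1 ∈ (P.restrictScalars ℂ).comap F := by rw [htop]; trivial
        have h2 : F (Pi.single i 1) ∈ P := this
        rw [hF] at h2
        simpa [Pi.single_apply] using h2
      have hm : ∀ r, r ∈ P ↔ r * g ∈ I := fun r => by
        rw [hx, Submodule.mem_colon_singleton, Submodule.mem_bot]
        exact Ideal.Quotient.eq_zero_iff_mem
      refine hprime.ne_top ((Ideal.eq_top_iff_one P).2 ((hm 1).2 ?_))
      rw [one_mul]
      exact hI g fun i => (hm _).1 (hl i)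
    obtain ⟨f, hf0, hf⟩ := Submodule.exists_le_ker_of_lt_top _ hlt
    -- The exponents 0, 1, 3, 4 are distinct, so `p` vanishes identically only if the linear
    -- functional `f` does; this is why c = b³ is taken.
    let p : Polynomial ℂ := Polynomial.C (f (Pi.single 0 1)) -
      Polynomial.C (f (Pi.single 1 1)) * Polynomial.X ^ 4 +
      Polynomial.C (f (Pi.single 2 1)) * Polynomial.X +
      Polynomial.C (f (Pi.single 3 1)) * Polynomial.X ^ 3
    have hp : p ≠ 0 := by
      intro h
      refine hf0 (LinearMap.pi_ext' fun i => LinearMap.ext_ring ?_)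
      have c0 := congrArg (fun r => Polynomial.coeff r 0) h
      have c1 := congrArg (fun r => Polynomial.coeff r 1) h
      have c3 := congrArg (fun r => Polynomial.coeff r 3) h
      have c4 := congrArg (fun r => Polynomial.coeff r 4) h
      simp [p, Polynomial.coeff_X_pow, Polynomial.coeff_X, Polynomial.coeff_C] at c0 c1 c3 c4
      fin_cases i <;> simpa
    refine (Polynomial.finite_setOfPred_isRoot hp).subset fun b hb => ?_
    have hm : ![1, -(b * b ^ 3), b, b ^ 3] ∈ (P.restrictScalars ℂ).comap F := by
      change F _ ∈ P
      rw [hF]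
      have hb' : L b ∈ P := hb
      convert hb' using 1
      simp [L, Fin.sum_univ_four]
      ring
    have hk : f ![1, -(b * b ^ 3), b, b ^ 3] = 0 := hf hm
    have e : ![1, -(b * b ^ 3), b, b ^ 3] = (Pi.single 0 1 : Fin 4 → ℂ) -
        (b * b ^ 3) • Pi.single 1 1 + b • Pi.single 2 1 + b ^ 3 • Pi.single 3 1 := by
      ext i
      fin_cases i <;> simp
    rw [e] at hk
    simp only [map_add, map_sub, map_smul, smul_eq_mul] at hk
    change Polynomial.eval b p = 0
    simp only [p, Polynomial.eval_add, Polynomial.eval_sub, Polynomial.eval_mul, Polynomial.eval_C,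
      Polynomial.eval_X, Polynomial.eval_pow]
    linear_combination hk
  have hall := (associatedPrimes.finite T (T ⧸ I)).biUnion hfin
  obtain ⟨b, hb⟩ := hall.infinite_compl.nonempty
  refine ⟨b, fun P hP hm => hb (Set.mem_iUnion₂.2 ⟨P, hP, hm⟩)⟩

/-- The unipotent isometry that fixes the base point and moves the plane `y₀ = 0`. -/
def unip (b c : ℂ) : Matrix (Fin 4) (Fin 4) ℂ :=
  !![1, -(b * c), b, c; 0, 1, 0, 0; 0, -c, 1, 0; 0, -b, 0, 1]

theorem isIsom_unip (b c : ℂ) : IsIsom (unip b c) := by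
  ext i j
  fin_cases i <;> fin_cases j <;>
    simp [unip, gram, Matrix.mul_apply, Fin.sum_univ_four, mul_comm]

theorem isomInv_unip (b c : ℂ) : isomInv (unip b c) = unip (-b) (-c) := by
  have h : unip b c * unip (-b) (-c) = 1 := by
    ext i j
    fin_cases i <;> fin_cases j <;> simp [unip, Matrix.mul_apply, Fin.sum_univ_four]
    ring
  rw [← Matrix.mul_one (isomInv _), ← h, ← Matrix.mul_assoc, (isIsom_unip b c).inv_mul,
    Matrix.one_mul]

theorem unip_mulVec (b c : ℂ) : (unip b c).mulVec (Pi.single 0 1) = Pi.single 0 1 := by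
  ext i
  fin_cases i <;> simp [unip]

theorem sub_unip_X_zero (b c : ℂ) :
    sub (unip b c) (X 0) = X 0 - C (b * c) * X 1 + C b * X 2 + C c * X 3 := by
  simp [sub_X, unip, Fin.sum_univ_four]
  ring

theorem isomInv_mul (M N : Matrix (Fin 4) (Fin 4) ℂ) :
    isomInv (M * N) = isomInv N * isomInv M := by
  have h : isomInv (M * N) = gram * N.transpose * (gram * gram) * M.transpose * gram := by
    rw [gram_mul_gram]
    simp only [isomInv, Matrix.transpose_mul, Matrix.mul_assoc, Matrix.one_mul]
  rw [h]
  simp only [isomInv, Matrix.mul_assoc]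

theorem sub_inv_mul (M N : Matrix (Fin 4) (Fin 4) ℂ) (f : T) :
    sub (isomInv (M * N)) f = sub (isomInv M) (sub (isomInv N) f) := by
  rw [sub_sub, isomInv_mul]

variable {M : Matrix (Fin 4) (Fin 4) ℂ}

theorem IsIsom.mem_of_sub_inv_X_mul_mem (hM : IsIsom M) {I : Ideal T}
    (hI : ∀ g : T, (∀ i, X i * g ∈ I) → g ∈ I) {g : T}
    (hg : ∀ i, sub (isomInv M) (X i) * g ∈ I) : g ∈ I := by
  refine hI g fun i => ?_
  have e : X i = ∑ j, C (M i j) * sub (isomInv M) (X j) := by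
    rw [← hM.sub_inv_sub (X i), sub_X, map_sum]
    simp [sub]
  rw [e, Finset.sum_mul]
  refine Ideal.sum_mem _ fun j _ => ?_
  rw [mul_assoc]
  exact I.mul_mem_left _ (hg j)

theorem sub_inv_mul_unip_X_zero (b c : ℂ) :
    sub (isomInv (M * unip (-b) (-c))) (X 0) = sub (isomInv M) (X 0) -
      C (b * c) * sub (isomInv M) (X 1) + C b * sub (isomInv M) (X 2) +
      C c * sub (isomInv M) (X 3) := by
  rw [sub_inv_mul, isomInv_unip, neg_neg, neg_neg, sub_unip_X_zero]
  have e : ∀ a : ℂ, sub (isomInv M) (C a) = C a := fun a => (sub (isomInv M)).commutes a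
  simp only [map_add, map_sub, map_mul (sub (isomInv M)), e]

theorem exists_chart (hM : IsIsom M) {Λ : Gr 10 W}
    (hΛ : Λ ∈ apolarThrough (M.mulVec (Pi.single 0 1))) :
    ∃ b c w, IsParam w ∧ Λ = fam (isoBasis (hM.mul (isIsom_unip b c))) w := by
  obtain ⟨I, hI, hap, hev, hcub⟩ := hΛ
  obtain ⟨b, c, hbc⟩ := exists_isotropic_nonZeroDivisor (I := I)
    (fun i => sub (isomInv M) (X i)) fun _ => hM.mem_of_sub_inv_X_mul_mem hI.saturated
  have h1 : ∀ g, sub (isomInv (M * unip (-b) (-c))) (X 0) * g ∈ I → g ∈ I := fun g hg => by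
    rw [sub_inv_mul_unip_X_zero] at hg
    exact hbc g hg
  have h2 : ∀ g ∈ I, eval ((M * unip (-b) (-c)).mulVec (Pi.single 0 1)) g = 0 := fun g hg => by
    rw [← Matrix.mulVec_mulVec, unip_mulVec]
    exact hev g hg
  have h3 : ∀ g ∈ Λ.1, (g : T) ∈ I := fun g hg => by
    have : (g : T) ∈ cubics Λ := ⟨g, hg, rfl⟩
    rw [hcub] at this
    exact this.1
  exact ⟨-b, -c, exists_isParam_of_isoBasis (hM.mul (isIsom_unip (-b) (-c))) h1
    (fun g hg => phi_eq_zero_of_diffOn (hap g hg)) h2 Λ h3⟩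

end Charts

/-! ### The variety `V_p` is the union of three components -/

section Variety

open MvPolynomial

variable {M : Matrix (Fin 4) (Fin 4) ℂ}

/-- With `exists_eq_X_zero_mul`, vanishing leading coordinates characterize the apolar cubics
divisible by y₀. The chart is thus the condition of containing no nonzero such cubic. -/
theorem harmCoord_lead_X_zero_mul {g : T} (hg : X 0 * g ∈ W) (j : Fin 10) :
    harmCoord (X 0 * g) (lead j) = 0 := by
  obtain ⟨-, h, -⟩ := (mem_W_iff_coeff _).1 hg
  simp [(coeff_ex_X_mul _ _ _ _ g).1] at h
  fin_cases j <;> simp [lead, harmCoord, lcoeff_apply, (coeff_ex_X_mul _ _ _ _ g).1, h]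

theorem exists_eq_X_zero_mul {g : T} (hg : g ∈ W) (hl : ∀ j, harmCoord g (lead j) = 0) :
    ∃ f : T, f.IsHomogeneous 2 ∧ g = X 0 * f := by
  refine ⟨harmCoord g (0, 0) • mono 2 0 0 0 + harmCoord g (1, 0) • mono 1 0 1 0 +
    harmCoord g (0, 1) • mono 1 0 0 1 + harmCoord g (2, 0) • mono 0 0 2 0 +
    harmCoord g (0, 2) • mono 0 0 0 2 + harmCoord g (1, 1) • (1 / 3 : ℂ) •
      ((2 : ℂ) • mono 0 0 1 1 - mono 1 1 0 0), ?_, ?_⟩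
  · rw [← mem_homogeneousSubmodule]
    have hm : ∀ a b c d, a + b + c + d = 2 → mono a b c d ∈ homogeneousSubmodule (Fin 4) ℂ 2 :=
      fun a b c d h => h ▸ isHomogeneous_mono a b c d
    repeat' first
      | exact hm _ _ _ _ rfl
      | apply Submodule.smul_mem
      | apply Submodule.sub_mem
      | apply Submodule.add_mem
  · simp only [Fin.forall_fin_succ] at hl
    simp [lead] at hl
    conv_lhs => rw [show g = ∑ p, harmCoord g p • harm p from sum_harm ⟨g, hg⟩]
    rw [Fintype.sum_prod_type]
    simp [Fin.sum_univ_four, hl, harm, mul_add, mul_sub, X_zero_mul_mono]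
    abel

/-- At w = 0 the operators of y₁, y₂, y₃ raise the weight (2 for y₁, 1 for y₂ and y₃), so the moved
form acts unipotently; the coordinates vanish in order of weight. -/
theorem eq_zero_of_map_unip_apply {E : T →ₐ[ℂ] Module.End ℂ (Fin 10 → ℂ)} (hE : IsRep 0 E) {b c : ℂ}
    {v : Fin 10 → ℂ} (h : E (sub (unip b c) (X 0)) v = 0) : v = 0 := by
  rw [sub_unip_X_zero] at h
  have e : ∀ a : ℂ, E (C a) = algebraMap ℂ _ a := fun a => E.commutes a
  simp only [map_add, map_sub, map_mul, e, hE.zero, hE.one, hE.two, hE.three] at h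
  have hc : ∀ i, _ := fun i => congrFun h i
  have c0 := hc 0
  have c1 := hc 1
  have c2 := hc 2
  have c3 := hc 3
  have c4 := hc 4
  have c5 := hc 5
  have c6 := hc 6
  have c7 := hc 7
  have c8 := hc 8
  have c9 := hc 9
  simp [mul1_apply, mul2_apply, mul3_apply] at c0 c1 c2 c3 c4 c5 c6 c7 c8 c9
  replace c0 : v 0 = 0 := c0
  replace c1 : v 1 - b * (c * v 0) = 0 := c1
  replace c2 : v 2 + b * v 0 = 0 := c2
  replace c3 : v 3 + c * v 0 = 0 := c3
  replace c4 : v 4 - b * (c * (v 1 + v 8 / 2)) + b * (v 6 / 2) + c * (v 5 / 2) = 0 := c4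
  replace c5 : v 5 - b * (c * v 2) + b * (v 1 + 2 * v 8) + c * (2 * v 7) = 0 := c5
  replace c6 : v 6 - b * (c * v 3) + b * (2 * v 9) + c * (v 1 + 2 * v 8) = 0 := c6
  replace c7 : v 7 + b * v 2 = 0 := c7
  replace c8 : v 8 + b * v 3 + c * v 2 = 0 := c8
  replace c9 : v 9 + c * v 3 = 0 := c9
  simp only [c0, mul_zero, sub_zero, add_zero] at c1 c2 c3
  simp only [c2, c3, mul_zero, add_zero] at c7 c8 c9
  simp only [c1, c2, c3, c7, c8, c9, mul_zero, sub_zero, add_zero] at c5 c6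
  simp only [c1, c5, c6, c8, zero_div, mul_zero, sub_zero, add_zero] at c4
  ext i
  fin_cases i <;> assumption

/-- A member divisible by the form of the plane has a quadric cofactor. At w = 0 that form acts
injectively, so the cofactor lies in the apolar ideal and is zero. -/
theorem leadCoord_injective_fam_zero (hM : IsIsom M) (b c : ℂ) :
    ∀ x ∈ (fam (isoBasis (hM.mul (isIsom_unip b c))) 0).1, leadCoord (isoBasis hM) x = 0 → x = 0 := by
  intro x hx hl
  have hU := isIsom_unip b c
  obtain ⟨E, h0, h1, h2, h3⟩ := exists_algHom_mul (w := 0) (by constructor <;> simp)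
  have hE : IsRep 0 E := ⟨h0, h1, h2, h3⟩
  obtain ⟨f, hf2, hf⟩ := exists_eq_X_zero_mul (hM.sub_mem_W x.2) fun j => congrFun hl j
  have hm : sub (unip b c) (X 0) * sub (unip b c) f ∈ idealOf E := by
    have : (subW (hM.mul hU) x : T) ∈ cubics (fam harmBasis 0) :=
      ⟨_, (mem_fam_isoBasis_iff _ _ x).1 hx, rfl⟩
    rw [hE.cubics_fam, coe_subW, ← sub_sub, hf, map_mul] at this
    exact this.1
  have hm' := map_eq_zero_of_mem_idealOf hm
  have hfE : E (sub (unip b c) f) unit = 0 := by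
    refine eq_zero_of_map_unip_apply hE (b := b) (c := c) ?_
    rw [← Module.End.mul_apply, ← map_mul, hm', LinearMap.zero_apply]
  have hfU := isHomogeneous_sub (unip b c) hf2
  have hfI : sub (unip b c) f ∈ idealOf E :=
    (mem_idealOf_iff_of_isHomogeneous hfU).2 ((hE.eq_zero_iff _).2 hfE)
  have hf0 : sub (unip b c) f = 0 := eq_zero_of_forall_phi_mul_eq_zero hfU fun r =>
    hE.phi_eq_zero ((idealOf E).mul_mem_right r hfI)
  have hff : f = 0 := by rw [← hU.sub_inv_sub f, hf0, map_zero]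
  apply Subtype.ext
  rw [← hM.sub_inv_sub x, hf, hff, mul_zero, map_zero]
  rfl

/-- If no nonzero cubic of the ideal is divisible by the form of the standard plane, no quadric is
annihilated by it. The form is then a nonzerodivisor, and the standard classification applies. -/
theorem exists_isParam_of_chart (hM : IsIsom M) {b c : ℂ} {w : Fin 8 → ℂ} (hw : IsParam w)
    (hl : ∀ x ∈ (fam (isoBasis (hM.mul (isIsom_unip b c))) w).1,
      leadCoord (isoBasis hM) x = 0 → x = 0) :
    ∃ w', IsParam w' ∧ fam (isoBasis (hM.mul (isIsom_unip b c))) w = fam (isoBasis hM) w' := by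
  have hU := isIsom_unip b c
  have hMU := hM.mul hU
  obtain ⟨E, h0, h1, h2, h3⟩ := exists_algHom_mul hw
  have hE : IsRep w E := ⟨h0, h1, h2, h3⟩
  have hlin : (sub (unip b c) (X 0)).IsHomogeneous 1 := isHomogeneous_sub _ (isHomogeneous_X ℂ 0)
  have hquad : ∀ f : T, f.IsHomogeneous 2 → sub (unip b c) (X 0) * f ∈ idealOf E → f = 0 :=
      fun f hf hfI => by
    have hmem : sub (unip b c) (X 0) * f ∈ degPart (idealOf E) 3 := ⟨hfI, hlin.mul hf⟩
    rw [← hE.cubics_fam] at hmem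
    obtain ⟨y, hy, hyf⟩ := hmem
    change (y : T) = _ at hyf
    have hx : (subW hMU).symm y ∈ (fam (isoBasis hMU) w).1 := by
      rw [mem_fam_isoBasis_iff, LinearEquiv.apply_symm_apply]
      exact hy
    have hsub : sub M ((subW hMU).symm y : W) = X 0 * sub (isomInv (unip b c)) f := by
      have e : (((subW hMU).symm y : W) : T) = sub (isomInv (M * unip b c)) y := rfl
      rw [e, sub_inv_mul, hM.sub_sub_inv, hyf, map_mul, hU.sub_inv_sub]
    have hW : X 0 * sub (isomInv (unip b c)) f ∈ W := by
      rw [← hsub]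
      exact hM.sub_mem_W (Subtype.coe_prop _)
    have hz : (subW hMU).symm y = 0 := hl _ hx (funext fun j => by
      change harmCoord (sub M ((subW hMU).symm y : W)) (lead j) = 0
      rw [hsub]
      exact harmCoord_lead_X_zero_mul hW j)
    rw [hz, Submodule.coe_zero, map_zero] at hsub
    have := (mul_eq_zero.1 hsub.symm).resolve_left (X_ne_zero 0)
    rw [← hU.sub_sub_inv f, this, map_zero]
  have hnz : ∀ g, sub (isomInv M) (X 0) * g ∈ (idealOf E).comap (sub (M * unip b c)) →
      g ∈ (idealOf E).comap (sub (M * unip b c)) := fun g hg => by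
    rw [Ideal.mem_comap, map_mul, ← sub_sub (unip b c) M (sub _ _), hM.sub_sub_inv] at hg
    exact hE.mem_of_mul_mem hlin hquad hg
  have hphi : ∀ g ∈ (idealOf E).comap (sub (M * unip b c)), phi g = 0 := fun g hg =>
    phi_eq_zero_of_mem_comap_sub hMU (fun _ => hE.phi_eq_zero) hg
  have hev : ∀ g ∈ (idealOf E).comap (sub (M * unip b c)),
      eval (M.mulVec (Pi.single 0 1)) g = 0 := fun g hg => by
    have := hE.eval_eq_zero hg
    rwa [eval_sub, ← Matrix.mulVec_mulVec, unip_mulVec] at this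
  refine exists_isParam_of_isoBasis hM hnz hphi hev _ fun g hg => ?_
  have : (subW hMU g : T) ∈ cubics (fam harmBasis w) :=
    ⟨_, (mem_fam_isoBasis_iff _ _ g).1 hg, rfl⟩
  rw [hE.cubics_fam] at this
  exact this.1

/-- The union of the three components. -/
def comps {V : Type*} [AddCommGroup V] [Module ℂ V] (h : Module.Basis (Fin 4 × Fin 4) ℂ V) :
    Set (Gr 10 V) := comp₀ h ∪ comp₁ h ∪ comp₂ h

theorem isClosed_comps {V : Type*} [AddCommGroup V] [Module ℂ V]
    (h : Module.Basis (Fin 4 × Fin 4) ℂ V) : IsClosed (comps h) :=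
  (isClosed_closure.union isClosed_closure).union isClosed_closure

/-- If one member avoided the closed union, then by irreducibility some member would both avoid it
and lie in the open standard chart, which contains the member at parameter 0. The classification in
that chart rules this out. -/
theorem fam_unip_mem_comps (hM : IsIsom M) (b c : ℂ) {P : (Fin 3 → ℂ) → Fin 8 → ℂ}
    (hP : ∀ i, IsPolyFun fun s => P s i) (hP0 : P 0 = 0) (hpar : ∀ s, IsParam (P s)) (s : Fin 3 → ℂ) :
    fam (isoBasis (hM.mul (isIsom_unip b c))) (P s) ∈ comps (isoBasis hM) := by
  have : FiniteDimensional ℂ W := Module.Finite.of_basis harmBasis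
  have hirr := ((isRegularFamily_fam (isoBasis (hM.mul (isIsom_unip b c)))).comp
    hP).isIrreducible_range
  by_contra hs
  obtain ⟨_, ⟨r, rfl⟩, hr1, hr2⟩ := hirr.2 _ _ (isOpen_chart (leadCoord (isoBasis hM)))
    (isClosed_comps (isoBasis hM)).isOpen_compl
    ⟨_, ⟨0, rfl⟩, by
      simp only [hP0]
      exact leadCoord_injective_fam_zero hM b c⟩
    ⟨_, ⟨s, rfl⟩, hs⟩
  obtain ⟨w', hw', e⟩ := exists_isParam_of_chart hM (hpar r) hr1
  refine hr2 ?_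
  simp only [e]
  exact fam_mem_of_isParam _ hw'

theorem comps_unip_subset (hM : IsIsom M) (b c : ℂ) :
    comps (isoBasis (hM.mul (isIsom_unip b c))) ⊆ comps (isoBasis hM) := by
  refine Set.union_subset (Set.union_subset ?_ ?_) ?_ <;>
    refine closure_minimal ?_ (isClosed_comps _) <;> rintro _ ⟨s, rfl⟩
  · exact fam_unip_mem_comps hM b c isPolyFun_par₀ (by ext i; fin_cases i <;> simp [par₀])
      isParam_par₀ s
  · exact fam_unip_mem_comps hM b c isPolyFun_par₁ (by ext i; fin_cases i <;> simp [par₁])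
      isParam_par₁ s
  · exact fam_unip_mem_comps hM b c isPolyFun_par₂ (by ext i; fin_cases i <;> simp [par₂])
      isParam_par₂ s

/-- Schemes in a moved chart are absorbed by `comps_unip_subset`; conversely the parametrized
members come from actual apolar schemes. -/
theorem Vp_eq (hM : IsIsom M) : Vp (M.mulVec (Pi.single 0 1)) = comps (isoBasis hM) := by
  refine (closure_minimal (fun Λ hΛ => ?_) (isClosed_comps _)).antisymm
    (Set.union_subset (Set.union_subset ?_ ?_) ?_)
  · obtain ⟨b, c, w, hw, rfl⟩ := exists_chart hM hΛ
    exact comps_unip_subset hM b c (fam_mem_of_isParam _ hw)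
  all_goals
    refine closure_mono ?_
    rintro _ ⟨s, rfl⟩
  · exact fam_isoBasis_mem_apolarThrough hM (isParam_par₀ s)
  · exact fam_isoBasis_mem_apolarThrough hM (isParam_par₁ s)
  · exact fam_isoBasis_mem_apolarThrough hM (isParam_par₂ s)

end Variety

/-! ### The cubics attached to the point and the line, in coordinates -/

open Polynomial in
-- The factors 1 + uX are units modulo powers of X, so the order of vanishing is decided by the
-- first nonzero scalar.
theorem X_pow_dvd_iff_of_le_three (a b c d : ℂ) (u : ℂ[X]) {m : ℕ} (hm : m ≤ 3) :
    (X : ℂ[X]) ^ m ∣ C a * (1 + u * X) ^ 3 + C b * (1 + u * X) ^ 2 * X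
        + C c * (1 + u * X) * X ^ 2 + C d * X ^ 3 ↔
      (0 < m → a = 0) ∧ (1 < m → b = 0) ∧ (2 < m → c = 0) := by
  constructor
  · intro h
    rw [X_pow_dvd_iff] at h
    have h0 : 0 < m → a = 0 := fun hm => by
      simpa [coeff_zero_eq_eval_zero] using h 0 hm
    have h1 : 1 < m → b = 0 := fun hm => by
      have h := h 1 hm
      rw [h0 (by omega), show C 0 * (1 + u * X) ^ 3 + C b * (1 + u * X) ^ 2 * X +
        C c * (1 + u * X) * X ^ 2 + C d * X ^ 3 = (C b * (1 + u * X) ^ 2 +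
        C c * (1 + u * X) * X + C d * X ^ 2) * X by rw [map_zero]; ring, coeff_mul_X] at h
      simpa [coeff_zero_eq_eval_zero] using h
    refine ⟨h0, h1, fun hm => ?_⟩
    have h := h 2 hm
    rw [h0 (by omega), h1 (by omega), show C 0 * (1 + u * X) ^ 3 + C 0 * (1 + u * X) ^ 2 * X +
      C c * (1 + u * X) * X ^ 2 + C d * X ^ 3 = (C c * (1 + u * X) + C d * X) * X * X by
        rw [map_zero]; ring, coeff_mul_X, coeff_mul_X] at h
    simpa [coeff_zero_eq_eval_zero] using h
  · rintro ⟨h0, h1, h2⟩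
    interval_cases m
    · simp
    · exact ⟨C b * (1 + u * X) ^ 2 + C c * (1 + u * X) * X + C d * X ^ 2, by
        rw [h0 one_pos, map_zero]
        ring⟩
    · exact ⟨C c * (1 + u * X) + C d * X, by
        rw [h0 two_pos, h1 one_lt_two, map_zero]
        ring⟩
    · exact ⟨C d, by
        rw [h0 three_pos, h1 (by norm_num), h2 (by norm_num), map_zero]
        ring⟩

section Multiplicity

open MvPolynomial

variable {M : Matrix (Fin 4) (Fin 4) ℂ} {g : T}

theorem MultGE_mulVec_iff (hM : IsIsom M) {N N' : Submodule ℂ (Fin 4 → ℂ)}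
    (hN : ∀ z, M.mulVec z ∈ N ↔ z ∈ N') (p : Fin 4 → ℂ) (m : ℕ) :
    MultGE g N (M.mulVec p) m ↔ MultGE (sub M g) N' p m := by
  have e : ∀ z : Fin 4 → ℂ,
      aeval (fun i => Polynomial.C (p i) + Polynomial.C (z i) * Polynomial.X) (sub M g) =
      aeval (fun i => Polynomial.C (M.mulVec p i) + Polynomial.C (M.mulVec z i) * Polynomial.X) g :=
    fun z => by
    rw [aeval_sub]
    congr 2
    ext1 i
    simp only [Matrix.mulVec, dotProduct, map_sum, Finset.sum_mul, mul_add, Finset.sum_add_distrib,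
      map_mul, mul_assoc]
    rfl
  constructor
  · intro h z hz
    rw [e]
    exact h _ ((hN z).2 hz)
  · intro h z hz
    have hz' : z = M.mulVec ((isomInv M).mulVec z) := by
      rw [Matrix.mulVec_mulVec, hM.mul_inv, Matrix.one_mulVec]
    rw [hz', ← e]
    exact h _ ((hN _).1 (hz' ▸ hz))

theorem mulVec_mem_tangentPlane_iff (hM : IsIsom M) (z : Fin 4 → ℂ) :
    M.mulVec z ∈ tangentPlane (M.mulVec (Pi.single 0 1)) ↔ z 1 = 0 := by
  have e : ∀ p y : Fin 4 → ℂ, y ∈ tangentPlane p ↔ dotProduct p (gram.mulVec y) = 0 := fun p y => by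
    simp [tangentPlane, qInv, Fin.sum_univ_four, gram, dotProduct, Matrix.mulVec,
      Derivation.leibniz, pderiv_X]
    ring_nf
  rw [e, Matrix.dotProduct_mulVec, Matrix.dotProduct_mulVec, ← Matrix.mulVec_transpose,
    ← Matrix.mulVec_transpose, Matrix.mulVec_mulVec, Matrix.mulVec_mulVec]
  have hg : M.transpose * (gram.transpose * M) = gram := by
    have ht : gram.transpose = gram := by
      ext i j
      fin_cases i <;> fin_cases j <;> simp [gram]
    rw [ht, ← Matrix.mul_assoc, hM]
  rw [← Matrix.mul_assoc] at hg
  rw [hg]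
  simp [gram, dotProduct, Fin.sum_univ_four, Matrix.mulVec]

theorem aeval_of_mem_W {R : Type*} [CommRing R] [Algebra ℂ R] {f : T} (hf : f ∈ W) (z : Fin 4 → R) :
    aeval z f = algebraMap ℂ R (harmCoord f (0, 0)) * z 0 ^ 3
      + algebraMap ℂ R (harmCoord f (0, 1)) * z 0 ^ 2 * z 3
      + algebraMap ℂ R (harmCoord f (0, 2)) * z 0 * z 3 ^ 2
      + algebraMap ℂ R (harmCoord f (0, 3)) * z 3 ^ 3
      + algebraMap ℂ R (harmCoord f (1, 0)) * z 0 ^ 2 * z 2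
      + algebraMap ℂ R (harmCoord f (1, 1) / 3) * (2 * z 0 * z 2 * z 3 - z 0 ^ 2 * z 1)
      + algebraMap ℂ R (harmCoord f (1, 2) / 3) * (z 2 * z 3 ^ 2 - 2 * z 0 * z 1 * z 3)
      - algebraMap ℂ R (harmCoord f (1, 3)) * z 1 * z 3 ^ 2
      + algebraMap ℂ R (harmCoord f (2, 0)) * z 0 * z 2 ^ 2
      + algebraMap ℂ R (harmCoord f (2, 1) / 3) * (z 2 ^ 2 * z 3 - 2 * z 0 * z 1 * z 2)
      + algebraMap ℂ R (harmCoord f (2, 2) / 3) * (z 0 * z 1 ^ 2 - 2 * z 1 * z 2 * z 3)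
      + algebraMap ℂ R (harmCoord f (2, 3)) * z 1 ^ 2 * z 3
      + algebraMap ℂ R (harmCoord f (3, 0)) * z 2 ^ 3
      - algebraMap ℂ R (harmCoord f (3, 1)) * z 1 * z 2 ^ 2
      + algebraMap ℂ R (harmCoord f (3, 2)) * z 1 ^ 2 * z 2
      - algebraMap ℂ R (harmCoord f (3, 3)) * z 1 ^ 3 := by
  have h2 : algebraMap ℂ R 2 = 2 := map_ofNat _ 2
  conv_lhs => rw [show f = ∑ p, harmCoord f p • harm p from sum_harm ⟨f, hf⟩]
  rw [Fintype.sum_prod_type]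
  simp only [Fin.sum_univ_four, harm, Matrix.cons_val, map_add, map_sub, map_neg,
    mono_eq, map_mul, map_pow, aeval_X, Algebra.smul_def, AlgHom.commutes, div_eq_mul_inv, h2, map_one]
  ring

theorem eval_of_mem_W {f : T} (hf : f ∈ W) (z : Fin 4 → ℂ) :
    eval z f = harmCoord f (0, 0) * z 0 ^ 3 + harmCoord f (0, 1) * z 0 ^ 2 * z 3
      + harmCoord f (0, 2) * z 0 * z 3 ^ 2 + harmCoord f (0, 3) * z 3 ^ 3
      + harmCoord f (1, 0) * z 0 ^ 2 * z 2
      + harmCoord f (1, 1) / 3 * (2 * z 0 * z 2 * z 3 - z 0 ^ 2 * z 1)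
      + harmCoord f (1, 2) / 3 * (z 2 * z 3 ^ 2 - 2 * z 0 * z 1 * z 3)
      - harmCoord f (1, 3) * z 1 * z 3 ^ 2 + harmCoord f (2, 0) * z 0 * z 2 ^ 2
      + harmCoord f (2, 1) / 3 * (z 2 ^ 2 * z 3 - 2 * z 0 * z 1 * z 2)
      + harmCoord f (2, 2) / 3 * (z 0 * z 1 ^ 2 - 2 * z 1 * z 2 * z 3)
      + harmCoord f (2, 3) * z 1 ^ 2 * z 3 + harmCoord f (3, 0) * z 2 ^ 3
      - harmCoord f (3, 1) * z 1 * z 2 ^ 2 + harmCoord f (3, 2) * z 1 ^ 2 * z 2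
      - harmCoord f (3, 3) * z 1 ^ 3 := aeval_of_mem_W hf z

/-- The values on the line through `e₀` in the direction `z`. -/
theorem aeval_line {f : T} (hf : f ∈ W) (z : Fin 4 → ℂ) :
    aeval (fun i => Polynomial.C ((Pi.single 0 1 : Fin 4 → ℂ) i) + Polynomial.C (z i) * Polynomial.X)
      f = Polynomial.C (harmCoord f (0, 0)) * (1 + Polynomial.C (z 0) * Polynomial.X) ^ 3
        + Polynomial.C (harmCoord f (0, 1) * z 3 + harmCoord f (1, 0) * z 2
            - harmCoord f (1, 1) / 3 * z 1) *
          (1 + Polynomial.C (z 0) * Polynomial.X) ^ 2 * Polynomial.X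
        + Polynomial.C (harmCoord f (0, 2) * z 3 ^ 2 + harmCoord f (2, 0) * z 2 ^ 2
            + harmCoord f (1, 1) / 3 * (2 * z 2 * z 3) - harmCoord f (1, 2) / 3 * (2 * z 1 * z 3)
            - harmCoord f (2, 1) / 3 * (2 * z 1 * z 2) + harmCoord f (2, 2) / 3 * z 1 ^ 2) *
          (1 + Polynomial.C (z 0) * Polynomial.X) * Polynomial.X ^ 2
        + Polynomial.C (eval ![0, z 1, z 2, z 3] f) * Polynomial.X ^ 3 := by
  have e : (fun i => Polynomial.C ((Pi.single 0 1 : Fin 4 → ℂ) i) + Polynomial.C (z i) *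
      Polynomial.X) = ![1 + Polynomial.C (z 0) * Polynomial.X, Polynomial.C (z 1) * Polynomial.X,
        Polynomial.C (z 2) * Polynomial.X, Polynomial.C (z 3) * Polynomial.X] := by
    ext1 i
    fin_cases i <;> simp
  have h2 : (Polynomial.C 2 : Polynomial ℂ) = 2 := rfl
  rw [e, aeval_of_mem_W hf, eval_of_mem_W hf]
  simp only [Matrix.cons_val, Polynomial.algebraMap_eq, map_add, map_sub, map_mul, map_pow, h2,
    map_zero]
  ring

theorem multGE_iff {f : T} (hf : f ∈ W) (N : Submodule ℂ (Fin 4 → ℂ)) {m : ℕ} (hm : m ≤ 3) :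
    MultGE f N (Pi.single 0 1) m ↔ ∀ z ∈ N,
      (0 < m → harmCoord f (0, 0) = 0) ∧
      (1 < m → harmCoord f (0, 1) * z 3 + harmCoord f (1, 0) * z 2
        - harmCoord f (1, 1) / 3 * z 1 = 0) ∧
      (2 < m → harmCoord f (0, 2) * z 3 ^ 2 + harmCoord f (2, 0) * z 2 ^ 2
        + harmCoord f (1, 1) / 3 * (2 * z 2 * z 3) - harmCoord f (1, 2) / 3 * (2 * z 1 * z 3)
        - harmCoord f (2, 1) / 3 * (2 * z 1 * z 2) + harmCoord f (2, 2) / 3 * z 1 ^ 2 = 0) := by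
  unfold MultGE
  simp only [aeval_line hf, X_pow_dvd_iff_of_le_three _ _ _ _ _ hm]

/-- The plane `z₁ = 0`. -/
def coordPlane : Submodule ℂ (Fin 4 → ℂ) := LinearMap.ker (LinearMap.proj 1)

/-- The line `z₁ = z₃ = 0`. -/
def coordLine : Submodule ℂ (Fin 4 → ℂ) :=
  LinearMap.ker (LinearMap.proj 1) ⊓ LinearMap.ker (LinearMap.proj 3)

theorem mem_coordPlane {z : Fin 4 → ℂ} : z ∈ coordPlane ↔ z 1 = 0 := Iff.rfl

theorem mem_coordLine {z : Fin 4 → ℂ} : z ∈ coordLine ↔ z 1 = 0 ∧ z 3 = 0 := Iff.rfl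

theorem multGE_coordPlane_two_iff {f : T} (hf : f ∈ W) : MultGE f coordPlane (Pi.single 0 1) 2 ↔
    harmCoord f (0, 0) = 0 ∧ harmCoord f (1, 0) = 0 ∧ harmCoord f (0, 1) = 0 := by
  rw [multGE_iff hf _ (by norm_num)]
  constructor
  · intro h
    obtain ⟨a, b, -⟩ := h (Pi.single 2 1) (by simp [mem_coordPlane])
    obtain ⟨-, c, -⟩ := h (Pi.single 3 1) (by simp [mem_coordPlane])
    exact ⟨a two_pos, by simpa using b one_lt_two, by simpa using c one_lt_two⟩
  · rintro ⟨a, b, c⟩ z hz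
    simp [a, b, c, mem_coordPlane.1 hz]

theorem multGE_coordPlane_three {f : T} (hf : f ∈ W) (h : MultGE f coordPlane (Pi.single 0 1) 3) :
    harmCoord f (0, 0) = 0 ∧ harmCoord f (1, 0) = 0 ∧ harmCoord f (0, 1) = 0 ∧
      harmCoord f (2, 0) = 0 ∧ harmCoord f (0, 2) = 0 ∧ harmCoord f (1, 1) = 0 := by
  rw [multGE_iff hf _ le_rfl] at h
  obtain ⟨a, b, d⟩ := h (Pi.single 2 1) (by simp [mem_coordPlane])
  obtain ⟨-, c, e⟩ := h (Pi.single 3 1) (by simp [mem_coordPlane])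
  obtain ⟨-, -, g⟩ := h (Pi.single 2 1 + Pi.single 3 1) (by simp [mem_coordPlane])
  simp at a b c d e g
  simp [d, e] at g
  exact ⟨a, b, c, d, e, g⟩

theorem multGE_coordLine_three_iff {f : T} (hf : f ∈ W) : MultGE f coordLine (Pi.single 0 1) 3 ↔
    harmCoord f (0, 0) = 0 ∧ harmCoord f (1, 0) = 0 ∧ harmCoord f (2, 0) = 0 := by
  rw [multGE_iff hf _ le_rfl]
  constructor
  · intro h
    obtain ⟨a, b, c⟩ := h (Pi.single 2 1) (by simp [mem_coordLine])
    simp at a b c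
    exact ⟨a, b, c⟩
  · rintro ⟨a, b, c⟩ z hz
    simp [a, b, c, mem_coordLine.1 hz]

theorem multGE_top_two_iff {f : T} (hf : f ∈ W) : MultGE f ⊤ (Pi.single 0 1) 2 ↔
    harmCoord f (0, 0) = 0 ∧ harmCoord f (1, 0) = 0 ∧ harmCoord f (0, 1) = 0 ∧
      harmCoord f (1, 1) = 0 := by
  rw [multGE_iff hf _ (by norm_num)]
  constructor
  · intro h
    obtain ⟨a, b, -⟩ := h (Pi.single 2 1) trivial
    obtain ⟨-, c, -⟩ := h (Pi.single 3 1) trivial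
    obtain ⟨-, d, -⟩ := h (Pi.single 1 1) trivial
    simp at a b c d
    exact ⟨a, b, c, d⟩
  · rintro ⟨a, b, c, d⟩ z -
    simp [a, b, c, d]

theorem harmCoord_eq_zero_of_multGE_single_two {f : T} (hf : f ∈ W)
    (h : MultGE f ⊤ (Pi.single 2 1) 2) :
    harmCoord f (3, 0) = 0 ∧ harmCoord f (2, 1) = 0 ∧ harmCoord f (3, 1) = 0 := by
  have h3 := h (Pi.single 3 1) trivial
  have h1 := h (Pi.single 1 1) trivial
  rw [aeval_of_mem_W hf, Polynomial.X_pow_dvd_iff] at h1 h3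
  have a := h3 0 (by norm_num)
  have b := h3 1 (by norm_num)
  have c := h1 1 (by norm_num)
  simp [Polynomial.coeff_X, Polynomial.coeff_X_pow] at a b c
  exact ⟨a, b, c⟩

/-- The basis cubics outside the list restrict to nonzero multiples of the ten ternary cubic
monomials, and the ten chosen points suffice to separate these. -/
theorem harmCoord_eq_zero_of_eval_coordPlane {f : T} (hf : f ∈ W)
    (h : ∀ z ∈ coordPlane, eval z f = 0) {i : Fin 4 × Fin 4}
    (hi : i ∉ ({(3, 1), (1, 3), (2, 2), (3, 2), (2, 3), (3, 3)} : Set (Fin 4 × Fin 4))) :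
    harmCoord f i = 0 := by
  have e : ∀ a b c : ℂ, eval ![a, 0, b, c] f = 0 := fun a b c => h _ rfl
  simp only [eval_of_mem_W hf, Matrix.cons_val] at e
  have e1 := e 1 0 0
  have e2 := e 0 1 0
  have e3 := e 0 0 1
  have e4 := e 1 1 0
  have e5 := e 1 (-1) 0
  have e6 := e 1 0 1
  have e7 := e 1 0 (-1)
  have e8 := e 0 1 1
  have e9 := e 0 1 (-1)
  have e10 := e 1 1 1
  norm_num at e1 e2 e3 e4 e5 e6 e7 e8 e9 e10
  obtain ⟨i, j⟩ := i
  have h10 : harmCoord f (1, 0) = 0 := by linear_combination (e4 - e5) / 2 - e2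
  have h20 : harmCoord f (2, 0) = 0 := by linear_combination (e4 + e5) / 2 - e1
  have h01 : harmCoord f (0, 1) = 0 := by linear_combination (e6 - e7) / 2 - e3
  have h02 : harmCoord f (0, 2) = 0 := by linear_combination (e6 + e7) / 2 - e1
  have h12 : harmCoord f (1, 2) = 0 := by linear_combination 3 * ((e8 + e9) / 2 - e2)
  have h21 : harmCoord f (2, 1) = 0 := by linear_combination 3 * ((e8 - e9) / 2 - e3)
  have h11 : harmCoord f (1, 1) = 0 := by
    simp [e1, e2, e3, h10, h20, h01, h02, h12, h21] at e10
    exact e10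
  fin_cases i <;> fin_cases j <;> simp at hi <;> assumption

theorem eval_coordLine_iff {f : T} (hf : f ∈ W) : (∀ z ∈ coordLine, eval z f = 0) ↔
    harmCoord f (0, 0) = 0 ∧ harmCoord f (1, 0) = 0 ∧ harmCoord f (2, 0) = 0 ∧
      harmCoord f (3, 0) = 0 := by
  constructor
  · intro h
    have e : ∀ a b : ℂ, eval ![a, 0, b, 0] f = 0 := fun a b => h _ ⟨rfl, rfl⟩
    simp only [eval_of_mem_W hf, Matrix.cons_val] at e
    have e1 := e 1 0
    have e2 := e 0 1
    have e3 := e 1 1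
    have e4 := e 1 (-1)
    norm_num at e1 e2 e3 e4
    refine ⟨e1, ?_, ?_, e2⟩
    · linear_combination (e3 - e4) / 2 - e2
    · linear_combination (e3 + e4) / 2 - e1
  · rintro ⟨a, b, c, d⟩ z hz
    rw [eval_of_mem_W hf]
    simp [a, b, c, d, mem_coordLine.1 hz]

end Multiplicity

/-! ### Isometries adapted to a flag -/

section Flag

open Matrix

/-- The polar bilinear form of the inverse quadric. -/
def polar (u v : Fin 4 → ℂ) : ℂ := u ⬝ᵥ gram *ᵥ v

theorem polar_apply (u v : Fin 4 → ℂ) :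
    polar u v = u 0 * v 1 + u 1 * v 0 + u 2 * v 3 + u 3 * v 2 := by
  simp [polar, gram, dotProduct, mulVec, Fin.sum_univ_four]

theorem polar_comm (u v : Fin 4 → ℂ) : polar u v = polar v u := by
  rw [polar_apply, polar_apply]
  ring

theorem polar_sub_smul (u v w : Fin 4 → ℂ) (c : ℂ) :
    polar u (v - c • w) = polar u v - c * polar u w := by
  simp only [polar_apply, Pi.sub_apply, Pi.smul_apply, smul_eq_mul]
  ring

theorem polar_combination (u v₀ v₁ v₂ v₃ : Fin 4 → ℂ) (c : Fin 4 → ℂ) :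
    polar u (c 0 • v₀ + c 1 • v₁ + c 2 • v₂ + c 3 • v₃) =
      c 0 * polar u v₀ + c 1 * polar u v₁ + c 2 * polar u v₂ + c 3 * polar u v₃ := by
  simp only [polar_apply, Pi.add_apply, Pi.smul_apply, smul_eq_mul]
  ring

/-- The Gram matrix is its own inverse, so it represents any linear functional by the polar form, in
particular a dual coordinate of the pair. -/
theorem exists_polar_eq {u v : Fin 4 → ℂ} (h : LinearIndependent ℂ ![u, v]) :
    ∃ w, polar u w = 1 ∧ polar v w = 0 := by
  obtain ⟨φ, hφ⟩ := exists_dual_coordinates h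
  have e : ∀ z, polar z (gram *ᵥ fun i => φ (Pi.single i 1) 0) = φ z 0 := fun z => by
    conv_rhs => rw [pi_eq_sum_univ' z, map_sum]
    rw [polar, mulVec_mulVec, gram_mul_gram, one_mulVec]
    simp [dotProduct]
  refine ⟨_, (e u).trans ?_, (e v).trans ?_⟩
  · simpa using congrFun (hφ 0) 0
  · simpa using congrFun (hφ 1) 0

/-- Witt's argument: a basis p, v of the isotropic plane is completed to a hyperbolic basis, whose
vectors are the columns of the isometry. As the plane is its own orthogonal complement, it
corresponds to z₁ = z₃ = 0. -/
theorem exists_isIsom {p : Fin 4 → ℂ} (hp : p ≠ 0) {L : Submodule ℂ (Fin 4 → ℂ)}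
    (hL : Module.finrank ℂ L = 2) (hLQ : ∀ z ∈ L, MvPolynomial.eval z qInv = 0) (hpL : p ∈ L) :
    ∃ M, IsIsom M ∧ M *ᵥ Pi.single 0 1 = p ∧ ∀ z, M *ᵥ z ∈ L ↔ z ∈ coordLine := by
  have hpol : ∀ u ∈ L, ∀ v ∈ L, polar u v = 0 := fun u hu v hv => by
    have h1 := hLQ _ (L.add_mem hu hv)
    have h2 := hLQ _ hu
    have h3 := hLQ _ hv
    simp [qInv] at h1 h2 h3
    rw [polar_apply]
    linear_combination h1 - h2 - h3
  obtain ⟨⟨v, hv⟩, hli⟩ := exists_linearIndependent_pair_of_one_lt_finrank (R := ℂ) (M := L)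
    (by omega) (x := ⟨p, hpL⟩) (fun h => hp (congrArg Subtype.val h))
  have hli' : LinearIndependent ℂ ![p, v] := by
    have := hli.map' L.subtype L.ker_subtype
    rwa [show L.subtype ∘ ![⟨p, hpL⟩, ⟨v, hv⟩] = ![p, v] by ext i : 1; fin_cases i <;> rfl] at this
  have hpp := hpol p hpL p hpL
  have hpv := hpol p hpL v hv
  have hvv := hpol v hv v hv
  obtain ⟨w₁, h₁, h₁'⟩ := exists_polar_eq hli'
  obtain ⟨w₃, h₃, h₃'⟩ := exists_polar_eq (LinearIndependent.pair_symm_iff.1 hli')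
  obtain ⟨v₁, e₁, e₁', e₁₁⟩ : ∃ v₁, polar p v₁ = 1 ∧ polar v v₁ = 0 ∧ polar v₁ v₁ = 0 := by
    -- Since the pairing with `p` is 1, subtracting half the norm makes the vector isotropic.
    refine ⟨w₁ - (polar w₁ w₁ / 2) • p, ?_, ?_, ?_⟩
    · rw [polar_sub_smul, hpp, h₁, mul_zero, sub_zero]
    · rw [polar_sub_smul, polar_comm v p, hpv, h₁', mul_zero, sub_zero]
    · rw [polar_sub_smul, polar_comm _ w₁, polar_sub_smul, polar_comm (_ - _) p, polar_sub_smul,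
        polar_comm w₁ p, h₁, hpp]
      ring
  obtain ⟨v₃, e₃, e₃', e₁₃, e₃₃⟩ : ∃ v₃, polar p v₃ = 0 ∧ polar v v₃ = 1 ∧ polar v₁ v₃ = 0 ∧
      polar v₃ v₃ = 0 := by
    -- Orthogonality to `v₁` is arranged first; the later correction along `v`, which is orthogonal
    -- to `v₁`, preserves it.
    obtain ⟨u, hu⟩ : ∃ u, u = w₃ - polar v₁ w₃ • p := ⟨_, rfl⟩
    have a : polar p u = 0 := by rw [hu, polar_sub_smul, h₃', hpp, mul_zero, sub_zero]
    have b : polar v u = 1 := by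
      rw [hu, polar_sub_smul, h₃, polar_comm v p, hpv, mul_zero, sub_zero]
    have c : polar v₁ u = 0 := by
      rw [hu, polar_sub_smul, polar_comm v₁ p, e₁, mul_one, sub_self]
    refine ⟨u - (polar u u / 2) • v, ?_, ?_, ?_, ?_⟩
    · rw [polar_sub_smul, a, hpv, mul_zero, sub_zero]
    · rw [polar_sub_smul, b, hvv, mul_zero, sub_zero]
    · rw [polar_sub_smul, c, polar_comm v₁ v, e₁', mul_zero, sub_zero]
    · rw [polar_sub_smul, polar_comm _ u, polar_sub_smul, polar_comm (_ - _) v, polar_sub_smul,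
        polar_comm u v, b, hvv]
      ring
  let c : Fin 4 → Fin 4 → ℂ := ![p, v₁, v, v₃]
  have hM : IsIsom (of c).transpose := by
    have e : ∀ i j, ((of c).transpose.transpose * gram * (of c).transpose) i j =
        polar (c i) (c j) := fun i j => by
      rw [Matrix.mul_assoc, transpose_transpose]
      rfl
    ext i j
    rw [e]
    fin_cases i <;> fin_cases j <;>
      simp [c, gram, hpp, hpv, hvv, e₁, e₁', e₁₁, e₃, e₃', e₁₃, e₃₃, polar_comm v₁, polar_comm v₃,
        polar_comm v p]
  have hz : ∀ z, (of c).transpose *ᵥ z = z 0 • p + z 1 • v₁ + z 2 • v + z 3 • v₃ := fun z => by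
    ext i
    simp [mulVec, dotProduct, Fin.sum_univ_four, c, mul_comm]
  refine ⟨(of c).transpose, hM, by simp [hz], fun z => ?_⟩
  rw [mem_coordLine]
  constructor
  · intro h
    have hp := hpol p hpL _ h
    have hv := hpol v hv _ h
    rw [hz, polar_combination] at hp hv
    simp only [hpp, e₁, hpv, e₃, polar_comm v p, e₁', hvv, e₃', mul_zero, mul_one, zero_add,
      add_zero] at hp hv
    exact ⟨hp, hv⟩
  · rintro ⟨h1, h3⟩
    rw [hz, h1, h3, zero_smul, zero_smul, add_zero, add_zero]
    exact L.add_mem (L.smul_mem _ hpL) (L.smul_mem _ hv)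

end Flag

/-! ### The components and the vertex -/

section Components

open MvPolynomial

variable {M : Matrix (Fin 4) (Fin 4) ℂ} {Λ : Gr 10 W} {L : Submodule ℂ (Fin 4 → ℂ)}

theorem mem_of_repr_eq_zero {V ι : Type*} [Fintype ι] [AddCommGroup V] [Module ℂ V]
    (h : Module.Basis ι ℂ V) {S : Set ι} {N : Submodule ℂ V} (hS : ∀ i ∈ S, h i ∈ N) {x : V}
    (hx : ∀ i ∉ S, h.repr x i = 0) : x ∈ N := by
  rw [← h.sum_repr x]
  refine N.sum_mem fun i _ => ?_
  by_cases hi : i ∈ S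
  · exact N.smul_mem _ (hS i hi)
  · rw [hx i hi, zero_smul]
    exact N.zero_mem

theorem B_subset (hM : IsIsom M) (hΛ : Λ ∈ comp₀ (isoBasis hM)) :
    B (M.mulVec (Pi.single 0 1)) ⊆ cubics Λ := fun g ⟨hg, h⟩ => by
  refine ⟨⟨g, hg⟩, mem_of_repr_eq_zero (isoBasis hM) (fun _ => mem_of_mem_comp₀ hΛ)
    fun i hi => ?_, rfl⟩
  refine harmCoord_eq_zero_of_eval_coordPlane (hM.sub_mem_W hg) (fun z hz => ?_) hi
  rw [eval_sub]
  exact h _ ((mulVec_mem_tangentPlane_iff hM z).2 hz)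

theorem mem_A_iff (hM : IsIsom M) {g : T} (hg : g ∈ W) : g ∈ A (M.mulVec (Pi.single 0 1)) ↔
    harmCoord (sub M g) (0, 0) = 0 ∧ harmCoord (sub M g) (1, 0) = 0 ∧
      harmCoord (sub M g) (0, 1) = 0 := by
  rw [← multGE_coordPlane_two_iff (hM.sub_mem_W hg),
    ← MultGE_mulVec_iff hM (N' := coordPlane) (mulVec_mem_tangentPlane_iff hM)]
  exact and_iff_right hg

theorem mem_UL_iff (hM : IsIsom M) (hL : ∀ z, M.mulVec z ∈ L ↔ z ∈ coordLine) {g : T}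
    (hg : g ∈ W) : g ∈ UL L (M.mulVec (Pi.single 0 1)) ↔
    harmCoord (sub M g) (0, 0) = 0 ∧ harmCoord (sub M g) (1, 0) = 0 ∧
      harmCoord (sub M g) (2, 0) = 0 := by
  rw [← multGE_coordLine_three_iff (hM.sub_mem_W hg), ← MultGE_mulVec_iff hM hL]
  exact and_iff_right hg

/-- Nine coordinates must vanish: six by multiplicity three in the tangent plane at p, and (3,0),
(2,1), (3,1) by singularity at the second base point e₂ of the line. -/
theorem WL_subset (hM : IsIsom M) (hL : ∀ z, M.mulVec z ∈ L ↔ z ∈ coordLine)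
    (hΛ : Λ ∈ comp₁ (isoBasis hM)) : WL L (M.mulVec (Pi.single 0 1)) ⊆ cubics Λ :=
  fun g ⟨hg, h, h'⟩ => by
  refine ⟨⟨g, hg⟩, mem_of_repr_eq_zero (isoBasis hM) (fun _ => mem_of_mem_comp₁ hΛ)
    fun i hi => ?_, rfl⟩
  have hW := hM.sub_mem_W hg
  rw [MultGE_mulVec_iff hM (N' := coordPlane) (mulVec_mem_tangentPlane_iff hM)] at h'
  obtain ⟨h00, h10, h01, h20, h02, h11⟩ := multGE_coordPlane_three hW h'
  have h2 := h _ ((hL (Pi.single 2 1)).2 (by simp [mem_coordLine]))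
  rw [MultGE_mulVec_iff hM (N' := ⊤) (fun _ => Iff.rfl)] at h2
  obtain ⟨h30, h21, h31⟩ := harmCoord_eq_zero_of_multGE_single_two hW h2
  rw [isoBasis_repr]
  obtain ⟨i, j⟩ := i
  fin_cases i <;> fin_cases j <;> simp at hi <;> assumption

theorem subset_A (hM : IsIsom M) (hΛ : Λ ∈ comp₀ (isoBasis hM)) :
    (cubics Λ : Set T) ⊆ A (M.mulVec (Pi.single 0 1)) := by
  rintro _ ⟨x, hx, rfl⟩
  have e := fun i hi => repr_eq_zero_of_mem_comp₀ hΛ (i := i) hi x hx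
  exact (mem_A_iff hM x.2).2 ⟨e (0, 0) (by simp), e (1, 0) (by simp), e (0, 1) (by simp)⟩

theorem subset_UL (hM : IsIsom M) (hL : ∀ z, M.mulVec z ∈ L ↔ z ∈ coordLine)
    (hΛ : Λ ∈ comp₁ (isoBasis hM)) : (cubics Λ : Set T) ⊆ UL L (M.mulVec (Pi.single 0 1)) := by
  rintro _ ⟨x, hx, rfl⟩
  have e := fun i hi => repr_eq_zero_of_mem_comp₁ hΛ (i := i) hi x hx
  exact (mem_UL_iff hM hL x.2).2 ⟨e (0, 0) (by simp), e (1, 0) (by simp), e (2, 0) (by simp)⟩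

/-- The other two components are excluded because they have members containing cubics whose
restriction to the tangent plane is not singular at p; a nonzero (0,1) or (1,0) coordinate detects
this. -/
theorem isV0_iff (hM : IsIsom M) (Z : Set (Gr 10 W)) :
    IsV0 (M.mulVec (Pi.single 0 1)) Z ↔ Z = comp₀ (isoBasis hM) := by
  rw [IsV0, Vp_eq hM, comps, isComponentOf_iff]
  constructor
  · rintro ⟨rfl | rfl | rfl, h⟩
    · rfl
    · obtain ⟨Λ, hΛ, x, hx, h0⟩ := exists_mem_comp₁ (isoBasis hM)
      exact absurd ((mem_A_iff hM x.2).1 ((h Λ hΛ).2 ⟨x, hx, rfl⟩)).2.2 h0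
    · obtain ⟨Λ, hΛ, ⟨x, hx, h0⟩, -⟩ := exists_mem_comp₂ (isoBasis hM)
      exact absurd ((mem_A_iff hM x.2).1 ((h Λ hΛ).2 ⟨x, hx, rfl⟩)).2.1 h0
  · rintro rfl
    exact ⟨.inl rfl, fun Λ hΛ => ⟨B_subset hM hΛ, subset_A hM hΛ⟩⟩

theorem isV1_iff (hM : IsIsom M) (hL : ∀ z, M.mulVec z ∈ L ↔ z ∈ coordLine) (Z : Set (Gr 10 W)) :
    IsV1 L (M.mulVec (Pi.single 0 1)) Z ↔ Z = comp₁ (isoBasis hM) := by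
  rw [IsV1, Vp_eq hM, comps, isComponentOf_iff]
  constructor
  · rintro ⟨rfl | rfl | rfl, h⟩
    · obtain ⟨Λ, hΛ, ⟨x, hx, h0⟩, -⟩ := exists_mem_comp₀ (isoBasis hM)
      exact absurd ((mem_UL_iff hM hL x.2).1 ((h Λ hΛ).2 ⟨x, hx, rfl⟩)).2.2 h0
    · rfl
    · obtain ⟨Λ, hΛ, -, ⟨x, hx, h0⟩⟩ := exists_mem_comp₂ (isoBasis hM)
      exact absurd ((mem_UL_iff hM hL x.2).1 ((h Λ hΛ).2 ⟨x, hx, rfl⟩)).2.2 h0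
  · rintro rfl
    exact ⟨.inr (.inl rfl), fun Λ hΛ => ⟨WL_subset hM hL hΛ, subset_UL hM hL hΛ⟩⟩

/-- The cubics of an ideal generated by a space of cubics. -/
theorem degPart_span {N : Submodule ℂ T} (hN : N ≤ homogeneousSubmodule (Fin 4) ℂ 3) :
    degPart (Ideal.span (N : Set T)) 3 = N := by
  refine le_antisymm ?_ fun g hg => ⟨Ideal.subset_span hg, hN hg⟩
  rintro g ⟨hg, hg3⟩
  have key : ∀ a, homogeneousComponent 3 (a * g) ∈ N := by
    refine Submodule.span_induction ?_ ?_ ?_ ?_ hg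
    · intro x hx a
      have := homogeneousComponent_mul (hN hx) a 0
      rw [mul_comm, show (3 : ℕ) = 0 + 3 from rfl, this, homogeneousComponent_zero, mul_comm,
        C_mul']
      exact N.smul_mem _ hx
    · simp
    · intro x y _ _ hx hy a
      rw [mul_add, map_add]
      exact N.add_mem (hx a) (hy a)
    · intro b x _ hx a
      rw [smul_eq_mul, ← mul_assoc]
      exact hx _
  have := key 1
  rwa [one_mul, homogeneousComponent_of_mem hg3, if_pos rfl] at this

theorem linearIndependent_vertex {V : Type*} [AddCommGroup V] [Module ℂ V]
    (h : Module.Basis (Fin 4 × Fin 4) ℂ V) :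
    LinearIndependent ℂ (pairVec h (h (2, 1)) (h (0, 2))) := by
  refine linearIndependent_pairVec (i := (2, 1)) (j := (0, 2)) ?_ ?_ ?_
  · rw [isFree_iff]
    simp
  · rw [isFree_iff]
    simp
  · simp

theorem mem_vertex_iff {V : Type*} [AddCommGroup V] [Module ℂ V]
    (h : Module.Basis (Fin 4 × Fin 4) ℂ V) (x : V) :
    x ∈ (grSpan _ (linearIndependent_vertex h)).1 ↔
      h.repr x (0, 0) = 0 ∧ h.repr x (1, 0) = 0 ∧ h.repr x (2, 0) = 0 ∧ h.repr x (3, 0) = 0 ∧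
        h.repr x (0, 1) = 0 ∧ h.repr x (1, 1) = 0 := by
  constructor
  · intro hx
    have e : ∀ i, (∀ r, h.repr (pairVec h (h (2, 1)) (h (0, 2)) r) i = 0) → h.repr x i = 0 :=
      fun i hi => by
      have : (grSpan _ (linearIndependent_vertex h)).1 ≤ LinearMap.ker (h.coord i) :=
        Submodule.span_le.2 (Set.range_subset_iff.2 hi)
      exact this hx
    refine ⟨e _ ?_, e _ ?_, e _ ?_, e _ ?_, e _ ?_, e _ ?_⟩ <;> intro r <;> fin_cases r <;>
      simp [pairVec]
  · rintro ⟨h00, h10, h20, h30, h01, h11⟩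
    refine mem_of_repr_eq_zero h (S := {(2, 1), (0, 2), (1, 2), (0, 3), (3, 1), (1, 3), (2, 2),
      (3, 2), (2, 3), (3, 3)}) (fun i hi => ?_) fun i hi => ?_
    · have hm : ∀ r, pairVec h (h (2, 1)) (h (0, 2)) r ∈ (grSpan _ (linearIndependent_vertex h)).1 :=
        fun r => Submodule.subset_span ⟨r, rfl⟩
      simp only [Set.mem_insert_iff, Set.mem_singleton_iff] at hi
      obtain rfl | rfl | rfl | rfl | rfl | rfl | rfl | rfl | rfl | rfl := hi
      exacts [hm 0, hm 1, hm 2, hm 3, hm 4, hm 5, hm 6, hm 7, hm 8, hm 9]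
    · obtain ⟨i, j⟩ := i
      fin_cases i <;> fin_cases j <;> simp at hi <;> assumption

/-- The generators already form a linear space of cubics, so `degPart_span` reduces the claim to six
vanishing coordinates: four for containing the line and, beyond these, two for singularity at p. -/
theorem cubics_vertex (hM : IsIsom M) (hL : ∀ z, M.mulVec z ∈ L ↔ z ∈ coordLine) :
    cubics (grSpan _ (linearIndependent_vertex (isoBasis hM))) =
      degPart (vertexIdeal L (M.mulVec (Pi.single 0 1))) 3 := by
  have e : (cubics (grSpan _ (linearIndependent_vertex (isoBasis hM))) : Set T) =
      {g | g ∈ W ∧ (∀ z ∈ L, eval z g = 0) ∧ MultGE g ⊤ (M.mulVec (Pi.single 0 1)) 2} := by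
    have hev : ∀ g : T, (∀ z ∈ L, eval z g = 0) ↔ ∀ z ∈ coordLine, eval z (sub M g) = 0 :=
        fun g => by
      simp only [eval_sub]
      constructor
      · exact fun h z hz => h _ ((hL z).2 hz)
      · intro h z hz
        have hz' : z = M.mulVec ((isomInv M).mulVec z) := by
          rw [Matrix.mulVec_mulVec, hM.mul_inv, Matrix.one_mulVec]
        rw [hz']
        exact h _ ((hL _).1 (hz' ▸ hz))
    ext g
    constructor
    · rintro ⟨x, hx, rfl⟩
      have hW := hM.sub_mem_W x.2
      obtain ⟨h00, h10, h20, h30, h01, h11⟩ := (mem_vertex_iff _ x).1 hx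
      refine ⟨x.2, (hev _).2 ((eval_coordLine_iff hW).2 ⟨h00, h10, h20, h30⟩), ?_⟩
      exact (MultGE_mulVec_iff hM (N' := ⊤) (fun _ => Iff.rfl) _ _).2
        ((multGE_top_two_iff hW).2 ⟨h00, h10, h01, h11⟩)
    · rintro ⟨hg, h1, h2⟩
      have hW := hM.sub_mem_W hg
      obtain ⟨h00, h10, h20, h30⟩ := (eval_coordLine_iff hW).1 ((hev _).1 h1)
      obtain ⟨-, -, h01, h11⟩ := (multGE_top_two_iff hW).1
        ((MultGE_mulVec_iff hM (N' := ⊤) (fun _ => Iff.rfl) _ _).1 h2)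
      exact ⟨⟨g, hg⟩, (mem_vertex_iff _ _).2 ⟨h00, h10, h20, h30, h01, h11⟩, rfl⟩
  rw [vertexIdeal, ← e, degPart_span]
  rintro _ ⟨x, -, rfl⟩
  exact x.2.1

end Components

end Apolar

end

theorem mainTheorem11 (p : Fin 4 → ℂ) (hp : p ≠ 0)
    (L : Submodule ℂ (Fin 4 → ℂ)) (hL : Module.finrank ℂ L = 2)
    (hLQ : ∀ z ∈ L, MvPolynomial.eval z Apolar.qInv = 0) (hpL : p ∈ L) :
    ∃ V₀ V₁ : Set (Apolar.Gr 10 Apolar.W),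
      (∀ Z, Apolar.IsV0 p Z ↔ Z = V₀) ∧ (∀ Z, Apolar.IsV1 L p Z ↔ Z = V₁) ∧
      ∃ v : Apolar.Gr 10 Apolar.W,
        Apolar.cubics v = Apolar.degPart (Apolar.vertexIdeal L p) 3 ∧
        Apolar.IsConeOverConic (Apolar.plucker v) (Apolar.plucker '' (V₀ ∩ V₁)) := by
  obtain ⟨M, hM, rfl, hLM⟩ := Apolar.exists_isIsom hp hL hLQ hpL
  exact ⟨_, _, Apolar.isV0_iff hM, Apolar.isV1_iff hM hLM, _, Apolar.cubics_vertex hM hLM,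
    Apolar.isConeOverConic_inter _ _ (Apolar.linearIndependent_vertex _) rfl⟩
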